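/- Let $k$ be a field of characteristic $0$ and let $\mathcal C$ be a $k$-linear abelian braided monoidal category with $k$-bilinear tensor product, having countable coproducts that are preserved by $\otimes$ in each variable. Let $B_n$ be the braid group on $n$ strands, acting on the left on $V^{\otimes n}$ through the braiding; an object $V$ is *finitely braided* if, for each $n$, this action factors through a finite quotient of $B_n$. For $p+q=n$ let $S_{p,q}=\sum_\tau\widetilde\tau\in k[B_n]$, where $\tau$ runs over the $(p,q)$-unshuffles and $\widetilde\tau$ is the lift of $\tau$ to $B_n$ along a reduced word. The profinite braided associative operad $\widehat{\mathrm{BrAss}}$ has as $n$-th term the inverse system $\{k[Q]\}$ of group rings of the finite quotients $Q$ of $B_n$, with right action of $B_n$ by multiplication and operadic composition induced by cabling of braids. Let $\mathrm{BrPrim}_*\le\widehat{\mathrm{BrAss}}$ be given by $\mathrm{BrPrim}_*(0)=0$, $\mathrm{BrPrim}_*(1)=k$ and, for $n>1$, at the level $Q$, $$\mathrm{BrPrim}_*(n)_Q=\bigcap_{p+q=n,\;p,q>0}\ker\bigl(S_{p,q}\cdot\colon k[Q]\to k[Q]\bigr).$$ For a bialgebra $A$ in $\mathcal C$ let $P(A)=\ker(\Delta-\mathrm{id}\otimes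 1-1\otimes\mathrm{id})$. For $V\in\mathcal C$ let $T(V)=\bigoplus_n V^{\otimes n}$ be the tensor algebra, with the bialgebra structure for which $V$ is primitive. The assignment $PT\colon V\mapsto P(T(V))$ is a monad on $\mathcal C$, with unit the inclusion $V\to P(T(V))$ and multiplication the restriction to primitives of the algebra map $T(P(T(V)))\to T(V)$ extending the inclusion of $P(T(V))$. Then: 1. $\mathrm{BrPrim}_*$ contains the operadic unit and is closed under operadic composition, so that it is a unital suboperad of $\widehat{\mathrm{BrAss}}$. 2. For finitely braided $V$ the pro-object $\mathrm{BrPrim}_*[V]=\bigoplus_n \mathrm{BrPrim}_*(n)\otimes_{B_n}V^{\otimes n}$ is isomorphic to a constant one, and $\mathrm{BrPrim}_*$ defines a monad on finitely braided objects: $V\mapsto \mathrm{BrPrim}_*[V]$ carries a $\mathrm{BrPrim}_*$-algebra structure whose operations on the generators $V$ are $(\alpha,x)\mapsto\alpha\otimes x$, and every morphism $V\to\mathrm{BrPrim}_*[W]$, with $V, W$ finitely braided, extends along the unit $V\to\mathrm{BrPrim}_*[V]$ to a morphism of $\mathrm{BrPrim}_*$-algebras $\mathrm{BrPrim}_*[V]\to\mathrm{BrPrim}_*[W]$,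 in a way that satisfies the laws of a Kleisli triple. (Since the values need not be finitely braided, this is a monad relative to the inclusion of the finitely braided objects into $\mathcal C$.) 3. This monad is isomorphic, compatibly with units and Kleisli extensions, to the restriction of $PT$ to the finitely braided objects. 4. If $A$ is a finitely braided bialgebra in $\mathcal C$ (in particular, if $A$ is a finitely braided Hopf algebra), then $P(A)$ is a $\mathrm{BrPrim}_*$-algebra. Explicitly, $\alpha\in\mathrm{BrPrim}_*(n)$ acts by the restriction to $P(A)^{\otimes n}$ of the action of $\alpha$ on $A^{\otimes n}$ followed by the $n$-fold multiplication of $A$, and the operations of arity $n$ factor through some level $\mathrm{BrPrim}_*(n)_Q$. -/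

import Mathlib

open CategoryTheory MonoidalCategory Limits

universe v u

namespace BraidedPrim

/-! ### Braid groups -/

/-- The defining relations of the braid group on `n` strands; the generator with index `i`
(counted from `0`) braids the strands in positions `i` and `i + 1`. -/
inductive BraidRel (n : ℕ) : FreeGroup (Fin (n - 1)) → Prop
  | braid (i j : Fin (n - 1)) (h : i.1 + 1 = j.1) :
      BraidRel n (.of i * .of j * .of i * (.of j * .of i * .of j)⁻¹)
  | comm (i j : Fin (n - 1)) (h : i.1 + 1 < j.1) :
      BraidRel n (.of i * .of j * (.of j * .of i)⁻¹)

/-- The braid group on `n` strands. -/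
abbrev B (n : ℕ) : Type := PresentedGroup {w | BraidRel n w}

/-- The Artin generator in position `i`, with the convention that it is `1` if there are no
strands in the positions `i` and `i + 1`. -/
def σ (n i : ℕ) : B n := if h : i < n - 1 then PresentedGroup.of ⟨i, h⟩ else 1

theorem σ_of (n : ℕ) (i : Fin (n - 1)) : σ n i = PresentedGroup.of i := by
  simp [σ]

theorem σ_comm (n i j : ℕ) (h : i + 1 < j) : σ n i * σ n j = σ n j * σ n i := by
  by_cases h2 : j < n - 1
  swap
  · simp [σ, h2]
  have h1 : i < n - 1 := by omega
  unfold σ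
  rw [dif_pos h1, dif_pos h2]
  have := PresentedGroup.one_of_mem (rels := {w | BraidRel n w})
    (BraidRel.comm ⟨i, h1⟩ ⟨j, h2⟩ h)
  rw [map_mul, map_inv, mul_inv_eq_one] at this
  exact this

theorem σ_braid (n i : ℕ) (h : i + 2 < n) :
    σ n i * σ n (i + 1) * σ n i = σ n (i + 1) * σ n i * σ n (i + 1) := by
  have h1 : i < n - 1 := by omega
  have h2 : i + 1 < n - 1 := by omega
  unfold σ
  rw [dif_pos h1, dif_pos h2]
  have := PresentedGroup.one_of_mem (rels := {w | BraidRel n w})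
    (BraidRel.braid ⟨i, h1⟩ ⟨i + 1, h2⟩ rfl)
  rw [map_mul, map_inv, mul_inv_eq_one] at this
  exact this

/-- A family of elements satisfying the braid relations defines a homomorphism on `B n`. -/
def braidLift {G : Type*} [Group G] (n : ℕ) (s : ℕ → G)
    (hb : ∀ i, i + 2 < n → s i * s (i + 1) * s i = s (i + 1) * s i * s (i + 1))
    (hc : ∀ i j, i + 1 < j → j + 1 < n → s i * s j = s j * s i) : B n →* G :=
  PresentedGroup.toGroup (f := fun i : Fin (n - 1) => s i) (by
    rintro _ (⟨i, j, h⟩ | ⟨i, j, h⟩)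
    · have := hb i.1 (by omega)
      simp only [map_mul, map_inv, FreeGroup.lift_apply_of, ← h, mul_inv_eq_one]
      exact this
    · have := hc i.1 j.1 h (by omega)
      simp only [map_mul, map_inv, FreeGroup.lift_apply_of, mul_inv_eq_one]
      exact this)

theorem braidLift_σ {G : Type*} [Group G] (n : ℕ) (s : ℕ → G) (hb) (hc) (i : ℕ)
    (hi : i + 1 < n) : braidLift n s hb hc (σ n i) = s i := by
  rw [σ, dif_pos (by omega)]
  exact PresentedGroup.toGroup.of _

/-- Adding strands: `B n → B N` carries the generator in position `i` to the one in position
`j + i`, provided that `j + n ≤ N`. -/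
def shift (n N j : ℕ) (h : j + n ≤ N) : B n →* B N :=
  braidLift n (fun i => σ N (j + i)) (fun i hi => σ_braid N (j + i) (by omega))
    (fun i k hik _ => σ_comm N (j + i) (j + k) (by omega))

/-! ### Matsumoto lifts and unshuffles -/

/-- The braid `σ_j σ_{j+1} ⋯ σ_{j+c-1}`, which moves the strand in position `j + c` to the left,
past the `c` strands in the positions `j, …, j + c - 1`. -/
def up (n j : ℕ) : ℕ → B n
  | 0 => 1
  | c + 1 => up n j c * σ n (j + c)

/-- The braid `σ_{j+c-1} ⋯ σ_{j+1} σ_j`, which moves the strand in position `j` to the right,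
past the `c` strands in the positions `j + 1, …, j + c`. -/
def down (n j : ℕ) : ℕ → B n
  | 0 => 1
  | c + 1 => σ n (j + c) * down n j c

/-- The number of strands starting to the left of `j` that `τ` moves to the right of `j`. -/
def crossings {n : ℕ} (τ : Equiv.Perm (Fin n)) (j : Fin n) : ℕ :=
  (Finset.univ.filter fun i : Fin n => i < j ∧ τ j < τ i).card

/-- The Matsumoto lift of a permutation: the product of the Artin generators along the reduced
word of `τ` given by insertion sort, that is, the strands `0, 1, 2, …` are successively moved to the
left past the preceding strands that they cross.  The word is reduced as its length is the number
of inversions of `τ`; all reduced words of `τ` give the same braid. -/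
def matsumoto {n : ℕ} (τ : Equiv.Perm (Fin n)) : B n :=
  ((List.finRange n).reverse.map fun j : Fin n => up n (j - crossings τ j) (crossings τ j)).prod

/-- The `(p, n - p)`-unshuffles: the inverses of those permutations which are increasing on
the first `p` positions and on the last `n - p` positions. -/
def unshuffles (n p : ℕ) : Finset (Equiv.Perm (Fin n)) :=
  Finset.univ.filter fun τ =>
    ∀ i j : Fin n, i < j → (j.1 < p ∨ p ≤ i.1) → τ⁻¹ i < τ⁻¹ j

/-- The element `S_{p, n - p}` of the group ring of the braid group. -/
noncomputable def shuffleElt (k : Type*) [Field k] (n p : ℕ) : MonoidAlgebra k (B n) :=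
  ∑ τ ∈ unshuffles n p, MonoidAlgebra.single (matsumoto τ) 1

/-! ### Cabling -/

theorem σ_comm_up_right (N j c l : ℕ) (h : j + c < l) :
    σ N l * up N j c = up N j c * σ N l := by
  induction c with
  | zero => simp [up]
  | succ c ih =>
    rw [up, ← mul_assoc, ih (by omega), mul_assoc, mul_assoc, σ_comm N (j + c) l (by omega)]

theorem σ_comm_up_left (N j c l : ℕ) (h : l + 1 < j) :
    σ N l * up N j c = up N j c * σ N l := by
  induction c with
  | zero => simp [up]
  | succ c ih =>
    rw [up, ← mul_assoc, ih, mul_assoc, mul_assoc, σ_comm N l (j + c) (by omega)]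

theorem σ_comm_down_right (N j c l : ℕ) (h : j + c < l) :
    σ N l * down N j c = down N j c * σ N l := by
  induction c with
  | zero => simp [down]
  | succ c ih =>
    rw [down, mul_assoc, ← ih (by omega), ← mul_assoc, ← mul_assoc, σ_comm N (j + c) l (by omega)]

theorem σ_comm_down_left (N j c l : ℕ) (h : l + 1 < j) :
    σ N l * down N j c = down N j c * σ N l := by
  induction c with
  | zero => simp [down]
  | succ c ih =>
    rw [down, mul_assoc, ← ih, ← mul_assoc, ← mul_assoc, σ_comm N l (j + c) (by omega)]

theorem cable_braid_left (N k n : ℕ) (h : k + n + 1 < N) :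
    σ N k * up N (k + 1) n * up N k n = up N (k + 1) n * up N k n * σ N (k + n) := by
  induction n with
  | zero => simp [up]
  | succ n ih =>
    have e := σ_comm_up_right N k n (k + 1 + n) (by omega)
    have b := σ_braid N (k + n) (by omega)
    have i := ih (by omega)
    have e1 : k + (n + 1) = k + n + 1 := by omega
    have e2 : k + 1 + n = k + n + 1 := by omega
    rw [e2] at e
    simp only [up, e1, e2]
    calc _ = σ N k * up N (k + 1) n * (σ N (k + n + 1) * up N k n) * σ N (k + n) := by group
      _ = (σ N k * up N (k + 1) n * up N k n) * σ N (k + n + 1) * σ N (k + n) := by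
        rw [e]; group
      _ = up N (k + 1) n * up N k n * (σ N (k + n) * σ N (k + n + 1) * σ N (k + n)) := by
        rw [i]; group
      _ = up N (k + 1) n * (up N k n * σ N (k + n + 1)) * σ N (k + n) * σ N (k + n + 1) := by
        rw [b]; group
      _ = _ := by rw [← e]; group

theorem cable_braid_right (N k n : ℕ) (h : k + n + 1 < N) :
    down N k n * down N (k + 1) n * σ N k = σ N (k + n) * down N k n * down N (k + 1) n := by
  induction n with
  | zero => simp [down]
  | succ n ih =>
    have e := σ_comm_down_right N k n (k + 1 + n) (by omega)
    have b := σ_braid N (k + n) (by omega)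
    have i := ih (by omega)
    have e1 : k + (n + 1) = k + n + 1 := by omega
    have e2 : k + 1 + n = k + n + 1 := by omega
    rw [e2] at e
    simp only [down, e1, e2]
    calc _ = σ N (k + n) * (down N k n * σ N (k + n + 1)) * down N (k + 1) n * σ N k := by group
      _ = σ N (k + n) * σ N (k + n + 1) * (down N k n * down N (k + 1) n * σ N k) := by
        rw [← e]; group
      _ = (σ N (k + n) * σ N (k + n + 1) * σ N (k + n)) * down N k n * down N (k + 1) n := by
        rw [i]; group
      _ = σ N (k + n + 1) * σ N (k + n) * (σ N (k + n + 1) * down N k n) * down N (k + 1) n := by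
        rw [b]; group
      _ = _ := by rw [e]; group

theorem cable_braid_mid (N k n : ℕ) (h : k + n + 1 < N) :
    up N k n * σ N (k + n) * down N k n = down N (k + 1) n * σ N k * up N (k + 1) n := by
  induction n with
  | zero => simp [up, down]
  | succ n ih =>
    have e := σ_comm_down_right N k n (k + 1 + n) (by omega)
    have e' := σ_comm_up_right N k n (k + 1 + n) (by omega)
    have b := σ_braid N (k + n) (by omega)
    have i := ih (by omega)
    have e1 : k + (n + 1) = k + n + 1 := by omega
    have e2 : k + 1 + n = k + n + 1 := by omega
    rw [e2] at e e'
    simp only [up, down, e1, e2]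
    calc _ = up N k n * (σ N (k + n) * σ N (k + n + 1) * σ N (k + n)) * down N k n := by group
      _ = (up N k n * σ N (k + n + 1)) * σ N (k + n) * (σ N (k + n + 1) * down N k n) := by
        rw [b]; group
      _ = σ N (k + n + 1) * (up N k n * σ N (k + n) * down N k n) * σ N (k + n + 1) := by
        rw [← e', e]; group
      _ = _ := by rw [i]; group

/-- The braid in `B N` obtained from the generator in position `l` when the strand in position
`j` is replaced by `n` parallel strands. -/
def cableGen (N n l j : ℕ) : B N :=
  if j = l then up N l n
  else if j = l + 1 then down N l n
  else if j < l then σ N (l + n - 1)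
  else σ N l

/-- The transposition of `l` and `l + 1`. -/
def sw (l j : ℕ) : ℕ := if j = l then l + 1 else if j = l + 1 then l else j

theorem cableGen_braid (M N n k j : ℕ) (hN : N + 1 = M + n) (hk : k + 2 < M) (hj : j < M) :
    cableGen N n k (sw (k + 1) (sw k j)) * cableGen N n (k + 1) (sw k j) * cableGen N n k j =
      cableGen N n (k + 1) (sw k (sw (k + 1) j)) * cableGen N n k (sw (k + 1) j) *
        cableGen N n (k + 1) j := by
  have hlt : j < k ∨ j = k ∨ j = k + 1 ∨ j = k + 2 ∨ k + 2 < j := by omega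
  rcases hlt with h | rfl | rfl | rfl | h
  · have h1 : j ≠ k := by omega
    have h2 : j ≠ k + 1 := by omega
    have h3 : j ≠ k + 1 + 1 := by omega
    have h4 : j < k + 1 := by omega
    have := σ_braid N (k + n - 1) (by omega)
    rw [show k + n - 1 + 1 = k + 1 + n - 1 by omega] at this
    simpa [sw, cableGen, h1, h2, h3, h4, h] using this
  · have := cable_braid_left N j n (by omega)
    have e : j + 1 + n - 1 = j + n := by omega
    have f1 : j ≠ j + 1 + 1 := by omega
    have f2 : j + 1 + 1 ≠ j := by omega
    have f3 : ¬ j + 1 + 1 < j := by omega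
    simpa [sw, cableGen, e, f1, f2, f3] using this
  · have := cable_braid_mid N k n (by omega)
    have e : k + 1 + n - 1 = k + n := by omega
    have f1 : k ≠ k + 1 + 1 := by omega
    have f2 : k + 1 + 1 ≠ k := by omega
    have f3 : ¬ k + 1 + 1 < k := by omega
    simpa [sw, cableGen, e, f1, f2, f3] using this
  · have := cable_braid_right N k n (by omega)
    have e : k + 1 + n - 1 = k + n := by omega
    have f1 : k ≠ k + 1 + 1 := by omega
    have f2 : k + 1 + 1 ≠ k := by omega
    have f3 : ¬ k + 1 + 1 < k := by omega
    simpa [sw, cableGen, e, f1, f2, f3] using this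
  · have h1 : j ≠ k := by omega
    have h2 : j ≠ k + 1 := by omega
    have h3 : j ≠ k + 1 + 1 := by omega
    have h4 : ¬ j < k + 1 := by omega
    have h5 : ¬ j < k := by omega
    have := σ_braid N k (by omega)
    simpa [sw, cableGen, h1, h2, h3, h4, h5] using this

theorem cableGen_comm (N n k l j : ℕ) (hkl : k + 1 < l) :
    cableGen N n k (sw l j) * cableGen N n l j = cableGen N n l (sw k j) * cableGen N n k j := by
  have hlt : j < k ∨ j = k ∨ j = k + 1 ∨ (k + 1 < j ∧ j < l) ∨ j = l ∨ j = l + 1 ∨ l + 1 < j := by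
    omega
  rcases hlt with h | rfl | rfl | ⟨h, h'⟩ | rfl | rfl | h
  · have h1 : j ≠ k := by omega
    have h2 : j ≠ k + 1 := by omega
    have h3 : j ≠ l := by omega
    have h4 : j ≠ l + 1 := by omega
    have h5 : j < l := by omega
    simpa [sw, cableGen, h1, h2, h3, h4, h5, h] using σ_comm N (k + n - 1) (l + n - 1) (by omega)
  · have h3 : j ≠ l := by omega
    have h4 : j ≠ l + 1 := by omega
    have h5 : j + 1 ≠ l := by omega
    simpa [sw, cableGen, h3, h4, h5, hkl, show j < l by omega] using
      (σ_comm_up_right N j n (l + n - 1) (by omega)).symm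
  · have h3 : k ≠ l := by omega
    have h4 : k ≠ l + 1 := by omega
    have h5 : k + 1 ≠ l := by omega
    simpa [sw, cableGen, h3, h4, h5, hkl, show k < l by omega] using
      (σ_comm_down_right N k n (l + n - 1) (by omega)).symm
  · have h1 : j ≠ k := by omega
    have h2 : j ≠ k + 1 := by omega
    have h3 : j ≠ l := by omega
    have h4 : j ≠ l + 1 := by omega
    have h5 : ¬ j < k := by omega
    simpa [sw, cableGen, h1, h2, h3, h4, h5, h'] using σ_comm N k (l + n - 1) (by omega)
  · have h1 : j ≠ k := by omega
    have h2 : j ≠ k + 1 := by omega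
    have h3 : ¬ j < k := by omega
    have h4 : ¬ j + 1 < k := by omega
    have h5 : j + 1 ≠ k := by omega
    simpa [sw, cableGen, h1, h2, h3, h4, h5] using σ_comm_up_left N j n k (by omega)
  · have h1 : l ≠ k := by omega
    have h2 : l ≠ k + 1 := by omega
    have h3 : ¬ l < k := by omega
    have h4 : ¬ l + 1 < k := by omega
    have h5 : l + 1 ≠ k := by omega
    simpa [sw, cableGen, h1, h2, h3, h4, h5] using σ_comm_down_left N l n k (by omega)
  · have h1 : j ≠ k := by omega
    have h2 : j ≠ k + 1 := by omega
    have h3 : j ≠ l := by omega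
    have h4 : j ≠ l + 1 := by omega
    have h5 : ¬ j < k := by omega
    have h6 : ¬ j < l := by omega
    simpa [sw, cableGen, h1, h2, h3, h4, h5, h6] using σ_comm N k l (by omega)

theorem swap_val {M l : ℕ} (h : l + 1 < M) (j : Fin M) :
    (Equiv.swap (⟨l, by omega⟩ : Fin M) ⟨l + 1, h⟩ j).1 = sw l j.1 := by
  simp only [Equiv.swap_apply_def, Fin.ext_iff, sw]
  split_ifs <;> rfl

/-- The permutation `(j, g) ↦ (π j, c j * g)` of `Fin M × G`. -/
def wreathPerm {M : ℕ} {G : Type*} [Group G] (π : Equiv.Perm (Fin M)) (c : Fin M → G) :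
    Equiv.Perm (Fin M × G) where
  toFun x := (π x.1, c x.1 * x.2)
  invFun x := (π⁻¹ x.1, (c (π⁻¹ x.1))⁻¹ * x.2)
  left_inv x := by simp
  right_inv x := by simp

theorem wreathPerm_mul {M : ℕ} {G : Type*} [Group G] (π π' : Equiv.Perm (Fin M))
    (c c' : Fin M → G) : wreathPerm π c * wreathPerm π' c' =
      wreathPerm (π * π') (fun j => c (π' j) * c' j) := by
  ext1 x
  simp [wreathPerm, mul_assoc]

theorem swap_braid {M k : ℕ} (h : k + 2 < M) :
    Equiv.swap (⟨k, by omega⟩ : Fin M) ⟨k + 1, by omega⟩ * Equiv.swap ⟨k + 1, by omega⟩ ⟨k + 2, h⟩ *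
      Equiv.swap ⟨k, by omega⟩ ⟨k + 1, by omega⟩ =
    Equiv.swap (⟨k + 1, by omega⟩ : Fin M) ⟨k + 2, h⟩ * Equiv.swap ⟨k, by omega⟩ ⟨k + 1, by omega⟩ *
      Equiv.swap ⟨k + 1, by omega⟩ ⟨k + 2, h⟩ := by
  ext j
  simp only [Equiv.Perm.coe_mul, Function.comp_apply, swap_val, sw]
  split_ifs <;> omega

theorem swap_comm' {M k l : ℕ} (hkl : k + 1 < l) (h : l + 1 < M) :
    Equiv.swap (⟨k, by omega⟩ : Fin M) ⟨k + 1, by omega⟩ * Equiv.swap ⟨l, by omega⟩ ⟨l + 1, h⟩ =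
    Equiv.swap (⟨l, by omega⟩ : Fin M) ⟨l + 1, h⟩ *
      Equiv.swap ⟨k, by omega⟩ ⟨k + 1, by omega⟩ := by
  ext j
  simp only [Equiv.Perm.coe_mul, Function.comp_apply, swap_val, sw]
  split_ifs <;> omega

/-- Cabling.  Let `N + 1 = M + n`.  A braid `γ` on `M` strands together with a position `i` gives
a braid on `N` strands, by replacing the strand of `γ` that starts in position `i` by `n` parallel
strands.  It is encoded here (after applying a homomorphism `φ : B N →* G`) by the action
`γ • (i, g) = (i', φ c * g)` on `Fin M × G`, where `i'` is the position in which this strand ends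
and `c` is the cabled braid. -/
def cable {G : Type*} [Group G] {M N n : ℕ} (hN : N + 1 = M + n) (φ : B N →* G) :
    B M →* Equiv.Perm (Fin M × G) :=
  braidLift M (fun l => if h : l + 1 < M then
      wreathPerm (Equiv.swap ⟨l, by omega⟩ ⟨l + 1, h⟩) (fun j => φ (cableGen N n l j)) else 1)
    (by
      intro k hk
      rw [dif_pos (by omega), dif_pos (by omega)]
      simp only [wreathPerm_mul]
      rw [swap_braid hk]
      congr 1
      funext j
      simp only [← map_mul, swap_val]
      rw [cableGen_braid M N n k j hN hk j.2])
    (by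
      intro k l hkl hl
      rw [dif_pos (by omega), dif_pos (by omega)]
      simp only [wreathPerm_mul]
      rw [swap_comm' hkl hl]
      congr 1
      funext j
      simp only [← map_mul, swap_val]
      rw [cableGen_comm N n k l j hkl])

/-- The braid `γ ∘_i ρ`, for `γ : B (i + 1 + r)` and `ρ : B n`: the strand of `γ` that starts in
position `i` is replaced by `n` parallel strands, braided by `ρ`.  (Positions are counted from
`0`.) -/
def cabling (i r : ℕ) {n : ℕ} (γ : B (i + 1 + r)) (ρ : B n) : B (i + n + r) :=
  let x := cable (show (i + n + r) + 1 = (i + 1 + r) + n by omega) (MonoidHom.id _) γ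
    (⟨i, by omega⟩, 1)
  shift n (i + n + r) x.1.1 (by have := x.1.2; omega) ρ * x.2
/-! ### Tensor powers and the braid group action -/

section TensorPower

variable {C : Type u} [Category.{v} C] [MonoidalCategory C]

/-- The tensor powers `V^{⊗ n} = (⋯((𝟙 ⊗ V) ⊗ V) ⋯ ) ⊗ V`. -/
def tp (V : C) : ℕ → C
  | 0 => 𝟙_ C
  | n + 1 => tp V n ⊗ V

/-- The tensor powers of a morphism. -/
def tpMap {V W : C} (f : V ⟶ W) : ∀ n, tp V n ⟶ tp W n
  | 0 => 𝟙 _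
  | n + 1 => tpMap f n ⊗ₘ f

/-- The canonical isomorphism `V^{⊗ p} ⊗ V^{⊗ q} ≅ V^{⊗ (p + q)}`. -/
def tpAdd (V : C) (p : ℕ) : ∀ q, tp V p ⊗ tp V q ≅ tp V (p + q)
  | 0 => ρ_ _
  | q + 1 => (α_ _ _ _).symm ≪≫ whiskerRightIso (tpAdd V p q) V

/-- For `g : A^{⊗ n} ⟶ A`, the morphism `id^{⊗ i} ⊗ g ⊗ id^{⊗ r}`. -/
def tpInsert {A : C} (i n r : ℕ) (g : tp A n ⟶ A) : tp A (i + n + r) ⟶ tp A (i + 1 + r) :=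
  (tpAdd A (i + n) r).inv ≫ (((tpAdd A i n).inv ≫ tp A i ◁ g) ▷ tp A r) ≫
    (tpAdd A (i + 1) r).hom

theorem whiskerRight_braid {X : C} (V : C) {a b : X ⟶ X} (h : a ≫ b ≫ a = b ≫ a ≫ b) :
    a ▷ V ≫ b ▷ V ≫ a ▷ V = b ▷ V ≫ a ▷ V ≫ b ▷ V := by
  simp only [← comp_whiskerRight, h]

theorem whiskerRight_comm {X : C} (V : C) {a b : X ⟶ X} (h : a ≫ b = b ≫ a) :
    a ▷ V ≫ b ▷ V = b ▷ V ≫ a ▷ V := by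
  simp only [← comp_whiskerRight, h]

variable [BraidedCategory C]

/-- The braiding of the tensor factors in the positions `i` and `i + 1` of `V^{⊗ n}`. -/
def braidGen (V : C) : ∀ (n _ : ℕ), tp V n ≅ tp V n
  | 0, _ => Iso.refl _
  | 1, _ => Iso.refl _
  | n + 2, i =>
    if i = n then α_ (tp V n) V V ≪≫ whiskerLeftIso (tp V n) (β_ V V) ≪≫ (α_ (tp V n) V V).symm
    else whiskerRightIso (braidGen V (n + 1) i) V

theorem braidGen_last (V : C) (n : ℕ) : braidGen V (n + 2) n =
    α_ (tp V n) V V ≪≫ whiskerLeftIso (tp V n) (β_ V V) ≪≫ (α_ (tp V n) V V).symm := by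
  exact if_pos rfl

theorem braidGen_ne (V : C) (n i : ℕ) (h : i ≠ n) : braidGen V (n + 2) i =
    whiskerRightIso (braidGen V (n + 1) i) V := by
  exact if_neg h

theorem yb_aux (T V : C) :
    let s : (T ⊗ V) ⊗ V ⟶ (T ⊗ V) ⊗ V := (α_ T V V).hom ≫ T ◁ (β_ V V).hom ≫ (α_ T V V).inv
    let t : ((T ⊗ V) ⊗ V) ⊗ V ⟶ ((T ⊗ V) ⊗ V) ⊗ V :=
      (α_ (T ⊗ V) V V).hom ≫ (T ⊗ V) ◁ (β_ V V).hom ≫ (α_ (T ⊗ V) V V).inv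
    s ▷ V ≫ t ≫ s ▷ V = t ≫ s ▷ V ≫ t := by
  intro s t
  let e : ((T ⊗ V) ⊗ V) ⊗ V ≅ T ⊗ ((V ⊗ V) ⊗ V) :=
    whiskerRightIso (α_ T V V) V ≪≫ α_ T (V ⊗ V) V
  have h1 : s ▷ V = e.hom ≫ T ◁ ((β_ V V).hom ▷ V) ≫ e.inv := by
    simp [s, e]
  have h2 : t = e.hom ≫ T ◁ ((α_ V V V).hom ≫ V ◁ (β_ V V).hom ≫ (α_ V V V).inv) ≫ e.inv := by
    simp [t, e]
  rw [h1, h2]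
  simp only [Category.assoc, Iso.inv_hom_id_assoc, ← whiskerLeft_comp_assoc]
  congr 1
  refine congrArg (fun f => T ◁ f ≫ e.inv) ?_
  rw [← cancel_mono (α_ V V V).hom, ← cancel_epi (α_ V V V).inv]
  simpa using BraidedCategory.yang_baxter V V V

theorem far_aux {T : C} (V : C) (a : T ⟶ T) :
    (a ▷ V) ▷ V ≫ (α_ T V V).hom ≫ T ◁ (β_ V V).hom ≫ (α_ T V V).inv =
      ((α_ T V V).hom ≫ T ◁ (β_ V V).hom ≫ (α_ T V V).inv) ≫ (a ▷ V) ▷ V := by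
  have h : (a ▷ V) ▷ V = (α_ T V V).hom ≫ a ▷ (V ⊗ V) ≫ (α_ T V V).inv := by simp
  rw [h]
  simp only [Category.assoc, Iso.inv_hom_id_assoc, whisker_exchange_assoc]

theorem braidGen_braid (V : C) (n i : ℕ) (h : i + 2 < n) :
    (braidGen V n i).hom ≫ (braidGen V n (i + 1)).hom ≫ (braidGen V n i).hom =
      (braidGen V n (i + 1)).hom ≫ (braidGen V n i).hom ≫ (braidGen V n (i + 1)).hom := by
  induction n with
  | zero => omega
  | succ n ih =>
    obtain ⟨m, rfl⟩ : ∃ m, n = m + 2 := ⟨n - 2, by omega⟩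
    rw [braidGen_ne V (m + 1) i (by omega)]
    by_cases hi : i = m
    · subst hi
      rw [braidGen_last V (i + 1), braidGen_last V i]
      exact yb_aux (tp V i) V
    · rw [braidGen_ne V (m + 1) (i + 1) (by omega)]
      exact whiskerRight_braid V (ih (by omega))

theorem braidGen_comm (V : C) (n i j : ℕ) (hij : i + 1 < j) (h : j + 1 < n) :
    (braidGen V n i).hom ≫ (braidGen V n j).hom =
      (braidGen V n j).hom ≫ (braidGen V n i).hom := by
  induction n with
  | zero => omega
  | succ n ih =>
    obtain ⟨m, rfl⟩ : ∃ m, n = m + 3 := ⟨n - 3, by omega⟩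
    rw [braidGen_ne V (m + 2) i (by omega)]
    by_cases hj : j = m + 2
    · subst hj
      rw [braidGen_last V (m + 2), braidGen_ne V (m + 1) i (by omega)]
      exact far_aux V (braidGen V (m + 2) i).hom
    · rw [braidGen_ne V (m + 2) j (by omega)]
      exact whiskerRight_comm V (ih (by omega))

/-- The (left) action of the braid group `B n` on `V^{⊗ n}`. -/
def braidAction (V : C) (n : ℕ) : B n →* Aut (tp V n) :=
  braidLift n (braidGen V n)
    (fun i hi => Iso.ext (braidGen_braid V n i hi))
    (fun i j hij hj => Iso.ext (braidGen_comm V n i j hij hj).symm)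

/-- An object is finitely braided if, for each `n`, the action of `B n` on `V^{⊗ n}` factors
through a finite quotient of `B n`. -/
def FinitelyBraided : ObjectProperty C := fun V => ∀ n, Finite (braidAction V n).range

end TensorPower
/-! ### The profinite braided associative operad and its braided subsequences -/

section Operad

/-- The finite quotients `Q` of the braid group `B n`, given by the finite index normal subgroups
`ker Q`, ordered by inclusion. -/
abbrev FinQuot (n : ℕ) : Type := FiniteIndexNormalSubgroup (B n)

instance (n : ℕ) : Nonempty (FinQuot n) := ⟨FiniteIndexNormalSubgroup.ofSubgroup ⊤⟩

variable (k : Type*) [Field k]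

/-- The group ring `k[Q]` of a finite quotient `Q` of `B n`. -/
abbrev GroupRing {n : ℕ} (Q : FinQuot n) : Type _ := MonoidAlgebra k (B n ⧸ Q.toSubgroup)

/-- The projection `k[B n] → k[Q]`. -/
noncomputable def toLevel {n : ℕ} (Q : FinQuot n) :
    MonoidAlgebra k (B n) →ₐ[k] GroupRing k Q :=
  MonoidAlgebra.mapDomainAlgHom k k (QuotientGroup.mk' Q.toSubgroup)

/-- The transition maps `k[P] → k[Q]` of the pro-object `{k[Q]}`. -/
noncomputable def levelMap {n : ℕ} {P Q : FinQuot n} (h : P ≤ Q) :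
    GroupRing k P →ₐ[k] GroupRing k Q :=
  MonoidAlgebra.mapDomainAlgHom k k
    (QuotientGroup.map P.toSubgroup Q.toSubgroup (MonoidHom.id (B n)) h)

theorem levelMap_toLevel {n : ℕ} {P Q : FinQuot n} (h : P ≤ Q) (a : MonoidAlgebra k (B n)) :
    levelMap k h (toLevel k P a) = toLevel k Q a := by
  have : (levelMap k h).comp (toLevel k P) = toLevel k Q := by
    unfold levelMap toLevel
    rw [← MonoidAlgebra.mapDomainAlgHom_comp]
    rfl
  exact DFunLike.congr_fun this a

/-- The class of a braid in `k[Q]`. -/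
noncomputable def braidClass {n : ℕ} (Q : FinQuot n) (g : B n) : GroupRing k Q :=
  toLevel k Q (MonoidAlgebra.single g 1)

/-- A braided subsequence of the profinite braided associative operad, whose `n`-th term is the
pro-vector space `{k[Q]}` indexed by the finite quotients `Q` of `B n`: a subspace at each level,
compatible with the transition maps and stable under the right action of the braid groups. -/
structure BraidedSubseq where
  /-- the subspace of `k[Q]` -/
  level : ∀ {n : ℕ} (Q : FinQuot n), Submodule k (GroupRing k Q)
  levelMap_mem : ∀ {n : ℕ} {P Q : FinQuot n} (h : P ≤ Q) (a : GroupRing k P),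
    a ∈ level P → levelMap k h a ∈ level Q
  mul_mem : ∀ {n : ℕ} (Q : FinQuot n) (a : GroupRing k Q) (g : B n),
    a ∈ level Q → a * braidClass k Q g ∈ level Q

/-- The levels of the unital braided primitive operad: `0` in arity `0`, everything (that is, `k`)
in arity `1`, and in arity `n > 1` the intersection over all `p + q = n` with `p, q > 0` of the
kernels of the left multiplication by `S_{p,q}` on `k[Q]`. -/
noncomputable def brPrimLevel : ∀ {n : ℕ} (Q : FinQuot n), Submodule k (GroupRing k Q)
  | 0, _ => ⊥
  | 1, _ => ⊤
  | n + 2, Q => ⨅ p ∈ Finset.Ioo 0 (n + 2),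
      LinearMap.ker (LinearMap.mulLeft k (toLevel k Q (shuffleElt k (n + 2) p)))

/-- The unital braided primitive operad, as a braided subsequence. -/
noncomputable def brPrim : BraidedSubseq k where
  level := brPrimLevel k
  levelMap_mem := by
    rintro (_ | _ | n) P Q h a ha
    · simp only [brPrimLevel, Submodule.mem_bot] at ha ⊢
      rw [ha, map_zero]
    · trivial
    · simp only [brPrimLevel, Submodule.mem_iInf, LinearMap.mem_ker,
        LinearMap.mulLeft_apply] at ha ⊢
      intro p hp
      rw [← levelMap_toLevel k h, ← map_mul, ha p hp, map_zero]
  mul_mem := by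
    rintro (_ | _ | n) Q a g ha
    · simp only [brPrimLevel, Submodule.mem_bot] at ha ⊢
      rw [ha, zero_mul]
    · trivial
    · simp only [brPrimLevel, Submodule.mem_iInf, LinearMap.mem_ker,
        LinearMap.mulLeft_apply] at ha ⊢
      intro p hp
      rw [← mul_assoc, ha p hp, zero_mul]

/-- Families of elements of the group rings of the finite quotients of `B n`. -/
abbrev Family (n : ℕ) : Type _ := ∀ Q : FinQuot n, GroupRing k Q

variable {k}

/-- The elements of arity `n` of a braided subsequence: the inverse limit of its levels. -/
noncomputable def BraidedSubseq.elements (O : BraidedSubseq k) (n : ℕ) :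
    Submodule k (Family k n) where
  carrier := {a | (∀ Q, a Q ∈ O.level Q) ∧ ∀ (P Q : FinQuot n) (h : P ≤ Q), levelMap k h (a P) = a Q}
  zero_mem' := ⟨fun Q => (O.level Q).zero_mem, fun P Q h => map_zero _⟩
  add_mem' ha hb := ⟨fun Q => (O.level Q).add_mem (ha.1 Q) (hb.1 Q), fun P Q h => by
    simp only [Pi.add_apply, map_add, ha.2 P Q h, hb.2 P Q h]⟩
  smul_mem' c a ha := ⟨fun Q => (O.level Q).smul_mem c (ha.1 Q), fun P Q h => by
    simp only [Pi.smul_apply, map_smul, ha.2 P Q h]⟩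

/-- The right action of a braid on the elements of a braided subsequence. -/
noncomputable def BraidedSubseq.act (O : BraidedSubseq k) {n : ℕ} (a : O.elements n) (g : B n) :
    O.elements n :=
  ⟨fun Q => a.1 Q * braidClass k Q g, fun Q => O.mul_mem Q _ g (a.2.1 Q), fun P Q h => by
    rw [map_mul, a.2.2 P Q h, braidClass, levelMap_toLevel]
    rfl⟩

/-- The finite quotient of `B (i + 1 + r)` through which the cabling of a strand by `n` strands,
with values in the finite quotient `R` of `B (i + n + r)`, factors. -/
noncomputable def outerQuot (i n r : ℕ) (R : FinQuot (i + n + r)) : FinQuot (i + 1 + r) :=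
  FiniteIndexNormalSubgroup.ofSubgroup
    (cable (show (i + n + r) + 1 = (i + 1 + r) + n by omega) (QuotientGroup.mk' R.toSubgroup)).ker

/-- The finite quotient of `B n` through which the maps
`B n → B (i + n + r) → R` given by adding strands factor. -/
noncomputable def innerQuot (i n r : ℕ) (R : FinQuot (i + n + r)) : FinQuot n :=
  haveI : (⨅ j : Fin (i + 1 + r), (FiniteIndexNormalSubgroup.comap
      (shift n (i + n + r) j (by omega)) R).toSubgroup).Normal :=
    Subgroup.normal_iInf_normal fun _ => inferInstance
  haveI : (⨅ j : Fin (i + 1 + r), (FiniteIndexNormalSubgroup.comap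
      (shift n (i + n + r) j (by omega)) R).toSubgroup).FiniteIndex :=
    Subgroup.finiteIndex_iInf fun _ => inferInstance
  FiniteIndexNormalSubgroup.ofSubgroup (⨅ j : Fin (i + 1 + r), (FiniteIndexNormalSubgroup.comap
      (shift n (i + n + r) j (by omega)) R).toSubgroup)

/-- The operadic composition `a ∘_i b` of the profinite braided associative operad, in which the
operation `b` of arity `n` is inserted in the position `i` of the operation `a` of arity
`i + 1 + r`: the bilinear extension of cabling, computed in the finite quotient `R` from
sufficiently large finite quotients of `B (i + 1 + r)` and `B n`. -/
noncomputable def operadComp (i n r : ℕ) (a : Family k (i + 1 + r)) (b : Family k n) :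
    Family k (i + n + r) := fun R =>
  (a (outerQuot i n r R)).coeff.sum fun x s => (b (innerQuot i n r R)).coeff.sum fun y t =>
    (s * t) • braidClass k R (cabling i r x.out y.out)

/-- A braided subsequence is a (unital) suboperad of the profinite braided associative operad if
its elements contain the operadic unit and are closed under operadic composition. -/
structure IsSuboperad (O : BraidedSubseq k) : Prop where
  one_mem : (fun _ => 1 : Family k 1) ∈ O.elements 1
  comp_mem : ∀ (i n r : ℕ) (a : Family k (i + 1 + r)) (b : Family k n),
    a ∈ O.elements (i + 1 + r) → b ∈ O.elements n → operadComp i n r a b ∈ O.elements (i + n + r)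

end Operad
/-! ### Pro-objects and Artin functors -/

/-- A pro-object of `C`: a functor to `C` from a small cofiltered category. -/
structure ProObject (C : Type u) [Category.{v} C] where
  /-- the indexing category -/
  I : Type
  [cat : SmallCategory I]
  [cofiltered : IsCofiltered I]
  /-- the inverse system -/
  F : I ⥤ C

namespace ProObject

variable {C : Type u} [Category.{v} C]

attribute [instance] ProObject.cat ProObject.cofiltered

/-- The functor `Y ↦ colim_i Hom(V_i, Y)`. -/
noncomputable def homFunctor (V : ProObject C) : C ⥤ Type v := colimit (V.F.op ⋙ coyoneda)

/-- Morphisms of pro-objects are the natural transformations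
`colim_j Hom(W_j, -) ⟶ colim_i Hom(V_i, -)`; by the Yoneda lemma,
`Hom(V, W) = lim_j colim_i Hom(V_i, W_j)`. -/
structure Hom (V W : ProObject C) where
  /-- the underlying natural transformation -/
  nat : W.homFunctor ⟶ V.homFunctor

noncomputable instance : Category (ProObject C) where
  Hom := Hom
  id V := ⟨𝟙 _⟩
  comp f g := ⟨g.nat ≫ f.nat⟩
  id_comp f := by cases f; simp
  comp_id f := by cases f; simp
  assoc f g h := by simp

/-- The constant pro-object. -/
def const (X : C) : ProObject C where
  I := PUnit
  F := (Functor.const _).obj X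

theorem ofCone_aux (V : ProObject C) (X : C) (f : ∀ i, X ⟶ V.F.obj i)
    (hf : ∀ {i j : V.I} (u : i ⟶ j), f i ≫ V.F.map u = f j) {i j : V.Iᵒᵖ} (u : i ⟶ j) :
    (V.F.op ⋙ coyoneda).map u ≫ (coyoneda.map (f j.unop).op ≫
      colimit.ι ((const X).F.op ⋙ coyoneda) (.op PUnit.unit)) =
    (coyoneda.map (f i.unop).op ≫ colimit.ι ((const X).F.op ⋙ coyoneda) (.op PUnit.unit)) ≫
      𝟙 _ := by
  rw [← hf u.unop, op_comp, Functor.map_comp, Category.comp_id]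
  exact (Category.assoc _ _ _).symm

/-- The morphism from a constant pro-object given by a compatible family of morphisms. -/
noncomputable def ofCone (V : ProObject C) (X : C) (f : ∀ i, X ⟶ V.F.obj i)
    (hf : ∀ {i j : V.I} (u : i ⟶ j), f i ≫ V.F.map u = f j) : const X ⟶ V where
  nat := colimit.desc (V.F.op ⋙ coyoneda)
    { pt := (const X).homFunctor
      ι := { app := fun i => coyoneda.map (f i.unop).op ≫
               colimit.ι ((const X).F.op ⋙ coyoneda) (.op PUnit.unit)
             naturality := fun _ _ u => ofCone_aux V X f hf u } }

/-- The functor carrying an object to the constant pro-object. -/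
noncomputable def constMap {X Y : C} (f : X ⟶ Y) : const X ⟶ const Y :=
  ofCone (const Y) X (fun _ => f) (fun _ => Category.comp_id f)

end ProObject
/-! ### Artin functors -/

attribute [local instance] Abelian.hasFiniteBiproducts

section Copower

variable {k : Type*} [Field k] {C : Type u} [Category.{v} C] [Abelian C] [Linear k C]

/-- The tensor product `M ⊗ X` of a finite-dimensional vector space with an object of a linear
category. -/
noncomputable abbrev copower (k : Type*) [Field k] [Linear k C] (M : Type*) [AddCommGroup M]
    [Module k M] (X : C) : C :=
  ⨁ fun _ : Fin (Module.finrank k M) => X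

namespace copower

variable {M : Type*} [AddCommGroup M] [Module k M] [Module.Finite k M]

/-- The morphism `X ⟶ M ⊗ X`, `x ↦ m ⊗ x`. -/
noncomputable def incl (X : C) (m : M) : X ⟶ copower k M X :=
  ∑ i, (Module.finBasis k M).repr m i •
    biproduct.ι (fun _ : Fin (Module.finrank k M) => X) i

/-- The morphism `M ⊗ X ⟶ Y` corresponding to a linear map `M → Hom(X, Y)`. -/
noncomputable def desc {X Y : C} (φ : M →ₗ[k] (X ⟶ Y)) : copower k M X ⟶ Y :=
  biproduct.desc fun i => φ (Module.finBasis k M i)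

theorem incl_desc {X Y : C} (φ : M →ₗ[k] (X ⟶ Y)) (m : M) : incl (k := k) X m ≫ desc φ = φ m := by
  have h := congrArg φ ((Module.finBasis k M).sum_repr m)
  rw [map_sum] at h
  simpa [incl, desc, Preadditive.sum_comp] using h

theorem hom_ext {X Y : C} {f g : copower k M X ⟶ Y}
    (h : ∀ m : M, incl (k := k) X m ≫ f = incl X m ≫ g) : f = g := by
  refine biproduct.hom_ext' _ _ fun i => ?_
  have := h (Module.finBasis k M i)
  have e : incl (k := k) X (Module.finBasis k M i) =
      biproduct.ι (fun _ : Fin (Module.finrank k M) => X) i := by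
    classical
    simp [incl, Finsupp.single_apply, ite_smul]
  rwa [e] at this

/-- The morphism `x ↦ m ⊗ x` depends linearly on `m`. -/
noncomputable def inclₗ (k : Type*) [Field k] [Linear k C] (M : Type*) [AddCommGroup M] [Module k M] [Module.Finite k M] (X : C) :
    M →ₗ[k] (X ⟶ copower k M X) where
  toFun := incl X
  map_add' a b := by simp [incl, add_smul, Finset.sum_add_distrib]
  map_smul' a b := by simp [incl, Finset.smul_sum, mul_smul]

end copower

end Copower

section Artin

variable {k : Type*} [Field k]

instance {n : ℕ} (Q : FinQuot n) : Module.Finite k (GroupRing k Q) :=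
  haveI : Finite (B n ⧸ Q.toSubgroup) := Subgroup.finite_quotient_of_finiteIndex
  inferInstanceAs (Module.Finite k (MonoidAlgebra k (B n ⧸ Q.toSubgroup)))

variable {C : Type u} [Category.{v} C] [Abelian C] [Linear k C] [MonoidalCategory C]
  [BraidedCategory C]

theorem levelMap_refl {n : ℕ} (Q : FinQuot n) (a : GroupRing k Q) :
    levelMap k (le_refl Q) a = a := by
  have h : QuotientGroup.map Q.toSubgroup Q.toSubgroup (MonoidHom.id (B n)) (le_refl _) =
      MonoidHom.id _ := QuotientGroup.map_id _
  have : levelMap k (le_refl Q) = AlgHom.id k _ :=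
    (congrArg (MonoidAlgebra.mapDomainAlgHom k k) h).trans MonoidAlgebra.mapDomainAlgHom_id
  exact DFunLike.congr_fun this a

theorem levelMap_levelMap {n : ℕ} {P Q R : FinQuot n} (h : P ≤ Q) (h' : Q ≤ R)
    (a : GroupRing k P) : levelMap k h' (levelMap k h a) = levelMap k (h.trans h') a := by
  have : (levelMap k h').comp (levelMap k h) = levelMap k (h.trans h') := by
    refine (MonoidAlgebra.mapDomainAlgHom_comp _ _).symm.trans (congrArg _ ?_)
    exact MonoidHom.ext fun x => by induction x using QuotientGroup.induction_on; rfl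
  exact DFunLike.congr_fun this a

/-- The indexing set of Artin functors: the product over `n` of the sets of finite quotients of
`B n`. -/
def Levels : Type := ∀ n, FinQuot n

noncomputable instance : SemilatticeInf Levels := inferInstanceAs (SemilatticeInf (∀ n, FinQuot n))

instance : Nonempty Levels := inferInstanceAs (Nonempty (∀ n, FinQuot n))

namespace BraidedSubseq

/-- The right multiplication by a braid on the level `Q` of a braided subsequence. -/
noncomputable def mulRight (O : BraidedSubseq k) {n : ℕ} (Q : FinQuot n) (g : B n) :
    O.level Q →ₗ[k] O.level Q :=
  (LinearMap.mulRight k (braidClass k Q g)).restrict fun a ha => O.mul_mem Q a g ha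

/-- The transition map between two levels of a braided subsequence. -/
noncomputable def trans (O : BraidedSubseq k) {n : ℕ} {P Q : FinQuot n} (h : P ≤ Q) :
    O.level P →ₗ[k] O.level Q :=
  (levelMap k h).toLinearMap.restrict fun a ha => O.levelMap_mem h a ha

theorem trans_mulRight (O : BraidedSubseq k) {n : ℕ} {P Q : FinQuot n} (h : P ≤ Q) (g : B n)
    (a : O.level P) : O.trans h (O.mulRight P g a) = O.mulRight Q g (O.trans h a) := by
  refine Subtype.ext ?_
  change levelMap k h (a.1 * braidClass k P g) = levelMap k h a.1 * braidClass k Q g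
  rw [map_mul, braidClass, levelMap_toLevel]
  rfl

/-- The difference of the two morphisms `O(n)_Q ⊗ V^{⊗ n} ⟶ O(n)_Q ⊗ V^{⊗ n}` given by
`a ⊗ x ↦ a g ⊗ x` and by `a ⊗ x ↦ a ⊗ g x`. -/
noncomputable def relation (O : BraidedSubseq k) {n : ℕ} (Q : FinQuot n) (V : C) (g : B n) :
    copower k (O.level Q) (tp V n) ⟶ copower k (O.level Q) (tp V n) :=
  copower.desc ((copower.inclₗ k (O.level Q) (tp V n)).comp (O.mulRight Q g)) -
    copower.desc ((Linear.leftComp k _ (braidAction V n g).hom).comp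
      (copower.inclₗ k (O.level Q) (tp V n)))

theorem incl_relation (O : BraidedSubseq k) {n : ℕ} (Q : FinQuot n) (V : C) (g : B n)
    (a : O.level Q) : copower.incl (k := k) (tp V n) a ≫ O.relation Q V g =
      copower.incl (tp V n) (O.mulRight Q g a) -
        (braidAction V n g).hom ≫ copower.incl (tp V n) a := by
  rw [relation, Preadditive.comp_sub, copower.incl_desc, copower.incl_desc]
  rfl

/-- The object `O(n)_Q ⊗_{B n} V^{⊗ n}`: the quotient of `O(n)_Q ⊗ V^{⊗ n}` by the relations
`a g ⊗ x = a ⊗ g x`, where it suffices that `g` ranges over the generators of `B n`. -/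
noncomputable abbrev piece (O : BraidedSubseq k) {n : ℕ} (Q : FinQuot n) (V : C) : C :=
  cokernel (biproduct.desc fun i : Fin (n - 1) => O.relation Q V (σ n i))

/-- The morphism `V^{⊗ n} ⟶ O(n)_Q ⊗_{B n} V^{⊗ n}`, `x ↦ a ⊗ x`. -/
noncomputable def pieceIncl (O : BraidedSubseq k) {n : ℕ} (Q : FinQuot n) (V : C) (a : O.level Q) :
    tp V n ⟶ O.piece Q V :=
  copower.incl (tp V n) a ≫ cokernel.π _

/-- The linear dependence of `pieceIncl` on `a`. -/
noncomputable def pieceInclₗ (O : BraidedSubseq k) {n : ℕ} (Q : FinQuot n) (V : C) :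
    O.level Q →ₗ[k] (tp V n ⟶ O.piece Q V) :=
  (Linear.rightComp k (tp V n) (cokernel.π _)).comp (copower.inclₗ k (O.level Q) (tp V n))

theorem piece_hom_ext (O : BraidedSubseq k) {n : ℕ} {Q : FinQuot n} {V Y : C}
    {f g : O.piece Q V ⟶ Y} (h : ∀ a, O.pieceIncl Q V a ≫ f = O.pieceIncl Q V a ≫ g) : f = g := by
  refine coequalizer.hom_ext (copower.hom_ext fun a => ?_)
  have := h a
  simp only [pieceIncl, Category.assoc] at this
  exact this

theorem pieceIncl_mulRight (O : BraidedSubseq k) {n : ℕ} (Q : FinQuot n) (V : C) (i : Fin (n - 1))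
    (a : O.level Q) : O.pieceIncl Q V (O.mulRight Q (σ n i) a) =
      (braidAction V n (σ n i)).hom ≫ O.pieceIncl Q V a := by
  have h : O.relation Q V (σ n i) ≫ cokernel.π
      (biproduct.desc fun i : Fin (n - 1) => O.relation Q V (σ n i)) = 0 := by
    rw [← biproduct.ι_desc (fun i : Fin (n - 1) => O.relation Q V (σ n i)) i, Category.assoc,
      cokernel.condition, comp_zero]
  have h2 := congrArg (copower.incl (k := k) (tp V n) a ≫ ·) h
  rw [← Category.assoc, incl_relation, comp_zero, Preadditive.sub_comp, sub_eq_zero] at h2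
  rw [pieceIncl, h2, pieceIncl, Category.assoc]

/-- A linear map `φ : O(n)_Q → Hom(V^{⊗ n}, Y)` with `φ (a g) = φ a ∘ g` defines a morphism
`O(n)_Q ⊗_{B n} V^{⊗ n} ⟶ Y`. -/
noncomputable def pieceDesc (O : BraidedSubseq k) {n : ℕ} {Q : FinQuot n} {V Y : C}
    (φ : O.level Q →ₗ[k] (tp V n ⟶ Y))
    (hφ : ∀ (i : Fin (n - 1)) a, φ (O.mulRight Q (σ n i) a) =
      (braidAction V n (σ n i)).hom ≫ φ a) : O.piece Q V ⟶ Y :=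
  cokernel.desc _ (copower.desc φ) (by
    refine biproduct.hom_ext' _ _ fun i => copower.hom_ext fun a => ?_
    rw [biproduct.ι_desc_assoc, comp_zero, comp_zero, ← Category.assoc, incl_relation,
      Preadditive.sub_comp, Category.assoc, copower.incl_desc, copower.incl_desc, hφ, sub_self])

theorem pieceIncl_desc (O : BraidedSubseq k) {n : ℕ} {Q : FinQuot n} {V Y : C}
    (φ : O.level Q →ₗ[k] (tp V n ⟶ Y)) (hφ) (a : O.level Q) :
    O.pieceIncl Q V a ≫ O.pieceDesc φ hφ = φ a := by
  rw [pieceIncl, pieceDesc, Category.assoc, cokernel.π_desc, copower.incl_desc]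

/-- The transition morphisms `O(n)_P ⊗_{B n} V^{⊗ n} ⟶ O(n)_Q ⊗_{B n} V^{⊗ n}`. -/
noncomputable def pieceMap (O : BraidedSubseq k) {n : ℕ} {P Q : FinQuot n} (h : P ≤ Q) (V : C) :
    O.piece P V ⟶ O.piece Q V :=
  O.pieceDesc ((O.pieceInclₗ Q V).comp (O.trans h)) fun i a => by
    refine Eq.trans ?_ (O.pieceIncl_mulRight Q V i (O.trans h a))
    rw [← trans_mulRight]
    rfl

theorem pieceIncl_map (O : BraidedSubseq k) {n : ℕ} {P Q : FinQuot n} (h : P ≤ Q) (V : C)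
    (a : O.level P) :
    O.pieceIncl P V a ≫ O.pieceMap h V = O.pieceIncl Q V (O.trans h a) :=
  O.pieceIncl_desc _ _ a

theorem trans_refl (O : BraidedSubseq k) {n : ℕ} (Q : FinQuot n) (a : O.level Q) :
    O.trans (le_refl Q) a = a := by
  exact Subtype.ext (levelMap_refl Q a.1)

theorem trans_trans (O : BraidedSubseq k) {n : ℕ} {P Q R : FinQuot n} (h : P ≤ Q) (h' : Q ≤ R)
    (a : O.level P) : O.trans h' (O.trans h a) = O.trans (h.trans h') a := by
  exact Subtype.ext (levelMap_levelMap h h' a.1)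

variable [HasCountableCoproducts C]

/-- The Artin functor: the pro-object `O[V] = ⨁_n O(n) ⊗_{B n} V^{⊗ n}`.  As a direct sum of
pro-objects, it is indexed by the product over `n` of the indexing sets of the summands. -/
noncomputable def artin (O : BraidedSubseq k) (V : C) : ProObject C where
  I := Levels
  F :=
    { obj := fun Q => ∐ fun n => O.piece (Q n) V
      map := fun h => Limits.Sigma.map fun n => O.pieceMap (leOfHom h n) V
      map_id := fun Q => Limits.Sigma.hom_ext _ _ fun n => by
        rw [Limits.Sigma.ι_map, Category.comp_id]
        refine (?_ : _ ≫ _ = 𝟙 _ ≫ _).trans (Category.id_comp _)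
        congr 1
        refine O.piece_hom_ext fun a => ?_
        rw [pieceIncl_map, trans_refl, Category.comp_id]
      map_comp := fun h h' => Limits.Sigma.hom_ext _ _ fun n => by
        rw [Limits.Sigma.ι_map, Limits.Sigma.ι_map_assoc, Limits.Sigma.ι_map, ← Category.assoc]
        congr 1
        refine O.piece_hom_ext fun a => ?_
        rw [pieceIncl_map, ← Category.assoc, pieceIncl_map, pieceIncl_map, trans_trans] }

/-- The value at the level `Q` of an element of a braided subsequence. -/
def elementsAt (O : BraidedSubseq k) {n : ℕ} (a : O.elements n) (Q : FinQuot n) : O.level Q :=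
  ⟨a.1 Q, a.2.1 Q⟩

theorem artinIncl_aux (O : BraidedSubseq k) (V : C) {n : ℕ} (a : O.elements n) {P Q : Levels}
    (h : P ⟶ Q) : (O.pieceIncl (P n) V (O.elementsAt a (P n)) ≫
      Limits.Sigma.ι (fun m => O.piece (P m) V) n) ≫
        Limits.Sigma.map (fun n => O.pieceMap (leOfHom h n) V) =
      O.pieceIncl (Q n) V (O.elementsAt a (Q n)) ≫
        Limits.Sigma.ι (fun m => O.piece (Q m) V) n := by
  rw [Category.assoc, Limits.Sigma.ι_map, ← Category.assoc, pieceIncl_map]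
  congr 2
  exact Subtype.ext (a.2.2 _ _ (leOfHom h n))

/-- The morphism `V^{⊗ n} ⟶ O[V]`, `x ↦ a ⊗ x`, defined by an element `a` of `O(n)`. -/
noncomputable def artinIncl (O : BraidedSubseq k) (V : C) {n : ℕ} (a : O.elements n) :
    ProObject.const (tp V n) ⟶ O.artin V :=
  ProObject.ofCone (O.artin V) (tp V n)
    (fun Q : Levels => O.pieceIncl (Q n) V (O.elementsAt a (Q n)) ≫
      Limits.Sigma.ι (fun m => O.piece (Q m) V) n)
    (fun h => O.artinIncl_aux V a h)

end BraidedSubseq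

end Artin

/-! ### The tensor algebra -/

section TensorAlgebra

/-- The tensor product preserves countable coproducts in each variable. -/
class TensorPreservesCountable (C : Type u) [Category.{v} C] [MonoidalCategory C] : Prop where
  left (X : C) : PreservesColimitsOfShape (Discrete ℕ) (tensorLeft X)
  right (X : C) : PreservesColimitsOfShape (Discrete ℕ) (tensorRight X)

attribute [instance] TensorPreservesCountable.left TensorPreservesCountable.right

/-- The product of the values of `f` on `n` tensor factors. -/
def foldMul {C : Type u} [Category.{v} C] [MonoidalCategory C] {V A : C} [MonObj A] (f : V ⟶ A) :
    ∀ n, tp V n ⟶ A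
  | 0 => MonObj.one
  | n + 1 => (foldMul f n ⊗ₘ f) ≫ MonObj.mul

section Aux

variable {C : Type u} [Category.{v} C]

section

variable [HasCountableCoproducts C] (F : C ⥤ C) [PreservesColimitsOfShape (Discrete ℕ) F]

/-- The morphism out of the image of a countable coproduct with the given components. -/
noncomputable def sigDesc (X : ℕ → C) {Z : C} (f : ∀ n, F.obj (X n) ⟶ Z) : F.obj (∐ X) ⟶ Z :=
  (PreservesCoproduct.iso F X).hom ≫ Limits.Sigma.desc f

theorem map_ι_sigDesc (X : ℕ → C) {Z : C} (f : ∀ n, F.obj (X n) ⟶ Z) (n : ℕ) :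
    F.map (Limits.Sigma.ι X n) ≫ sigDesc F X f = f n := by
  have h : F.map (Limits.Sigma.ι X n) ≫ (PreservesCoproduct.iso F X).hom =
      Limits.Sigma.ι (fun n => F.obj (X n)) n := by
    rw [← Iso.eq_comp_inv, PreservesCoproduct.inv_hom, ι_comp_sigmaComparison]
  rw [sigDesc, ← Category.assoc, h, Limits.Sigma.ι_desc]

theorem sig_ext (X : ℕ → C) {Z : C} {f g : F.obj (∐ X) ⟶ Z}
    (h : ∀ n, F.map (Limits.Sigma.ι X n) ≫ f = F.map (Limits.Sigma.ι X n) ≫ g) : f = g := by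
  rw [← cancel_epi (PreservesCoproduct.iso F X).inv]
  refine Limits.Sigma.hom_ext _ _ fun n => ?_
  rw [PreservesCoproduct.inv_hom, ι_comp_sigmaComparison_assoc, ι_comp_sigmaComparison_assoc]
  exact h n

end

variable [MonoidalCategory C] {T P V A : C}

theorem aux_mul {m : T ⊗ T ⟶ T} {s : T ⊗ V ⟶ T} {a : T ⊗ P ⟶ T}
    (hs : T ◁ s ≫ m = (α_ T T V).inv ≫ m ▷ V ≫ s)
    (ih : m ▷ P ≫ a = (α_ T T P).hom ≫ T ◁ a ≫ m) :
    m ▷ (P ⊗ V) ≫ (α_ T P V).inv ≫ a ▷ V ≫ s =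
      (α_ T T (P ⊗ V)).hom ≫ T ◁ ((α_ T P V).inv ≫ a ▷ V ≫ s) ≫ m := by
  rw [associator_inv_naturality_left_assoc, ← comp_whiskerRight_assoc, ih,
    MonoidalCategory.whiskerLeft_comp, MonoidalCategory.whiskerLeft_comp, Category.assoc,
    Category.assoc, hs]
  simp

theorem aux_one {o : 𝟙_ C ⟶ T} {s : T ⊗ V ⟶ T} {a : T ⊗ P ⟶ T} {j : P ⟶ T} {j' : P ⊗ V ⟶ T}
    (hj : j ▷ V ≫ s = j') (ih : o ▷ P ≫ a = (λ_ P).hom ≫ j) :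
    o ▷ (P ⊗ V) ≫ (α_ T P V).inv ≫ a ▷ V ≫ s = (λ_ (P ⊗ V)).hom ≫ j' := by
  rw [associator_inv_naturality_left_assoc, ← comp_whiskerRight_assoc, ih, ← hj]
  simp

theorem aux_snoc {m : T ⊗ T ⟶ T} {s : T ⊗ V ⟶ T} {a : T ⊗ P ⟶ T} {j : P ⟶ T} {j' : P ⊗ V ⟶ T}
    (hj : j ▷ V ≫ s = j') (h : T ◁ j ≫ m = a)
    (h' : T ◁ j' ≫ m = (α_ T P V).inv ≫ a ▷ V ≫ s) :
    (T ◁ j) ▷ V ≫ (α_ T T V).hom ≫ T ◁ s ≫ m = (T ◁ j) ▷ V ≫ m ▷ V ≫ s := by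
  rw [← comp_whiskerRight_assoc, h, associator_naturality_middle_assoc,
    ← MonoidalCategory.whiskerLeft_comp_assoc, hj, h', Iso.hom_inv_id_assoc]

theorem aux_snoc_eq {m : T ⊗ T ⟶ T} {s : T ⊗ V ⟶ T} {i : 𝟙_ C ⊗ V ⟶ T}
    (h : T ◁ i ≫ m = (α_ T (𝟙_ C) V).inv ≫ (ρ_ T).hom ▷ V ≫ s) :
    s = T ◁ ((λ_ V).inv ≫ i) ≫ m := by
  rw [MonoidalCategory.whiskerLeft_comp, Category.assoc, h]
  simp

variable [MonObj A]

theorem aux_lift {s : T ⊗ V ⟶ T} {a : T ⊗ P ⟶ T} {l : T ⟶ A} {f : V ⟶ A} {φ : P ⟶ A}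
    (hs : s ≫ l = (l ⊗ₘ f) ≫ MonObj.mul) (ih : a ≫ l = (l ⊗ₘ φ) ≫ MonObj.mul) :
    ((α_ T P V).inv ≫ a ▷ V ≫ s) ≫ l = (l ⊗ₘ ((φ ⊗ₘ f) ≫ MonObj.mul)) ≫ MonObj.mul := by
  have h1 : a ▷ V ≫ (l ⊗ₘ f) = ((l ⊗ₘ φ) ⊗ₘ f) ≫ MonObj.mul ▷ A := by
    rw [← tensorHom_id, tensorHom_comp_tensorHom, Category.id_comp, ih, ← tensorHom_id,
      tensorHom_comp_tensorHom, Category.comp_id]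
  have h2 : (l ⊗ₘ ((φ ⊗ₘ f) ≫ MonObj.mul)) = (l ⊗ₘ (φ ⊗ₘ f)) ≫ A ◁ MonObj.mul := by
    rw [← id_tensorHom, tensorHom_comp_tensorHom, Category.comp_id]
  rw [Category.assoc, Category.assoc, hs, reassoc_of% h1, MonObj.mul_assoc, h2]
  simp

theorem aux_snoc_lift {s : T ⊗ V ⟶ T} {l : T ⟶ A} {f : V ⟶ A} {φ : P ⟶ A} {j : P ⟶ T}
    {j' : P ⊗ V ⟶ T} (hj : j ▷ V ≫ s = j') (h : j ≫ l = φ)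
    (h' : j' ≫ l = (φ ⊗ₘ f) ≫ MonObj.mul) :
    j ▷ V ≫ s ≫ l = j ▷ V ≫ (l ⊗ₘ f) ≫ MonObj.mul := by
  rw [← Category.assoc, hj, h', ← h, ← Category.assoc, ← tensorHom_id, tensorHom_comp_tensorHom,
    Category.id_comp]

theorem aux_incl_lift {l : T ⟶ A} {f : V ⟶ A} {j : 𝟙_ C ⊗ V ⟶ T}
    (h : j ≫ l = (MonObj.one ⊗ₘ f) ≫ MonObj.mul) : ((λ_ V).inv ≫ j) ≫ l = f := by
  rw [Category.assoc, h, MonoidalCategory.tensorHom_def']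
  simp

theorem aux_ext [MonObj T] {s : T ⊗ V ⟶ T} {c : V ⟶ T} {f g : T ⟶ A} [IsMonHom f] [IsMonHom g]
    {j : P ⟶ T} {j' : P ⊗ V ⟶ T} (hj : j ▷ V ≫ s = j') (hs : s = T ◁ c ≫ MonObj.mul)
    (h : j ≫ f = j ≫ g) (hc : c ≫ f = c ≫ g) : j' ≫ f = j' ≫ g := by
  have e : ∀ (f : T ⟶ A) [IsMonHom f], j' ≫ f = ((j ≫ f) ⊗ₘ (c ≫ f)) ≫ MonObj.mul := by
    intro f _
    rw [← hj, hs, Category.assoc, Category.assoc, IsMonHom.mul_hom, ← Category.assoc (T ◁ c),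
      ← id_tensorHom, tensorHom_comp_tensorHom, ← Category.assoc, ← tensorHom_id,
      tensorHom_comp_tensorHom]
    simp
  rw [e f, e g, h, hc]

end Aux

variable {C : Type u} [Category.{v} C] [MonoidalCategory C] [HasCountableCoproducts C]

/-- The underlying object `⨁_n V^{⊗ n}` of the tensor algebra. -/
noncomputable def TA (V : C) : C := ∐ fun n => tp V n

namespace TA

/-- The inclusion of `V^{⊗ n}`. -/
noncomputable def inj (V : C) (n : ℕ) : tp V n ⟶ TA V := Limits.Sigma.ι (fun n => tp V n) n

theorem hom_ext {V Z : C} {f g : TA V ⟶ Z} (h : ∀ n, inj V n ≫ f = inj V n ≫ g) : f = g :=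
  Limits.Sigma.hom_ext _ _ h

/-- The inclusion of the generators. -/
noncomputable def incl (V : C) : V ⟶ TA V := (λ_ V).inv ≫ inj V 1

/-- The extension of a morphism `V ⟶ A` to a morphism of algebras `T(V) ⟶ A`. -/
noncomputable def lift {V A : C} [MonObj A] (f : V ⟶ A) : TA V ⟶ A :=
  Limits.Sigma.desc (foldMul f)

theorem inj_lift {V A : C} [MonObj A] (f : V ⟶ A) (n : ℕ) : inj V n ≫ lift f = foldMul f n :=
  Limits.Sigma.ι_desc _ n

theorem incl_lift {V A : C} [MonObj A] (f : V ⟶ A) : incl V ≫ lift f = f :=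
  aux_incl_lift (inj_lift f 1)

variable [TensorPreservesCountable C]

/-- The right multiplication `T(V) ⊗ V ⟶ T(V)` by generators: the concatenation morphisms
`V^{⊗ n} ⊗ V = V^{⊗ (n + 1)}`. -/
noncomputable def snoc (V : C) : TA V ⊗ V ⟶ TA V :=
  sigDesc (tensorRight V) (fun n => tp V n) fun n => inj V (n + 1)

theorem inj_snoc (V : C) (n : ℕ) : inj V n ▷ V ≫ snoc V = inj V (n + 1) :=
  map_ι_sigDesc (tensorRight V) (fun n => tp V n) (fun n => inj V (n + 1)) n

/-- The concatenation morphisms `T(V) ⊗ V^{⊗ n} ⟶ T(V)`. -/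
noncomputable def append (V : C) : ∀ n, TA V ⊗ tp V n ⟶ TA V
  | 0 => (ρ_ _).hom
  | n + 1 => (α_ (TA V) (tp V n) V).inv ≫ append V n ▷ V ≫ snoc V

/-- The multiplication of the tensor algebra, given by concatenation. -/
noncomputable def mul (V : C) : TA V ⊗ TA V ⟶ TA V :=
  sigDesc (tensorLeft (TA V)) (fun n => tp V n) (append V)

theorem inj_mul (V : C) (n : ℕ) : TA V ◁ inj V n ≫ mul V = append V n :=
  map_ι_sigDesc (tensorLeft (TA V)) (fun n => tp V n) (append V) n

theorem homL_ext {V Y Z : C} {f g : Y ⊗ TA V ⟶ Z} (h : ∀ n, Y ◁ inj V n ≫ f = Y ◁ inj V n ≫ g) :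
    f = g :=
  sig_ext (tensorLeft Y) (fun n => tp V n) h

theorem homR_ext {V Y Z : C} {f g : TA V ⊗ Y ⟶ Z} (h : ∀ n, inj V n ▷ Y ≫ f = inj V n ▷ Y ≫ g) :
    f = g :=
  sig_ext (tensorRight Y) (fun n => tp V n) h

theorem snoc_mul (V : C) :
    TA V ◁ snoc V ≫ mul V = (α_ (TA V) (TA V) V).inv ≫ mul V ▷ V ≫ snoc V := by
  rw [← cancel_epi (α_ (TA V) (TA V) V).hom, Iso.hom_inv_id_assoc]
  exact sig_ext (tensorLeft (TA V) ⋙ tensorRight V) (fun n => tp V n) fun n =>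
    aux_snoc (inj_snoc V n) (inj_mul V n) (inj_mul V (n + 1))

theorem mul_append (V : C) (n : ℕ) : mul V ▷ tp V n ≫ append V n =
    (α_ (TA V) (TA V) (tp V n)).hom ≫ TA V ◁ append V n ≫ mul V := by
  induction n with
  | zero =>
    change mul V ▷ 𝟙_ C ≫ (ρ_ _).hom = (α_ (TA V) (TA V) (𝟙_ C)).hom ≫ TA V ◁ (ρ_ _).hom ≫ mul V
    simp
  | succ n ih => exact aux_mul (snoc_mul V) ih

theorem one_append (V : C) (n : ℕ) :
    inj V 0 ▷ tp V n ≫ append V n = (λ_ (tp V n)).hom ≫ inj V n := by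
  induction n with
  | zero =>
    change inj V 0 ▷ 𝟙_ C ≫ (ρ_ _).hom = (λ_ (𝟙_ C)).hom ≫ inj V 0
    rw [rightUnitor_naturality, unitors_equal]
    rfl
  | succ n ih => exact aux_one (inj_snoc V n) ih

theorem one_mul_aux (V : C) : inj V 0 ▷ TA V ≫ mul V = (λ_ (TA V)).hom := by
  refine homL_ext fun n => ?_
  refine (whisker_exchange_assoc _ _ _).trans ?_
  rw [inj_mul, one_append]
  exact (leftUnitor_naturality _).symm

/-- The tensor algebra is a monoid object. -/
noncomputable instance (V : C) : MonObj (TA V) where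
  one := inj V 0
  mul := mul V
  one_mul := one_mul_aux V
  mul_one := inj_mul V 0
  mul_assoc := homL_ext fun n => by
    rw [whisker_exchange_assoc, inj_mul, mul_append, associator_naturality_right_assoc,
      ← MonoidalCategory.whiskerLeft_comp_assoc, inj_mul]

theorem snoc_lift {V A : C} [MonObj A] (f : V ⟶ A) :
    snoc V ≫ lift f = (lift f ⊗ₘ f) ≫ MonObj.mul :=
  homR_ext fun n => aux_snoc_lift (inj_snoc V n) (inj_lift f n) (inj_lift f (n + 1))

theorem append_lift {V A : C} [MonObj A] (f : V ⟶ A) (n : ℕ) :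
    append V n ≫ lift f = (lift f ⊗ₘ foldMul f n) ≫ MonObj.mul := by
  induction n with
  | zero =>
    change (ρ_ (TA V)).hom ≫ lift f = (lift f ⊗ₘ MonObj.one) ≫ MonObj.mul
    simp [MonoidalCategory.tensorHom_def]
  | succ n ih => exact aux_lift (snoc_lift f) ih

instance {V A : C} [MonObj A] (f : V ⟶ A) : IsMonHom (lift f) where
  one_hom := inj_lift f 0
  mul_hom := homL_ext fun n => by
    refine (Category.assoc _ _ _).symm.trans ((inj_mul V n =≫ lift f).trans ?_)
    rw [append_lift, ← inj_lift, ← Category.assoc, ← id_tensorHom, tensorHom_comp_tensorHom,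
      Category.id_comp]

theorem snoc_eq (V : C) : snoc V = TA V ◁ incl V ≫ mul V := aux_snoc_eq (inj_mul V 1)

theorem algHom_ext {V A : C} [MonObj A] {f g : TA V ⟶ A} [IsMonHom f] [IsMonHom g]
    (h : incl V ≫ f = incl V ≫ g) : f = g := by
  refine hom_ext fun n => ?_
  induction n with
  | zero => exact (IsMonHom.one_hom (f := f)).trans (IsMonHom.one_hom (f := g)).symm
  | succ n ih => exact aux_ext (inj_snoc V n) (snoc_eq V) ih h

end TA

end TensorAlgebra

/-! ### The monad of primitives -/

section Primitives

variable {C : Type u} [Category.{v} C] [Abelian C] [MonoidalCategory C]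

set_option linter.unusedSectionVars false

/-- The morphism `x ↦ x ⊗ 1`. -/
noncomputable def insL (A : C) [MonObj A] : A ⟶ A ⊗ A := (ρ_ A).inv ≫ A ◁ MonObj.one

/-- The morphism `x ↦ 1 ⊗ x`. -/
noncomputable def insR (A : C) [MonObj A] : A ⟶ A ⊗ A := (λ_ A).inv ≫ MonObj.one ▷ A

theorem insL_map {A A' : C} [MonObj A] [MonObj A'] (f : A ⟶ A') [IsMonHom f] :
    insL A ≫ (f ⊗ₘ f) = f ≫ insL A' := by
  rw [insL, insL, Category.assoc, ← id_tensorHom, tensorHom_comp_tensorHom, IsMonHom.one_hom,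
    Category.id_comp, MonoidalCategory.tensorHom_def, rightUnitor_inv_naturality_assoc]

theorem insR_map {A A' : C} [MonObj A] [MonObj A'] (f : A ⟶ A') [IsMonHom f] :
    insR A ≫ (f ⊗ₘ f) = f ≫ insR A' := by
  rw [insR, insR, Category.assoc, ← tensorHom_id, tensorHom_comp_tensorHom, IsMonHom.one_hom,
    Category.id_comp, MonoidalCategory.tensorHom_def', leftUnitor_inv_naturality_assoc]

section Aux

variable {V T : C} [MonObj T] {x : V ⟶ T}

theorem aux_counitL {f : T ⟶ 𝟙_ C} (h1 : MonObj.one ≫ f = 𝟙 _) (hx : x ≫ f = 0) :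
    x ≫ (insL T + insR T) ≫ f ▷ T = x ≫ (λ_ T).inv := by
  have hL : insL T ≫ f ▷ T = f ≫ (ρ_ _).inv ≫ (𝟙_ C) ◁ MonObj.one := by
    rw [insL, Category.assoc, whisker_exchange, ← rightUnitor_inv_naturality_assoc]
  have hR : insR T ≫ f ▷ T = (λ_ T).inv := by
    rw [insR, Category.assoc, ← comp_whiskerRight, h1, id_whiskerRight, Category.comp_id]
  rw [Preadditive.add_comp, hL, hR, Preadditive.comp_add, reassoc_of% hx, zero_comp, zero_add]

theorem aux_counitR {f : T ⟶ 𝟙_ C} (h1 : MonObj.one ≫ f = 𝟙 _) (hx : x ≫ f = 0) :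
    x ≫ (insL T + insR T) ≫ T ◁ f = x ≫ (ρ_ T).inv := by
  have hL : insR T ≫ T ◁ f = f ≫ (λ_ _).inv ≫ MonObj.one ▷ (𝟙_ C) := by
    rw [insR, Category.assoc, ← whisker_exchange, ← leftUnitor_inv_naturality_assoc]
  have hR : insL T ≫ T ◁ f = (ρ_ T).inv := by
    rw [insL, Category.assoc, ← MonoidalCategory.whiskerLeft_comp, h1,
      MonoidalCategory.whiskerLeft_id, Category.comp_id]
  rw [Preadditive.add_comp, hL, hR, Preadditive.comp_add, reassoc_of% hx, zero_comp, add_zero]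

theorem aux_coassoc {d : T ⟶ T ⊗ T}
    (h1 : MonObj.one ≫ d = (λ_ (𝟙_ C)).inv ≫ (MonObj.one ⊗ₘ MonObj.one))
    (hx : x ≫ d = x ≫ (insL T + insR T)) :
    x ≫ (insL T + insR T) ≫ T ◁ d = x ≫ (insL T + insR T) ≫ d ▷ T ≫ (α_ T T T).hom := by
  have e1 : insL T ≫ T ◁ d =
      (ρ_ T).inv ≫ T ◁ ((λ_ (𝟙_ C)).inv ≫ (MonObj.one ⊗ₘ MonObj.one)) := by
    rw [insL, Category.assoc, ← MonoidalCategory.whiskerLeft_comp, h1]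
  have e2 : insR T ≫ T ◁ d = d ≫ (λ_ _).inv ≫ MonObj.one ▷ (T ⊗ T) := by
    rw [insR, Category.assoc, ← whisker_exchange, ← leftUnitor_inv_naturality_assoc]
  have e3 : insL T ≫ d ▷ T = d ≫ (ρ_ _).inv ≫ (T ⊗ T) ◁ MonObj.one := by
    rw [insL, Category.assoc, whisker_exchange, ← rightUnitor_inv_naturality_assoc]
  have e4 : insR T ≫ d ▷ T =
      (λ_ T).inv ≫ ((λ_ (𝟙_ C)).inv ≫ (MonObj.one ⊗ₘ MonObj.one)) ▷ T := by
    rw [insR, Category.assoc, ← comp_whiskerRight, h1]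
  rw [Preadditive.add_comp, ← Category.assoc (insL T + insR T), Preadditive.add_comp, e1, e2, e3,
    e4]
  simp only [Preadditive.comp_add, Preadditive.add_comp, Category.assoc, reassoc_of% hx]
  rw [← Preadditive.comp_add, ← Preadditive.comp_add, ← Preadditive.comp_add,
    ← Preadditive.comp_add]
  have a : (ρ_ T).inv ≫ T ◁ ((λ_ (𝟙_ C)).inv ≫ (MonObj.one ⊗ₘ MonObj.one)) =
      insL T ≫ (ρ_ _).inv ≫ (T ⊗ T) ◁ MonObj.one ≫ (α_ T T T).hom := by
    rw [insL, MonoidalCategory.tensorHom_def]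
    monoidal
  have b : insL T ≫ (λ_ (T ⊗ T)).inv ≫ MonObj.one ▷ (T ⊗ T) =
      insR T ≫ (ρ_ (T ⊗ T)).inv ≫ (T ⊗ T) ◁ MonObj.one ≫ (α_ T T T).hom := by
    have e : (T ◁ MonObj.one ≫ (λ_ (T ⊗ T)).inv) ≫ MonObj.one ▷ (T ⊗ T) =
        (λ_ (T ⊗ 𝟙_ C)).inv ≫ MonObj.one ▷ (T ⊗ 𝟙_ C) ≫ T ◁ (T ◁ MonObj.one) := by
      rw [leftUnitor_inv_naturality, Category.assoc, whisker_exchange]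
    rw [insL, Category.assoc, ← Category.assoc (T ◁ _), e, insR]
    monoidal
  have c : insR T ≫ (λ_ (T ⊗ T)).inv ≫ MonObj.one ▷ (T ⊗ T) =
      (λ_ T).inv ≫ ((λ_ (𝟙_ C)).inv ≫ (MonObj.one ⊗ₘ MonObj.one)) ▷ T ≫ (α_ T T T).hom := by
    rw [insR, MonoidalCategory.tensorHom_def']
    monoidal
  rw [a, b, c, add_assoc]

end Aux

namespace TA

variable [BraidedCategory C] [HasCountableCoproducts C]
  [TensorPreservesCountable C]

/-- The diagonal of the tensor algebra: the morphism of algebras `T(V) ⟶ T(V) ⊗ T(V)` for which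
the generators are primitive. -/
noncomputable def comul (V : C) : TA V ⟶ TA V ⊗ TA V :=
  lift (incl V ≫ (insL (TA V) + insR (TA V)))

/-- The counit of the tensor algebra, which vanishes on the generators. -/
noncomputable def counit (V : C) : TA V ⟶ 𝟙_ C := lift 0

noncomputable instance (V : C) : IsMonHom (comul V) := inferInstanceAs (IsMonHom (lift _))

noncomputable instance (V : C) : IsMonHom (counit V) := inferInstanceAs (IsMonHom (lift _))

theorem incl_comul (V : C) : incl V ≫ comul V = incl V ≫ (insL (TA V) + insR (TA V)) :=
  incl_lift _

theorem incl_counit (V : C) : incl V ≫ counit V = 0 := incl_lift _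

theorem one_comul (V : C) : MonObj.one ≫ comul V =
    (λ_ (𝟙_ C)).inv ≫ (MonObj.one ⊗ₘ MonObj.one) := IsMonHom.one_hom (comul V)

theorem one_counit (V : C) : MonObj.one ≫ counit V = 𝟙 _ := IsMonHom.one_hom (counit V)

/-- The tensor algebra is a comonoid object. -/
noncomputable instance (V : C) : ComonObj (TA V) where
  counit := counit V
  comul := comul V
  counit_comul := algHom_ext (by
    rw [← Category.assoc, incl_comul, Category.assoc, aux_counitL (one_counit V) (incl_counit V)])
  comul_counit := algHom_ext (by
    rw [← Category.assoc, incl_comul, Category.assoc, aux_counitR (one_counit V) (incl_counit V)])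
  comul_assoc := algHom_ext (by
    rw [← Category.assoc, ← Category.assoc (incl V), incl_comul, Category.assoc, Category.assoc,
      aux_coassoc (one_comul V) (incl_comul V)])

/-- The tensor algebra is a bialgebra. -/
noncomputable instance (V : C) : BimonObj (TA V) where
  mul_comul := (IsMonHom.mul_hom (comul V)).trans rfl
  one_comul := IsMonHom.one_hom (comul V)
  mul_counit := IsMonHom.mul_hom (counit V)
  one_counit := one_counit V

theorem lift_comul {V A : C} [BimonObj A] (x : V ⟶ A)
    (hx : x ≫ ComonObj.comul = x ≫ (insL A + insR A)) :
    lift x ≫ ComonObj.comul = ComonObj.comul ≫ (lift x ⊗ₘ lift x) := by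
  have : IsMonHom (ComonObj.comul (X := A)) :=
    ⟨BimonObj.one_comul A, BimonObj.mul_comul A⟩
  have : IsMonHom (ComonObj.comul (X := TA V)) := inferInstanceAs (IsMonHom (comul V))
  refine algHom_ext ?_
  have h : incl V ≫ ComonObj.comul = incl V ≫ (insL (TA V) + insR (TA V)) := incl_comul V
  rw [← Category.assoc, incl_lift, hx, ← Category.assoc, h, Category.assoc, Preadditive.add_comp,
    insL_map, insR_map, ← Preadditive.comp_add, ← Category.assoc, incl_lift]

end TA

variable [BraidedCategory C]

/-- The primitives of a bialgebra: the kernel of `x ↦ Δ x - x ⊗ 1 - 1 ⊗ x`. -/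
noncomputable def primitives (A : C) [BimonObj A] : C :=
  kernel (ComonObj.comul (X := A) - (insL A + insR A))

/-- The inclusion of the primitives. -/
noncomputable def primι (A : C) [BimonObj A] : primitives A ⟶ A :=
  kernel.ι (ComonObj.comul (X := A) - (insL A + insR A))

instance (A : C) [BimonObj A] : Mono (primι A) := inferInstanceAs (Mono (kernel.ι _))

theorem primι_comul (A : C) [BimonObj A] :
    primι A ≫ ComonObj.comul = primι A ≫ (insL A + insR A) := by
  rw [← sub_eq_zero, ← Preadditive.comp_sub]
  exact kernel.condition _

/-- The factorization of a morphism with primitive values. -/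
noncomputable def primLift {A X : C} [BimonObj A] (x : X ⟶ A)
    (hx : x ≫ ComonObj.comul = x ≫ (insL A + insR A)) : X ⟶ primitives A :=
  kernel.lift _ x (by rw [Preadditive.comp_sub, hx, sub_self])

theorem primLift_ι {A X : C} [BimonObj A] (x : X ⟶ A) (hx) : primLift x hx ≫ primι A = x :=
  kernel.lift_ι _ _ _

variable [HasCountableCoproducts C] [TensorPreservesCountable C]

/-- For `f : V ⟶ P(A)`, the restriction `P(T(V)) ⟶ P(A)` to primitives of the morphism of
bialgebras `T(V) ⟶ A` that extends `f`. -/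
noncomputable def primExt {V A : C} [BimonObj A] (f : V ⟶ primitives A) :
    primitives (TA V) ⟶ primitives A :=
  primLift (primι (TA V) ≫ TA.lift (f ≫ primι A)) (by
    rw [Category.assoc, TA.lift_comul (f ≫ primι A) (by simp only [Category.assoc, primι_comul]),
      ← Category.assoc, primι_comul, Category.assoc, Category.assoc, Preadditive.add_comp,
      insL_map, insR_map, ← Preadditive.comp_add])

theorem primExt_ι {V A : C} [BimonObj A] (f : V ⟶ primitives A) :
    primExt f ≫ primι A = primι (TA V) ≫ TA.lift (f ≫ primι A) :=
  primLift_ι _ _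

/-- The inclusion `V ⟶ P(T(V))`. -/
noncomputable def primUnit (V : C) : V ⟶ primitives (TA V) :=
  primLift (TA.incl V) (TA.incl_comul V)

theorem primUnit_ι (V : C) : primUnit V ≫ primι (TA V) = TA.incl V := primLift_ι _ _

theorem primUnit_ext {V A : C} [BimonObj A] (f : V ⟶ primitives A) : primUnit V ≫ primExt f = f := by
  rw [← cancel_mono (primι A), Category.assoc, primExt_ι, ← Category.assoc, primUnit_ι,
    TA.incl_lift]

theorem primExt_unit (V : C) : primExt (primUnit V) = 𝟙 _ := by
  rw [← cancel_mono (primι (TA V)), primExt_ι, primUnit_ι]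
  have : TA.lift (TA.incl V) = 𝟙 _ := TA.algHom_ext (by rw [TA.incl_lift, Category.comp_id])
  rw [this, Category.comp_id, Category.id_comp]

theorem primExt_comp {V W A : C} [BimonObj A] (f : V ⟶ primitives (TA W)) (g : W ⟶ primitives A) :
    primExt f ≫ primExt g = primExt (f ≫ primExt g) := by
  rw [← cancel_mono (primι A), Category.assoc, primExt_ι, primExt_ι, ← Category.assoc, primExt_ι,
    Category.assoc]
  congr 1
  refine TA.algHom_ext ?_
  rw [← Category.assoc, TA.incl_lift, TA.incl_lift, Category.assoc, Category.assoc, primExt_ι]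

end Primitives

/-- The monad `V ↦ P(T(V))` of primitives in the tensor algebra.  Its unit is the inclusion
`V ⟶ P(T(V))`; its multiplication is the restriction to primitives of the morphism of bialgebras
`T(P(T(V))) ⟶ T(V)` that extends the inclusion `P(T(V)) ⟶ T(V)`. -/
noncomputable def primMonad (C : Type u) [Category.{v} C] [Abelian C] [MonoidalCategory C]
    [BraidedCategory C] [HasCountableCoproducts C] [TensorPreservesCountable C] : Monad C where
  obj V := primitives (TA V)
  map {V W} f := primExt (f ≫ primUnit W)
  map_id V := by rw [Category.id_comp, primExt_unit]
  map_comp {U V W} f g := by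
    rw [primExt_comp, Category.assoc, Category.assoc, primUnit_ext]
  η :=
    { app := primUnit
      naturality := fun V W f => (primUnit_ext _).symm }
  μ :=
    { app := fun V => primExt (𝟙 (primitives (TA V)))
      naturality := fun V W f => by
        refine (primExt_comp _ _).trans (Eq.trans ?_ (primExt_comp _ _).symm)
        rw [Category.assoc, primUnit_ext, Category.id_comp, Category.comp_id] }
  assoc V := by
    refine (primExt_comp _ _).trans (Eq.trans ?_ (primExt_comp _ _).symm)
    exact congrArg primExt (by
      rw [Category.assoc, primUnit_ext]
      exact (Category.comp_id _).trans (Category.id_comp _).symm)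
  left_unit V := primUnit_ext _
  right_unit V := by
    refine (primExt_comp _ _).trans (Eq.trans (congrArg primExt ?_) (primExt_unit V))
    rw [Category.assoc, primUnit_ext]
    exact Category.comp_id _

/-! ### Relative monads -/

section RelMonad

universe v₁ v₂ u₁ u₂

/-- A monad relative to a functor `J`, in Kleisli form.  For an identity functor this is a monad;
for the inclusion `J` of a full subcategory it is a monad that is defined on the objects of the
subcategory, but whose values do not need to lie in the subcategory. -/
structure RelMonad {𝓐 : Type u₁} [Category.{v₁} 𝓐] {𝓑 : Type u₂} [Category.{v₂} 𝓑]
    (J : 𝓐 ⥤ 𝓑) where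
  /-- the values on objects -/
  obj : 𝓐 → 𝓑
  /-- the unit -/
  unit : ∀ X, J.obj X ⟶ obj X
  /-- the Kleisli extension -/
  ext : ∀ {X Y}, (J.obj X ⟶ obj Y) → (obj X ⟶ obj Y)
  ext_unit : ∀ X, ext (unit X) = 𝟙 (obj X)
  unit_ext : ∀ {X Y} (f : J.obj X ⟶ obj Y), unit X ≫ ext f = f
  ext_comp : ∀ {X Y Z} (f : J.obj X ⟶ obj Y) (g : J.obj Y ⟶ obj Z),
    ext f ≫ ext g = ext (f ≫ ext g)

variable {𝓐 : Type u₁} [Category.{v₁} 𝓐] {𝓑 : Type u₂} [Category.{v₂} 𝓑] {J : 𝓐 ⥤ 𝓑}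

/-- An isomorphism of relative monads. -/
structure RelMonad.Iso (M N : RelMonad J) where
  /-- the isomorphisms of the values -/
  app : ∀ X, M.obj X ≅ N.obj X
  unit : ∀ X, M.unit X ≫ (app X).hom = N.unit X
  ext : ∀ {X Y} (f : J.obj X ⟶ M.obj Y),
    M.ext f ≫ (app Y).hom = (app X).hom ≫ N.ext (f ≫ (app Y).hom)

/-- The restriction of a monad along a functor. -/
def restrictMonad (T : Monad 𝓑) (J : 𝓐 ⥤ 𝓑) : RelMonad J where
  obj X := T.obj (J.obj X)
  unit X := T.η.app (J.obj X)
  ext {X Y} f := T.map f ≫ T.μ.app (J.obj Y)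
  ext_unit X := T.right_unit (J.obj X)
  unit_ext {X Y} f := by
    have h : f ≫ T.η.app _ = T.η.app _ ≫ T.map f := T.η.naturality f
    rw [← Category.assoc, ← h, Category.assoc, T.left_unit]
    exact Category.comp_id f
  ext_comp {X Y Z} f g := by
    have h : T.map (T.map g) ≫ T.μ.app _ = T.μ.app _ ≫ T.map g := T.μ.naturality g
    simp only [Functor.map_comp, Category.assoc]
    rw [T.assoc, reassoc_of% h]

end RelMonad

/-! ### Algebras over a suboperad and its monad -/

section Algebras

variable {k : Type*} [Field k] {C : Type u} [Category.{v} C] [Abelian C] [Linear k C]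
  [MonoidalCategory C] [BraidedCategory C]

/-- An algebra structure on the object `A` over a suboperad of the profinite braided associative
operad. -/
structure OpAlgebra {O : BraidedSubseq k} (hO : IsSuboperad O) (A : C) where
  /-- the operations -/
  act : ∀ n, O.elements n →ₗ[k] (tp A n ⟶ A)
  act_one : act 1 ⟨fun _ => 1, hO.one_mem⟩ = (λ_ A).hom
  act_braid : ∀ (n : ℕ) (a : O.elements n) (g : B n),
    act n (O.act a g) = (braidAction A n g).hom ≫ act n a
  act_comp : ∀ (i n r : ℕ) (a : O.elements (i + 1 + r)) (b : O.elements n),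
    act (i + n + r) ⟨operadComp i n r a.1 b.1, hO.comp_mem i n r a.1 b.1 a.2 b.2⟩ =
      tpInsert i n r (act n b) ≫ act (i + 1 + r) a

/-- The operations of each arity `n` factor through some level `O(n)_Q`; that is, they are defined
by a morphism from the pro-object `O(n)` to the constant pro-object `Hom(A^{⊗ n}, A)`. -/
def OpAlgebra.IsContinuous {O : BraidedSubseq k} {hO : IsSuboperad O} {A : C}
    (θ : OpAlgebra hO A) : Prop :=
  ∀ n, ∃ Q : FinQuot n, ∀ a : O.elements n, a.1 Q = 0 → θ.act n a = 0

/-- The monad on the finitely braided objects that is defined by a suboperad `O` of the profinite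
braided associative operad: its underlying object is the Artin functor `O[V]`, which is
pro-constant; this is an `O`-algebra, in which `a ⊗ (x₁ ⊗ ⋯ ⊗ xₙ)` is the value of the operation
`a` on the generators `x₁, …, xₙ`; and the Kleisli extension of a morphism `V ⟶ O[W]` is a morphism
of `O`-algebras. -/
structure ArtinMonad [HasCountableCoproducts C] {O : BraidedSubseq k} (hO : IsSuboperad O) extends
    RelMonad (FinitelyBraided (C := C)).ι where
  /-- the identification with the Artin functor -/
  iso : ∀ V, ProObject.const (obj V) ≅ O.artin V.obj
  /-- the algebra structures -/
  op : ∀ V, OpAlgebra hO (obj V)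
  op_unit : ∀ V n (a : O.elements n),
    ProObject.constMap (tpMap (unit V) n ≫ (op V).act n a) ≫ (iso V).hom = O.artinIncl V.obj a
  op_ext : ∀ {V W} (f : (FinitelyBraided (C := C)).ι.obj V ⟶ obj W) n (a : O.elements n),
    (op V).act n a ≫ ext f = tpMap (ext f) n ≫ (op W).act n a

/-- The action on `V^{⊗ n}`, for a finitely braided object `V`, of a compatible family of elements
of the group rings of the finite quotients of `B n`: it is computed in the finite quotient through
which the action of `B n` factors. -/
noncomputable def profAct {V : C} (hV : FinitelyBraided V) {n : ℕ} (a : Family k n) :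
    tp V n ⟶ tp V n :=
  haveI : Finite (braidAction V n).range := hV n
  haveI : (braidAction V n).ker.FiniteIndex := Subgroup.finiteIndex_ker (braidAction V n)
  (a (FiniteIndexNormalSubgroup.ofSubgroup (braidAction V n).ker)).coeff.sum
    fun x s => s • (braidAction V n x.out).hom

end Algebras

end BraidedPrim

-- Everything rests on one formula: in degree `n` the diagonal of `T(V)` is the sum over `p` of the
-- action of `S_{p,n-p}` followed by the cut of `V^{⊗ n}` into `V^{⊗ p} ⊗ V^{⊗ (n-p)}`
-- (`inj_comul`). The terms `p = 0` and `p = n` are `1 ⊗ x` and `x ⊗ 1`, so for `n > 0` the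
-- primitives of degree `n` are what is killed by all `S_{p,q}` with `p, q > 0`. The braided
-- primitive operad imposes the same equations on the group rings themselves. Applied to the
-- universal case `T(A) ⟶ A`, the formula shows that an element `α` of this operad, followed by the
-- multiplication of a bialgebra `A`, carries primitives to primitives (`primVal_comul`).
--
-- Closure under composition comes from a Vandermonde identity (`sh_add`): a shuffle of all strands
-- of a cabled braid splits according to how many strands of the cable go to the left. If the
-- inserted element `β` is killed by the inner shuffles, only the terms in which the cable moves as
-- a whole survive. If `β` has arity `n + 1`, this leaves in `S_p (α ∘ β)` the part of `S_{p-n} α`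
-- in which the cabled strand ends on the left and the part of `S_p α` in which it ends on the right
-- (`sh_mul_insertBlock`). Both vanish because `α` is killed by shuffles, apart from the extreme
-- values of `p`, where no such position exists.
--
-- Characteristic `0` enters through idempotents. On the rational group ring of a finite group the
-- standard inner product is definite, so `1` has a component `e` orthogonal to the left ideal
-- generated by the shuffle elements. This component is determined by equations preserved by the
-- transition maps, so the `e` form a compatible family `idem`. It satisfies `S_p e = 0`, and `1 -
-- e` is a left combination of the `S_p`. Hence each level of the operad in positive arity is the
-- right ideal generated by `e`, and the projection of `T(V)` with components `e` has the primitives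
-- as its image: it lands in them, and `1 - e` factors through the reduced diagonal
-- (`exists_comul_sub_comp`). Moreover `O(n)_Q ⊗_{B n} V^{⊗ n}` is `e V^{⊗ n}` for every
-- sufficiently fine level `Q`. So the Artin functor is constant with value `P(T(V))`
-- (`isIso_artinHom`).
--
-- The composition law for the operations is the naturality of the braiding with respect to cabling
-- (`cable_insPos`). The object `T(V)` need not be finitely braided even if `V` is. However, each
-- summand of `T(V)^{⊗ n}` is fixed by a subgroup of finite index, and operations can be evaluated
-- one total degree at a time. `FixedBy`, `ProfiniteAction` and `EnoughFixed` isolate what is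
-- needed, so that finitely braided bialgebras and tensor algebras are treated together.
--
-- Finally, in any monad of the required kind the values of the operations on generators are
-- prescribed. By operadic composition these values determine all operations, and a morphism of
-- algebras is determined by its restriction to generators. So the identification with `P(T(V))` on
-- objects respects the operations and the Kleisli extensions.

attribute [reducible] BraidedPrim.tp

namespace BraidedPrim

/-! ### Shuffle elements -/

section Shuffles

variable (k : Type*) [Field k]

/-- The shuffle elements on the `n` strands of `B N` that start at the position `j`, defined by
recursion: the last strand either stays, or moves to the left past the strands of the right
part. -/
noncomputable def sh (N j : ℕ) : ℕ → ℕ → MonoidAlgebra k (B N)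
  | 0, 0 => 1
  | 0, _ + 1 => 0
  | n + 1, 0 => sh N j n 0
  -- The truncation in `n - p` does no harm: for `n < p` the factor `sh N j n p` vanishes.
  | n + 1, p + 1 => sh N j n (p + 1) + MonoidAlgebra.of k (B N) (up N (j + p) (n - p)) * sh N j n p

theorem sh_zero (N j n : ℕ) : sh k N j n 0 = 1 := by
  induction n with
  | zero => rfl
  | succ n ih => exact ih

theorem sh_of_lt (N j n p : ℕ) (h : n < p) : sh k N j n p = 0 := by
  induction n generalizing p with
  | zero =>
    obtain ⟨p, rfl⟩ : ∃ q, p = q + 1 := ⟨p - 1, by omega⟩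
    rfl
  | succ n ih =>
    obtain ⟨p, rfl⟩ : ∃ q, p = q + 1 := ⟨p - 1, by omega⟩
    rw [sh, ih _ (by omega), ih _ (by omega), mul_zero, add_zero]

theorem sh_self (N j n : ℕ) : sh k N j n n = 1 := by
  induction n with
  | zero => rfl
  | succ n ih => rw [sh, sh_of_lt k N j n (n + 1) (by omega), ih, Nat.sub_self, up, map_one]; simp

theorem sh_succ_succ (N j n p : ℕ) : sh k N j (n + 1) (p + 1) =
    sh k N j n (p + 1) + MonoidAlgebra.of k (B N) (up N (j + p) (n - p)) * sh k N j n p := rfl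

/-- The lift of the unshuffle that moves the strands in `s` to the left. -/
def shuffleWord (N : ℕ) (s : Finset ℕ) : ℕ → B N
  | 0 => 1
  | n + 1 =>
    -- A strand in `s` passes exactly the earlier strands outside `s`, which by then are the ones
    -- next to it on its left.
    let c := if n ∈ s then (Finset.range n \ s).card else 0
    up N (n - c) c * shuffleWord N s n

theorem shuffleWord_congr (N n : ℕ) {s t : Finset ℕ} (h : ∀ i < n, i ∈ s ↔ i ∈ t) :
    shuffleWord N s n = shuffleWord N t n := by
  induction n with
  | zero => rfl
  | succ n ih =>
    have e : Finset.range n \ s = Finset.range n \ t := by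
      ext i
      simp only [Finset.mem_sdiff, Finset.mem_range]
      refine and_congr_right fun hi => not_congr (h i (by omega))
    simp only [shuffleWord, ih fun i hi => h i (by omega), e, h n (by omega)]

/-- A term of the recursion is a choice, for each strand in turn, between staying and moving left.
The strands that move left form the set `s`. -/
theorem sh_eq_sum (N n p : ℕ) : sh k N 0 n p =
    ∑ s ∈ (Finset.range n).powersetCard p, MonoidAlgebra.of k (B N) (shuffleWord N s n) := by
  induction n generalizing p with
  | zero =>
    cases p with
    | zero => simp [sh, shuffleWord, MonoidAlgebra.one_def]
    | succ p => rw [sh, Finset.range_zero, Finset.powersetCard_eq_empty.2 (by simp),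
        Finset.sum_empty]
  | succ n ih =>
    have hn : n ∉ Finset.range n := by simp
    cases p with
    | zero =>
      rw [sh_zero, Finset.powersetCard_zero, Finset.sum_singleton]
      have : shuffleWord N ∅ (n + 1) = 1 := by
        generalize n + 1 = m
        induction m with
        | zero => rfl
        | succ m ih => simp [shuffleWord, ih, up]
      rw [this, map_one]
    | succ p =>
      rw [sh, ih, ih, Finset.range_add_one, Finset.powersetCard_succ_insert hn, Finset.sum_union,
        Finset.sum_image]
      · congr 1
        · refine Finset.sum_congr rfl fun s hs => ?_
          have : n ∉ s := fun h => hn ((Finset.mem_powersetCard.1 hs).1 h)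
          simp [shuffleWord, this, up]
        · rw [Finset.mul_sum]
          refine Finset.sum_congr rfl fun s hs => ?_
          obtain ⟨hs, hc⟩ := Finset.mem_powersetCard.1 hs
          have e : Finset.range n \ insert n s = Finset.range n \ s := by
            ext i
            simp only [Finset.mem_sdiff, Finset.mem_range, Finset.mem_insert, not_or]
            constructor
            · tauto
            · rintro ⟨h1, h2⟩
              exact ⟨h1, by omega, h2⟩
          have hle := Finset.card_le_card hs
          rw [Finset.card_range, hc] at hle
          simp only [shuffleWord, Finset.mem_insert_self, if_true, e, Finset.card_sdiff_of_subset hs,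
            Finset.card_range, hc]
          rw [← map_mul, shuffleWord_congr N n (s := insert n s) (t := s) fun i hi => by
            simp only [Finset.mem_insert, or_iff_right_iff_imp]; omega]
          congr 3
          omega
      · intro s hs t ht h
        have h1 : n ∉ s := fun h => hn ((Finset.mem_powersetCard.1 hs).1 h)
        have h2 : n ∉ t := fun h => hn ((Finset.mem_powersetCard.1 ht).1 h)
        rw [← Finset.erase_insert h1, ← Finset.erase_insert h2]
        exact congrArg (fun x => Finset.erase x n) h
      · rw [Finset.disjoint_left]
        rintro s hs ht
        obtain ⟨t, -, rfl⟩ := Finset.mem_image.1 ht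
        exact hn ((Finset.mem_powersetCard.1 hs).1 (Finset.mem_insert_self _ _))

/-- The set of strands that a permutation moves to the first `p` positions. -/
def leftSet {n : ℕ} (p : ℕ) (τ : Equiv.Perm (Fin n)) : Finset ℕ :=
  (Finset.univ.filter fun i => (τ i).1 < p).map Fin.valEmbedding

theorem mem_leftSet {n p : ℕ} {τ : Equiv.Perm (Fin n)} {i : Fin n} :
    i.1 ∈ leftSet p τ ↔ (τ i).1 < p := by
  simp only [leftSet, Finset.mem_map, Finset.mem_filter, Finset.mem_univ, true_and,
    Fin.valEmbedding_apply]
  exact ⟨fun ⟨a, h1, h2⟩ => Fin.ext h2 ▸ h1, fun h => ⟨i, h, rfl⟩⟩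

theorem inv_apply {α : Type*} (τ : Equiv.Perm α) (a : α) : τ⁻¹ (τ a) = a := τ.symm_apply_apply a

theorem apply_inv {α : Type*} (τ : Equiv.Perm α) (a : α) : τ (τ⁻¹ a) = a := τ.apply_symm_apply a

/-- An unshuffle keeps the order within each of its two groups of strands, so the only crossings are
between a strand that goes right and a later strand that goes left. -/
theorem crossings_of_unshuffle {n p : ℕ} {τ : Equiv.Perm (Fin n)} (hτ : τ ∈ unshuffles n p)
    (j : Fin n) : crossings τ j =
      if j.1 ∈ leftSet p τ then (Finset.range j \ leftSet p τ).card else 0 := by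
  simp only [unshuffles, Finset.mem_filter, Finset.mem_univ, true_and] at hτ
  have key : ∀ i j : Fin n, i < j → τ j < τ i → (τ j).1 < p ∧ ¬ (τ i).1 < p := by
    intro i j hij h
    by_contra hc
    have := hτ (τ j) (τ i) h (by omega)
    rw [inv_apply, inv_apply] at this
    omega
  split_ifs with h
  · rw [mem_leftSet] at h
    unfold crossings
    rw [← Finset.card_map Fin.valEmbedding]
    congr 1
    ext i
    simp only [Finset.mem_map, Finset.mem_filter, Finset.mem_univ, true_and,
      Fin.valEmbedding_apply, Finset.mem_sdiff, Finset.mem_range]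
    constructor
    · rintro ⟨i, ⟨h1, h2⟩, rfl⟩
      exact ⟨h1, by rw [mem_leftSet]; exact (key i j h1 h2).2⟩
    · rintro ⟨h1, h2⟩
      refine ⟨⟨i, by omega⟩, ⟨h1, ?_⟩, rfl⟩
      have := (mem_leftSet (τ := τ) (i := ⟨i, by omega⟩)).not.1 h2
      exact Fin.lt_def.2 (by omega)
  · rw [mem_leftSet] at h
    unfold crossings
    rw [Finset.card_eq_zero, Finset.filter_eq_empty_iff]
    rintro i - ⟨h1, h2⟩
    exact h (key i j h1 h2).1

theorem prod_reverse_finRange {G : Type*} [Monoid G] (f : ℕ → G) (n : ℕ) :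
    ((List.finRange (n + 1)).reverse.map fun j => f j.1).prod =
      f n * ((List.finRange n).reverse.map fun j => f j.1).prod := by
  rw [List.finRange_succ_last]
  simp [Function.comp_def]

theorem matsumoto_of_unshuffle {n p : ℕ} {τ : Equiv.Perm (Fin n)} (hτ : τ ∈ unshuffles n p) :
    matsumoto τ = shuffleWord n (leftSet p τ) n := by
  have h : ∀ s : Finset ℕ, ∀ m, ((List.finRange m).reverse.map fun j : Fin m =>
      up n (j.1 - if j.1 ∈ s then (Finset.range j \ s).card else 0)
        (if j.1 ∈ s then (Finset.range j \ s).card else 0)).prod = shuffleWord n s m := by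
    intro s m
    induction m with
    | zero => simp [shuffleWord]
    | succ m ih =>
      rw [prod_reverse_finRange (fun j => up n (j - if j ∈ s then (Finset.range j \ s).card else 0)
        (if j ∈ s then (Finset.range j \ s).card else 0)), ih]
      rfl
  rw [← h, matsumoto]
  congr 2
  funext j
  rw [crossings_of_unshuffle hτ]

theorem card_leftSet {n p : ℕ} (hp : p ≤ n) (τ : Equiv.Perm (Fin n)) : (leftSet p τ).card = p := by
  rw [leftSet, Finset.card_map]
  have : (Finset.univ.filter fun i => (τ i).1 < p) =
      (Finset.univ.filter fun i : Fin n => i.1 < p).map τ⁻¹.toEmbedding := by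
    ext i
    simp only [Finset.mem_filter, Finset.mem_univ, true_and, Finset.mem_map_equiv]
    rfl
  rw [this, Finset.card_map]
  rw [Fin.card_filter_val_lt, Nat.min_eq_right hp]

/-- Two unshuffles with the same left strands are increasing on the same two groups and send each to
the same positions. So their quotient is an order automorphism of `Fin n`, hence trivial. -/
theorem leftSet_injOn {n p : ℕ} {τ τ' : Equiv.Perm (Fin n)} (hτ : τ ∈ unshuffles n p)
    (hτ' : τ' ∈ unshuffles n p) (h : leftSet p τ = leftSet p τ') : τ = τ' := by
  have hs : ∀ i, (τ i).1 < p ↔ (τ' i).1 < p := fun i => by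
    rw [← mem_leftSet, ← mem_leftSet, h]
  have hcount : ∀ {τ : Equiv.Perm (Fin n)}, τ ∈ unshuffles n p → ∀ i j, ((τ i).1 < p ↔ (τ j).1 < p) →
      (τ i < τ j ↔ i < j) := by
    intro τ hτ i j hij
    simp only [unshuffles, Finset.mem_filter, Finset.mem_univ, true_and] at hτ
    constructor
    · intro h
      simpa using hτ (τ i) (τ j) h (by omega)
    · intro h
      by_contra hc
      have hne : τ i ≠ τ j := fun e => by
        have := τ.injective e
        omega
      have := hτ (τ j) (τ i) (lt_of_le_of_ne (not_lt.1 hc) hne.symm) (by omega)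
      simp only [inv_apply] at this
      omega
  let e : Equiv.Perm (Fin n) := τ⁻¹.trans τ'
  have hlt : ∀ a, (e a).1 < p ↔ a.1 < p := fun a => by
    have := hs (τ⁻¹ a)
    simp only [apply_inv] at this
    exact this.symm
  have hmono : StrictMono e := by
    intro a b hab
    by_cases hc : a.1 < p ↔ b.1 < p
    · have h1 := (hcount hτ (τ⁻¹ a) (τ⁻¹ b) (by simpa using hc)).1 (by simpa using hab)
      exact (hcount hτ' (τ⁻¹ a) (τ⁻¹ b) ((hlt a).trans (hc.trans (hlt b).symm))).2 h1
    · have ha := hlt a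
      have hb := hlt b
      rw [Fin.lt_def] at hab ⊢
      omega
  have he : ∀ a, e a = a := by
    have : (hmono.orderIsoOfSurjective e e.surjective) = OrderIso.refl (Fin n) :=
      Subsingleton.elim _ _
    intro a
    exact congrArg (fun f : Fin n ≃o Fin n => f a) this
  ext1 i
  have := he (τ i)
  simp only [e, Equiv.trans_apply, inv_apply] at this
  exact this.symm

/-- The inverse of the unshuffle lists `s` in increasing order and then the complement of `s` in
increasing order. -/
theorem exists_leftSet {n p : ℕ} (hp : p ≤ n) {s : Finset ℕ} (hs : s ⊆ Finset.range n)
    (hc : s.card = p) : ∃ τ ∈ unshuffles n p, leftSet p τ = s := by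
  obtain ⟨q, rfl⟩ := Nat.exists_eq_add_of_le hp
  let t : Finset (Fin (p + q)) := Finset.univ.filter fun i => i.1 ∈ s
  have ht : t.card = p := by
    refine Eq.trans ?_ hc
    rw [← Finset.card_map Fin.valEmbedding]
    congr 1
    ext i
    simp only [t, Finset.mem_map, Finset.mem_filter, Finset.mem_univ, true_and,
      Fin.valEmbedding_apply]
    exact ⟨fun ⟨a, h1, h2⟩ => h2 ▸ h1, fun h => ⟨⟨i, Finset.mem_range.1 (hs h)⟩, h, rfl⟩⟩
  have htc : tᶜ.card = q := by rw [Finset.card_compl, ht, Fintype.card_fin]; omega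
  let f : Equiv.Perm (Fin (p + q)) := finSumFinEquiv.symm.trans (finSumEquivOfFinset ht htc)
  have hl : ∀ i : Fin p, f (Fin.castAdd q i) = t.orderEmbOfFin ht i := fun i => by
    simp [f]
  have hr : ∀ i : Fin q, f (Fin.natAdd p i) = tᶜ.orderEmbOfFin htc i := fun i => by
    simp [f]
  refine ⟨f⁻¹, ?_, ?_⟩
  · simp only [unshuffles, Finset.mem_filter, Finset.mem_univ, true_and, inv_inv]
    intro i j hij h
    rcases h with h | h
    · have e1 : i = Fin.castAdd q ⟨i, by omega⟩ := rfl
      have e2 : j = Fin.castAdd q ⟨j, h⟩ := rfl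
      refine lt_of_eq_of_lt ((congrArg f e1).trans (hl _))
        (lt_of_lt_of_eq ?_ ((congrArg f e2).trans (hl _)).symm)
      simpa using hij
    · have e1 : i = Fin.natAdd p ⟨i - p, by omega⟩ := Fin.ext (by simp; omega)
      have e2 : j = Fin.natAdd p ⟨j - p, by omega⟩ := Fin.ext (by simp; omega)
      refine lt_of_eq_of_lt ((congrArg f e1).trans (hr _))
        (lt_of_lt_of_eq ?_ ((congrArg f e2).trans (hr _)).symm)
      simp only [OrderEmbedding.lt_iff_lt, Fin.lt_def]
      omega
  · have hmem : ∀ a : Fin (p + q), (a.1 < p ↔ (f a).1 ∈ s) := by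
      intro a
      refine Fin.addCases (fun i => ?_) (fun i => ?_) a
      · rw [hl]
        have := Finset.orderEmbOfFin_mem t ht i
        simp only [t, Finset.mem_filter, Finset.mem_univ, true_and] at this
        simpa using this
      · rw [hr]
        have := Finset.orderEmbOfFin_mem tᶜ htc i
        rw [Finset.mem_compl, Finset.mem_filter, not_and] at this
        simpa using this (Finset.mem_univ _)
    ext i
    by_cases hi : i < p + q
    · rw [show i = (⟨i, hi⟩ : Fin (p + q)).1 from rfl, mem_leftSet, hmem]
      simp
    · constructor
      · intro h
        obtain ⟨a, -, rfl⟩ := Finset.mem_map.1 h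
        exact absurd a.2 hi
      · intro h
        exact absurd (Finset.mem_range.1 (hs h)) hi

/-- Unshuffles correspond to the sets of strands that they move left. From here on only the
recursive form of the shuffle elements is used. -/
theorem shuffleElt_eq (n p : ℕ) (hp : p ≤ n) : shuffleElt k n p = sh k n 0 n p := by
  rw [sh_eq_sum, shuffleElt]
  refine Finset.sum_bij (fun τ _ => leftSet p τ) (fun τ hτ => ?_) (fun τ hτ τ' hτ' h => ?_)
    (fun s hs => ?_) (fun τ hτ => ?_)
  · rw [Finset.mem_powersetCard]
    refine ⟨fun i hi => ?_, card_leftSet hp τ⟩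
    obtain ⟨a, -, rfl⟩ := Finset.mem_map.1 hi
    exact Finset.mem_range.2 a.2
  · exact leftSet_injOn hτ hτ' h
  · obtain ⟨hs, hc⟩ := Finset.mem_powersetCard.1 hs
    obtain ⟨τ, h1, h2⟩ := exists_leftSet hp hs hc
    exact ⟨τ, h1, h2⟩
  · rw [matsumoto_of_unshuffle hτ, MonoidAlgebra.of_apply]

end Shuffles

/-! ### Braids and blocks of strands -/

section Blocks

theorem braid_induction {n : ℕ} {P : B n → Prop} (one : P 1) (mul : ∀ a b, P a → P b → P (a * b))
    (inv : ∀ a, P a → P a⁻¹) (gen : ∀ i, i + 1 < n → P (σ n i)) (g : B n) : P g := by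
  have hg : g ∈ Subgroup.closure (Set.range (PresentedGroup.of (rels := {w | BraidRel n w}))) := by
    rw [PresentedGroup.closure_range_of]
    trivial
  induction hg using Subgroup.closure_induction with
  | mem x hx =>
    obtain ⟨i, rfl⟩ := hx
    rw [← σ_of]
    exact gen i (by omega)
  | one => exact one
  | mul a b _ _ ha hb => exact mul a b ha hb
  | inv a _ ha => exact inv a ha

/-- Equivariance passes from the Artin generators to all braids. The action `b` is by plain
functions, so for inverses `x` is first written as `a g (a g⁻¹ x)`. -/
theorem braid_equivariant {n : ℕ} {X Y : Type*} (a : B n →* Equiv.Perm X)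
    (b : B n → Y → Y) (hone : ∀ y, b 1 y = y) (hmul : ∀ g h y, b (g * h) y = b g (b h y))
    (Ψ : X → Y) (h : ∀ i, i + 1 < n → ∀ x, Ψ (a (σ n i) x) = b (σ n i) (Ψ x)) (g : B n) (x : X) :
    Ψ (a g x) = b g (Ψ x) := by
  induction g using braid_induction generalizing x with
  | one => rw [map_one, hone]; rfl
  | mul g h hg hh => rw [map_mul, hmul, ← hh, ← hg]; rfl
  | inv g hg =>
    have e : x = a g (a g⁻¹ x) := by rw [← Equiv.Perm.mul_apply, ← map_mul]; simp
    conv_rhs => rw [e, hg, ← hmul, inv_mul_cancel, hone]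
  | gen i hi => exact h i hi x

theorem up_add (N j c d : ℕ) : up N j (c + d) = up N j c * up N (j + c) d := by
  induction d with
  | zero => simp [up]
  | succ d ih => rw [← add_assoc, up, ih, up, mul_assoc, add_assoc]

theorem σ_comm_up (N j c l : ℕ) (h : c = 0 ∨ j + c < l) : Commute (σ N l) (up N j c) := by
  rcases h with rfl | h
  · exact Commute.one_right _
  · exact σ_comm_up_right N j c l h

theorem up_comm (N j c l d : ℕ) (h : c = 0 ∨ j + c < l) : Commute (up N l d) (up N j c) := by
  induction d with
  | zero => exact Commute.one_left _
  | succ d ih => exact ih.mul_left (σ_comm_up N j c (l + d) (by omega))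

/-- The braid that moves the `s` strands starting at `q + c` to the left past `c` strands. -/
def blk (N q c : ℕ) : ℕ → B N
  | 0 => 1
  | s + 1 => up N (q + s) c * blk N q c s

theorem up_comm_blk (N q c s l d : ℕ) (h : q + c + s ≤ l) :
    Commute (up N l d) (blk N q c s) := by
  induction s with
  | zero => exact Commute.one_right _
  | succ s ih => exact (up_comm N _ c l d (by omega)).mul_right (ih (by omega))

/-- A rectangle of crossings can be read by rows or by columns. The definition of `blk` peels off a
moving strand, whereas here one of the passed strands is peeled off, which is how the block arises
by cabling an `up` braid. -/
theorem blk_succ_left (N q c s : ℕ) : blk N q (c + 1) s = blk N q c s * down N (q + c) s := by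
  induction s with
  | zero => simp [blk, down]
  | succ s ih =>
    have h : σ N (q + c + s) * blk N q c s = blk N q c s * σ N (q + c + s) := by
      have := up_comm_blk N q c s (q + c + s) 1 le_rfl
      simpa [up] using this.eq
    rw [blk, ih, up, down, blk, show q + s + c = q + c + s by omega]
    calc _ = up N (q + s) c * (σ N (q + c + s) * blk N q c s) * down N (q + c) s := by group
      _ = _ := by rw [h]; group

theorem blk_zero_left (N q s : ℕ) : blk N q 0 s = 1 := by
  induction s with
  | zero => rfl
  | succ s ih => rw [blk, ih, up, mul_one]

end Blocks

/-! ### The Vandermonde identity for shuffle elements -/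

section Vandermonde

variable (k : Type*) [Field k]

theorem up_comm_sh (N n p l d : ℕ) (h : n ≤ l) :
    Commute (MonoidAlgebra.of k (B N) (up N l d)) (sh k N 0 n p) := by
  induction n generalizing p with
  | zero => cases p with
    | zero => exact Commute.one_right _
    | succ p => exact Commute.zero_right _
  | succ n ih => cases p with
    | zero => exact ih 0 (by omega)
    | succ p =>
      refine (ih (p + 1) (by omega)).add_right (Commute.mul_right ?_ (ih p (by omega)))
      exact (up_comm N (0 + p) (n - p) l d (by omega)).map (MonoidAlgebra.of k (B N))

/-- Of the `p` strands that go left, `q` are among the first `j` strands and `s` among the last `n`.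
Both groups are shuffled separately, and then the `s` strands are carried past the `j - q` strands
of the first group that stay right. The induction is on `n`, comparing what the last strand does. -/
theorem sh_add (N j n p : ℕ) : sh k N 0 (j + n) p =
    ∑ x ∈ Finset.HasAntidiagonal.antidiagonal p, MonoidAlgebra.of k (B N) (blk N x.1 (j - x.1) x.2) *
      (sh k N 0 j x.1 * sh k N j n x.2) := by
  induction n generalizing p with
  | zero =>
    rw [Finset.sum_eq_single (p, 0)]
    · simp [blk, sh_zero, ← MonoidAlgebra.one_def]
    · rintro ⟨q, s⟩ hx hne
      have : s ≠ 0 := by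
        rintro rfl
        simp only [Finset.HasAntidiagonal.mem_antidiagonal] at hx
        exact hne (by simp [← hx])
      rw [sh_of_lt k N j 0 s (by omega), mul_zero, mul_zero]
    · simp
  | succ n ih =>
    rw [← add_assoc]
    cases p with
    | zero => simp [sh_zero, blk, MonoidAlgebra.one_def]
    | succ p =>
      rw [sh_succ_succ, ih, ih, Finset.Nat.sum_antidiagonal_succ' (n := p),
        Finset.Nat.sum_antidiagonal_succ' (n := p)]
      simp only [sh_zero, sh_succ_succ, mul_add, Finset.sum_add_distrib]
      rw [add_assoc, Finset.mul_sum]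
      congr 2
      refine Finset.sum_congr rfl fun x hx => ?_
      obtain ⟨q, s⟩ := x
      obtain rfl := Finset.HasAntidiagonal.mem_antidiagonal.1 hx
      dsimp only
      by_cases hq : j < q
      · rw [sh_of_lt k N 0 j q hq]; simp
      by_cases hs : n < s
      · rw [sh_of_lt k N j n s hs]; simp
      -- The last strand moves left in two stages: first past the `n - s` strands of its own group,
      -- then past the `j - q` strands of the first group. The second stage enlarges the block from
      -- `s` to `s + 1` strands.
      have e : up N (0 + (q + s)) (j + n - (q + s)) * blk N q (j - q) s =
          blk N q (j - q) (s + 1) * up N (j + s) (n - s) := by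
        rw [blk, mul_assoc, ← (up_comm_blk N q (j - q) s (j + s) (n - s) (by omega)).eq,
          ← mul_assoc, show j + n - (q + s) = (j - q) + (n - s) by omega, up_add,
          show 0 + (q + s) = q + s by omega, show q + s + (j - q) = j + s by omega]
      have c := (up_comm_sh k N j q (j + s) (n - s) (by omega)).eq
      calc _ = MonoidAlgebra.of k (B N) (up N (0 + (q + s)) (j + n - (q + s)) * blk N q (j - q) s) *
            (sh k N 0 j q * sh k N j n s) := by rw [map_mul, mul_assoc]
        _ = MonoidAlgebra.of k (B N) (blk N q (j - q) (s + 1)) *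
          ((MonoidAlgebra.of k (B N) (up N (j + s) (n - s)) * sh k N 0 j q) * sh k N j n s) := by
          rw [e, map_mul]; simp only [mul_assoc]
        _ = _ := by rw [c]; simp only [mul_assoc]

end Vandermonde

/-! ### Cabling of shuffles -/

section Cabling

variable {M N n : ℕ} {G : Type*} [Group G] (hN : N + 1 = M + n) (φ : B N →* G)

theorem sw_lt {M l j : ℕ} (hl : l + 1 < M) (hj : j < M) : sw l j < M := by
  unfold sw
  split_ifs <;> omega

theorem cable_σ (l : ℕ) (hl : l + 1 < M) (x : Fin M × G) : cable hN φ (σ M l) x =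
    (⟨sw l x.1, sw_lt hl x.1.2⟩, φ (cableGen N n l x.1) * x.2) := by
  rw [cable, braidLift_σ _ _ _ _ _ hl, dif_pos hl]
  exact Prod.ext (Fin.ext (swap_val hl x.1)) rfl

/-- The cabling of the strand of `γ` that starts at `j` is the braid `c`; this strand ends
at `j'`. -/
def IsCable (γ : B M) (j j' : ℕ) (c : B N) : Prop :=
  ∀ (x : Fin M × G), x.1.1 = j → ((cable hN φ γ x).1.1 = j' ∧ (cable hN φ γ x).2 = φ c * x.2)

variable {hN φ}

theorem IsCable.one (j : ℕ) : IsCable hN φ 1 j j 1 := fun x hx => by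
  rw [map_one, map_one, one_mul]
  exact ⟨hx, rfl⟩

theorem IsCable.mul {γ γ' : B M} {j j' j'' : ℕ} {c c' : B N} (h' : IsCable hN φ γ' j' j'' c')
    (h : IsCable hN φ γ j j' c) : IsCable hN φ (γ' * γ) j j'' (c' * c) := fun x hx => by
  rw [map_mul, Equiv.Perm.mul_apply, map_mul, mul_assoc]
  obtain ⟨h1, h2⟩ := h x hx
  obtain ⟨h3, h4⟩ := h' _ h1
  exact ⟨h3, by rw [h4, h2]⟩

theorem IsCable.σ (l j : ℕ) (hl : l + 1 < M) :
    IsCable hN φ (σ M l) j (sw l j) (cableGen N n l j) := fun x hx => by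
  rw [cable_σ hN φ l hl, ← hx]
  exact ⟨rfl, rfl⟩

theorem IsCable.congr {γ : B M} {j j' j'' : ℕ} {c c' : B N} (h : IsCable hN φ γ j j' c)
    (hj : j' = j'') (hc : c = c') : IsCable hN φ γ j j'' c' := hj ▸ hc ▸ h

/-- All crossings lie to the right of the cable, so their positions grow by `n - 1`. The subtraction
is exact, since `j < l` forces `l` to be positive. -/
theorem isCable_up_right (l c j : ℕ) (h : c = 0 ∨ l + c < M) (hj : j < l) :
    IsCable hN φ (up M l c) j j (up N (l + n - 1) c) := by
  induction c with
  | zero => exact .one j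
  | succ c ih =>
    refine ((ih (by omega)).mul ((IsCable.σ (l + c) j (by omega)).congr (j'' := j) ?_ rfl)).congr
      rfl ?_
    · unfold sw; split_ifs <;> omega
    · rw [up]
      congr 1
      unfold cableGen
      rw [if_neg (by omega), if_neg (by omega), if_pos (by omega)]
      congr 1
      omega

theorem isCable_up_left (l c j : ℕ) (h : l + c < M) (hj : l + c < j) :
    IsCable hN φ (up M l c) j j (up N l c) := by
  induction c with
  | zero => exact .one j
  | succ c ih =>
    refine ((ih (by omega) (by omega)).mul ((IsCable.σ (l + c) j (by omega)).congr (j'' := j)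
      ?_ rfl)).congr rfl ?_
    · unfold sw; split_ifs <;> omega
    · rw [up]
      congr 1
      unfold cableGen
      rw [if_neg (by omega), if_neg (by omega), if_neg (by omega)]

/-- The cable is one of the strands that are passed, so the passing strand meets `n` strands in
place of one. The braid is cut into the parts before, at and after the cable. -/
theorem isCable_up_mid (l c j : ℕ) (h : l + c < M) (hj : l ≤ j) (hj' : j < l + c) :
    IsCable hN φ (up M l c) j (j + 1) (up N l (c + n - 1)) := by
  obtain ⟨a, rfl⟩ := Nat.exists_eq_add_of_le hj
  obtain ⟨d, rfl⟩ : ∃ d, c = a + (1 + d) := ⟨c - a - 1, by omega⟩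
  have h1 : IsCable hN φ (up M (l + a + 1) d) (l + a) (l + a) (up N (l + a + n) d) :=
    (isCable_up_right (l + a + 1) d (l + a) (by omega) (by omega)).congr rfl
      (by congr 1; omega)
  have h2 : IsCable hN φ (up M (l + a) 1) (l + a) (l + a + 1) (up N (l + a) n) := by
    have := IsCable.σ (hN := hN) (φ := φ) (l + a) (l + a) (by omega)
    simpa [up, sw, cableGen] using this
  have h3 := isCable_up_left (hN := hN) (φ := φ) l a (l + a + 1) (by omega) (by omega)
  rw [up_add M l a, up_add]
  refine (h3.mul (h2.mul h1)).congr rfl ?_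
  rw [show a + (1 + d) + n - 1 = a + (n + d) by omega, up_add N l a, up_add]

/-- The passing strand is the cable itself, so a whole block of `n` strands moves past the `c`
others. -/
theorem isCable_up_last (l c : ℕ) (h : l + c < M) :
    IsCable hN φ (up M l c) (l + c) l (blk N l c n) := by
  induction c with
  | zero => exact (IsCable.one l).congr rfl (blk_zero_left N l n).symm
  | succ c ih =>
    refine ((ih (by omega)).mul ((IsCable.σ (l + c) (l + (c + 1)) (by omega)).congr ?_ rfl)).congr
      rfl ?_
    · unfold sw; split_ifs <;> omega
    · rw [blk_succ_left]
      congr 1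
      unfold cableGen
      rw [if_neg (by omega), if_pos (by omega)]

theorem shift_σ (n N j : ℕ) (h : j + n ≤ N) (i : ℕ) (hi : i + 1 < n) :
    shift n N j h (σ n i) = σ N (j + i) := braidLift_σ _ _ _ _ _ hi

theorem shift_up (n N j : ℕ) (h : j + n ≤ N) (i c : ℕ) (hi : c = 0 ∨ i + c < n) :
    shift n N j h (up n i c) = up N (j + i) c := by
  induction c with
  | zero => exact map_one _
  | succ c ih => rw [up, map_mul, ih (by omega), shift_σ _ _ _ _ _ (by omega), up, add_assoc]

/-- A strand slides under a crossing of the strands that it passes. This is a single braid relation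
in the middle of `up`, whose remaining letters commute with the crossing. -/
theorem up_σ (N l n t : ℕ) (hN : l + n < N) (h : t + 1 < n) :
    up N l n * σ N (l + t) = σ N (l + 1 + t) * up N l n := by
  obtain ⟨d, rfl⟩ := Nat.exists_eq_add_of_lt h
  have e1 : up N l (t + 1 + d + 1) = up N l t * (σ N (l + t) * σ N (l + t + 1)) *
      up N (l + t + 2) d := by
    rw [show t + 1 + d + 1 = t + (2 + d) by omega, up_add, up_add]
    simp [up, mul_assoc]
  have c1 : σ N (l + t) * up N (l + t + 2) d = up N (l + t + 2) d * σ N (l + t) :=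
    σ_comm_up_left N _ d _ (by omega)
  have c2 : σ N (l + t + 1) * up N l t = up N l t * σ N (l + t + 1) :=
    σ_comm_up_right N l t _ (by omega)
  have b := σ_braid N (l + t) (by omega)
  rw [e1, show l + 1 + t = l + t + 1 by omega]
  calc _ = up N l t * (σ N (l + t) * σ N (l + t + 1)) * (up N (l + t + 2) d * σ N (l + t)) := by
        group
    _ = up N l t * (σ N (l + t) * σ N (l + t + 1) * σ N (l + t)) * up N (l + t + 2) d := by
        rw [← c1]; group
    _ = (up N l t * σ N (l + t + 1)) * σ N (l + t) * σ N (l + t + 1) * up N (l + t + 2) d := by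
        rw [b]; group
    _ = _ := by rw [← c2]; group

theorem down_add (N j c d : ℕ) : down N j (c + d) = down N (j + c) d * down N j c := by
  induction d with
  | zero => simp [down]
  | succ d ih => rw [← add_assoc, down, ih, down, mul_assoc, add_assoc]

theorem down_σ (N l n t : ℕ) (hN : l + n < N) (h : t + 1 < n) :
    down N l n * σ N (l + 1 + t) = σ N (l + t) * down N l n := by
  obtain ⟨d, rfl⟩ := Nat.exists_eq_add_of_lt h
  have e1 : down N l (t + 1 + d + 1) = down N (l + t + 2) d * (σ N (l + t + 1) * σ N (l + t)) *
      down N l t := by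
    rw [show t + 1 + d + 1 = t + (2 + d) by omega, down_add, down_add]
    simp [down]
  have c1 : σ N (l + t) * down N (l + t + 2) d = down N (l + t + 2) d * σ N (l + t) :=
    σ_comm_down_left N _ d _ (by omega)
  have c2 : σ N (l + t + 1) * down N l t = down N l t * σ N (l + t + 1) :=
    σ_comm_down_right N l t _ (by omega)
  have b := σ_braid N (l + t) (by omega)
  rw [e1, show l + 1 + t = l + t + 1 by omega]
  calc _ = down N (l + t + 2) d * (σ N (l + t + 1) * σ N (l + t)) *
        (down N l t * σ N (l + t + 1)) := by group
    _ = down N (l + t + 2) d * (σ N (l + t + 1) * σ N (l + t) * σ N (l + t + 1)) * down N l t := by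
        rw [← c2]; group
    _ = (down N (l + t + 2) d * σ N (l + t)) * σ N (l + t + 1) * σ N (l + t) * down N l t := by
        rw [← b]; group
    _ = _ := by rw [← c1]; group

/-- Conjugation with the cabled braids moves a braid in the cable along the strand. -/
theorem cableGen_mul_shift (l j t : ℕ) (hN : N + 1 = M + n) (hl : l + 1 < M) (hj : j < M)
    (ht : t + 1 < n) : cableGen N n l j * BraidedPrim.σ N (j + t) =
      BraidedPrim.σ N (sw l j + t) * cableGen N n l j := by
  unfold cableGen sw
  split_ifs with h1 h2 h3
  · subst h1
    exact up_σ N j n t (by omega) ht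
  · subst h2
    exact down_σ N l n t (by omega) ht
  · exact (σ_comm N (j + t) (l + n - 1) (by omega)).symm
  · exact σ_comm N l (j + t) (by omega)

/-- A braid inside the cable can be slid along it: conjugated back by the cabled braid, it does not
depend on how far the strand has been followed. This is an invariance under `B M`, so the generators
suffice. -/
theorem cable_shift_invariant (hN : N + 1 = M + n) (φ : B N →* G) (ρ : B n) (γ : B M)
    (x : Fin M × G) :
    φ (shift n N (cable hN φ γ x).1 (by have := (cable hN φ γ x).1.2; omega) ρ) =
      (cable hN φ γ x).2 * x.2⁻¹ * φ (shift n N x.1 (by have := x.1.2; omega) ρ) *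
        x.2 * (cable hN φ γ x).2⁻¹ := by
  let Ψ : Fin M × G → G := fun x =>
    x.2⁻¹ * φ (shift n N x.1 (by have := x.1.2; omega) ρ) * x.2
  have hΨ : ∀ γ x, Ψ (cable hN φ γ x) = Ψ x := by
    intro γ x
    refine braid_equivariant (cable hN φ) (fun _ y => y) (fun _ => rfl) (fun _ _ _ => rfl) Ψ ?_ γ x
    intro i hi x
    rw [cable_σ hN φ i hi]
    simp only [Ψ, mul_inv_rev]
    have key : ∀ ρ : B n, shift n N (sw i x.1) (by have := sw_lt hi x.1.2; omega) ρ *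
        cableGen N n i x.1 = cableGen N n i x.1 * shift n N x.1 (by have := x.1.2; omega) ρ := by
      intro ρ
      induction ρ using braid_induction with
      | one => simp
      | mul a b ha hb => rw [map_mul, map_mul, mul_assoc, hb, ← mul_assoc, ha, mul_assoc]
      | inv a ha =>
        rw [map_inv, map_inv, inv_mul_eq_iff_eq_mul, ← mul_assoc, eq_mul_inv_iff_mul_eq, ha]
      | gen t ht =>
        rw [shift_σ _ _ _ _ _ ht, shift_σ _ _ _ _ _ ht, cableGen_mul_shift i x.1 t hN hi x.1.2 ht]
    have := congrArg φ (key ρ)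
    rw [map_mul, map_mul] at this
    calc _ = x.2⁻¹ * (φ (cableGen N n i x.1))⁻¹ *
        (φ (shift n N (sw i x.1) (by have := sw_lt hi x.1.2; omega) ρ) *
          φ (cableGen N n i x.1)) * x.2 := by group
      _ = _ := by rw [this]; group
  have := hΨ γ x
  simp only [Ψ] at this
  rw [inv_mul_eq_iff_eq_mul.1 ((mul_assoc _ _ _).symm.trans this) |> eq_mul_inv_of_mul_eq]
  group

end Cabling

/-! ### The shuffle elements and operadic composition -/

section ShuffleComp

variable (k : Type*) [Field k] {M N n : ℕ} {G : Type*} [Group G] (hN : N + 1 = M + n)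
  (φ : B N →* G)

/-- The module of formal linear combinations of pairs of a position and an element of `G`, on which
`k[B M]` acts by cabling. -/
noncomputable def cabMod : MonoidAlgebra k (B M) →ₐ[k] Module.End k ((Fin M × G) →₀ k) :=
  MonoidAlgebra.lift k (Module.End k ((Fin M × G) →₀ k)) (B M)
    { toFun := fun γ => Finsupp.lmapDomain k k (cable hN φ γ)
      map_one' := by
        rw [map_one]
        exact Finsupp.lmapDomain_id k k
      map_mul' := fun a b => by
        rw [map_mul]
        exact Finsupp.lmapDomain_comp k k (cable hN φ b) (cable hN φ a) }

theorem cabMod_of (γ : B M) (x : Fin M × G) (s : k) :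
    cabMod k hN φ (MonoidAlgebra.of k _ γ) (Finsupp.single x s) =
      Finsupp.single (cable hN φ γ x) s := by
  rw [cabMod, MonoidAlgebra.lift_of]
  exact Finsupp.mapDomain_single

/-- The image in `k[G]` of an element of `k[B n]`, placed on the strands that start at `j`. -/
noncomputable def place (j : Fin M) : MonoidAlgebra k (B n) →ₐ[k] MonoidAlgebra k G :=
  MonoidAlgebra.mapDomainAlgHom k k (φ.comp (shift n N j (by have := j.2; omega)))

theorem place_of (j : Fin M) (ρ : B n) : place k hN φ j (MonoidAlgebra.of k _ ρ) =
    MonoidAlgebra.of k G (φ (shift n N j (by have := j.2; omega) ρ)) := by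
  rw [place, MonoidAlgebra.of_apply, MonoidAlgebra.of_apply]
  exact MonoidAlgebra.mapDomain_single

/-- The linear map `(j, g) ↦ β_j g`. -/
noncomputable def insertBlock (β : MonoidAlgebra k (B n)) :
    ((Fin M × G) →₀ k) →ₗ[k] MonoidAlgebra k G :=
  Finsupp.linearCombination k fun x => place k hN φ x.1 β * MonoidAlgebra.of k G x.2

theorem insertBlock_single (β : MonoidAlgebra k (B n)) (x : Fin M × G) (s : k) :
    insertBlock k hN φ β (Finsupp.single x s) =
      s • (place k hN φ x.1 β * MonoidAlgebra.of k G x.2) :=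
  Finsupp.linearCombination_single k s x

/-- Since braids inside the cable slide along it, `β` may be inserted at the start of the strand
instead of its end. -/
theorem insertBlock_cable (β : MonoidAlgebra k (B n)) {γ : B M} {j j' : ℕ} {c : B N}
    (h : IsCable hN φ γ j j' c) (x : Fin M × G) (hx : x.1.1 = j) (s : k) :
    insertBlock k hN φ β (cabMod k hN φ (MonoidAlgebra.of k _ γ) (Finsupp.single x s)) =
      MonoidAlgebra.of k G (φ c) * insertBlock k hN φ β (Finsupp.single x s) := by
  obtain ⟨h1, h2⟩ := h x hx
  rw [cabMod_of, insertBlock_single, insertBlock_single, mul_smul_comm]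
  congr 1
  have key : ∀ β : MonoidAlgebra k (B n), place k hN φ (cable hN φ γ x).1 β *
      MonoidAlgebra.of k G (φ c) = MonoidAlgebra.of k G (φ c) * place k hN φ x.1 β := by
    intro β
    induction β using MonoidAlgebra.induction_linear with
    | zero => simp
    | add a b ha hb => rw [map_add, map_add, add_mul, mul_add, ha, hb]
    | single ρ s =>
      have e : MonoidAlgebra.single ρ s = s • MonoidAlgebra.of k (B n) ρ := by simp
      rw [e, map_smul, map_smul, smul_mul_assoc, mul_smul_comm, place_of k hN, place_of k hN,
        ← map_mul (MonoidAlgebra.of k G), ← map_mul (MonoidAlgebra.of k G)]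
      congr 2
      rw [cable_shift_invariant hN φ ρ γ x, h2, mul_inv_rev]
      simp only [mul_assoc, mul_inv_cancel_left, inv_mul_cancel, mul_one]
      exact hN
  rw [h2, map_mul, ← mul_assoc, key, mul_assoc]

/-- The recursion that is satisfied by the shuffle elements, with arbitrary initial values. -/
noncomputable def shRec (m : ℕ) (F : ℕ → MonoidAlgebra k G) : ℕ → ℕ → MonoidAlgebra k G
  | 0, p => F p
  | r + 1, 0 => shRec m F r 0
  | r + 1, p + 1 => shRec m F r (p + 1) +
      MonoidAlgebra.of k G (φ (up N p (m + r - p))) * shRec m F r p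

/-- This linearity in the initial values is the purpose of `shRec`. The shuffles in which a block
goes left and those in which it goes right obey the same recursion over the strands to the right of
the block, so they need to be compared with the full shuffle only at the block. -/
theorem shRec_add (m : ℕ) (F F' : ℕ → MonoidAlgebra k G) (r p : ℕ) :
    shRec k φ m (fun p => F p + F' p) r p = shRec k φ m F r p + shRec k φ m F' r p := by
  induction r generalizing p with
  | zero => rfl
  | succ r ih => cases p with
    | zero => exact ih 0
    | succ p => rw [shRec, shRec, shRec, ih, ih, mul_add]; abel

theorem shRec_eq_zero (m : ℕ) (F : ℕ → MonoidAlgebra k G) (a : ℕ) (hF : ∀ p < a, F p = 0)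
    (r p : ℕ) (hp : p < a) : shRec k φ m F r p = 0 := by
  induction r generalizing p with
  | zero => exact hF p hp
  | succ r ih => cases p with
    | zero => exact ih 0 hp
    | succ p => rw [shRec, ih _ hp, ih _ (by omega), mul_zero, add_zero]

theorem shRec_sh (m : ℕ) (y : MonoidAlgebra k G) (r p : ℕ) :
    shRec k φ m (fun p => MonoidAlgebra.mapDomainAlgHom k k φ (sh k N 0 m p) * y) r p =
      MonoidAlgebra.mapDomainAlgHom k k φ (sh k N 0 (m + r) p) * y := by
  induction r generalizing p with
  | zero => rfl
  | succ r ih => cases p with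
    | zero => rw [shRec, ih, sh_zero, sh_zero]
    | succ p =>
      rw [shRec, ih, ih, ← add_assoc m r 1, sh_succ_succ, map_add, map_mul, add_mul, mul_assoc,
        Nat.zero_add]
      congr 2
      exact MonoidAlgebra.mapDomain_single.symm

/-- Vectors which are supported on the positions in `s`. -/
noncomputable abbrev suppPos (M : ℕ) (G : Type*) (s : Set ℕ) : Submodule k ((Fin M × G) →₀ k) :=
  Finsupp.supported k k {x | x.1.1 ∈ s}

theorem suppPos_induction {G : Type*} {s : Set ℕ} {P : ((Fin M × G) →₀ k) → Prop} (h0 : P 0)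
    (hadd : ∀ a b, P a → P b → P (a + b))
    (hs : ∀ (x : Fin M × G) (c : k), x.1.1 ∈ s → P (Finsupp.single x c)) {y}
    (hy : y ∈ suppPos k M G s) : P y := by
  classical
  induction y using Finsupp.induction with
  | zero => exact h0
  | single_add x c y hx hc ih =>
    rw [Finsupp.mem_supported] at hy
    rw [Finsupp.support_single_add hx hc] at hy
    refine hadd _ _ (hs x c (hy (by simp))) (ih ?_)
    rw [Finsupp.mem_supported]
    exact fun a ha => hy (by simp only [Finset.coe_cons, Set.mem_insert_iff]; exact .inr ha)

theorem cabMod_mem {s t : Set ℕ} {γ : B M}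
    (h : ∀ x : Fin M × G, x.1.1 ∈ s → (cable hN φ γ x).1.1 ∈ t) {y} (hy : y ∈ suppPos k M G s) :
    cabMod k hN φ (MonoidAlgebra.of k _ γ) y ∈ suppPos k M G t := by
  refine suppPos_induction k (P := fun y => cabMod k hN φ (MonoidAlgebra.of k _ γ) y ∈
    suppPos k M G t) (by rw [map_zero]; exact Submodule.zero_mem _)
    (fun a b ha hb => by rw [map_add]; exact Submodule.add_mem _ ha hb) (fun x c hx => ?_) hy
  rw [cabMod_of]
  exact Finsupp.single_mem_supported k c (h x hx)

theorem insertBlock_up (β : MonoidAlgebra k (B n)) {s : Set ℕ} {γ : B M} {c : B N}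
    (h : ∀ j ∈ s, ∃ j', IsCable hN φ γ j j' c) {y} (hy : y ∈ suppPos k M G s) :
    insertBlock k hN φ β (cabMod k hN φ (MonoidAlgebra.of k _ γ) y) =
      MonoidAlgebra.of k G (φ c) * insertBlock k hN φ β y := by
  refine suppPos_induction k (P := fun y => insertBlock k hN φ β (cabMod k hN φ
    (MonoidAlgebra.of k _ γ) y) = MonoidAlgebra.of k G (φ c) * insertBlock k hN φ β y) (by simp)
    (fun a b ha hb => by simp only [map_add, mul_add, ha, hb]) (fun x c hx => ?_) hy
  obtain ⟨j', hj'⟩ := h _ hx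
  exact insertBlock_cable k hN φ β hj' x rfl c

theorem suppPos_mono {G : Type*} {s t : Set ℕ} (h : s ⊆ t) : suppPos k M G s ≤ suppPos k M G t :=
  Finsupp.supported_mono fun _ hx => h hx

/-- Vectors in the position `j`. -/
noncomputable def atPos (j : Fin M) : MonoidAlgebra k G →ₗ[k] ((Fin M × G) →₀ k) :=
  (Finsupp.lmapDomain k k fun g => (j, g)).comp (MonoidAlgebra.coeffLinearEquiv k).toLinearMap

theorem atPos_of (j : Fin M) (g : G) (s : k) :
    atPos k j (s • MonoidAlgebra.of k G g) = Finsupp.single (j, g) s := by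
  simp [atPos]

theorem atPos_mem (j : Fin M) (y : MonoidAlgebra k G) {s : Set ℕ} (hj : j.1 ∈ s) :
    atPos k j y ∈ suppPos k M G s := by
  induction y using MonoidAlgebra.induction_linear with
  | zero => rw [map_zero]; exact Submodule.zero_mem _
  | add a b ha hb => rw [map_add]; exact Submodule.add_mem _ ha hb
  | single g c =>
    have e : MonoidAlgebra.single g c = c • MonoidAlgebra.of k G g := by simp
    rw [e, atPos_of]
    exact Finsupp.single_mem_supported k c hj

theorem insertBlock_atPos (β : MonoidAlgebra k (B n)) (j : Fin M) (y : MonoidAlgebra k G) :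
    insertBlock k hN φ β (atPos k j y) = place k hN φ j β * y := by
  induction y using MonoidAlgebra.induction_linear with
  | zero => simp
  | add a b ha hb => rw [map_add, map_add, ha, hb, mul_add]
  | single g c =>
    have e : MonoidAlgebra.single g c = c • MonoidAlgebra.of k G g := by simp
    rw [e, atPos_of, insertBlock_single, mul_smul_comm]

theorem cabMod_atPos {γ : B M} {j j' : Fin M} {c : B N} (h : IsCable hN φ γ j j' c)
    (y : MonoidAlgebra k G) : cabMod k hN φ (MonoidAlgebra.of k _ γ) (atPos k j y) =
      atPos k j' (MonoidAlgebra.of k G (φ c) * y) := by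
  induction y using MonoidAlgebra.induction_linear with
  | zero => simp
  | add a b ha hb => simp only [map_add, ha, hb, mul_add]
  | single g s =>
    have e : MonoidAlgebra.single g s = s • MonoidAlgebra.of k G g := by simp
    obtain ⟨h1, h2⟩ := h (j, g) rfl
    rw [e, atPos_of, cabMod_of, mul_smul_comm, ← map_mul, atPos_of]
    congr 1
    exact Prod.ext (Fin.ext h1) h2

/-- Only strands to the left of position `j` are shuffled. The strand at `j` stays, and replacing it
by a cable does not affect the positions of the crossings. -/
theorem cabMod_sh_atPos (j : Fin M) (m p : ℕ) (hm : m ≤ j.1) (y : MonoidAlgebra k G) :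
    cabMod k hN φ (sh k M 0 m p) (atPos k j y) =
      atPos k j (MonoidAlgebra.mapDomainAlgHom k k φ (sh k N 0 m p) * y) := by
  induction m generalizing p with
  | zero => cases p with
    | zero => rw [sh_zero, sh_zero, map_one, map_one, one_mul]; rfl
    | succ p => rw [sh_of_lt _ _ _ _ _ (by omega), sh_of_lt _ _ _ _ _ (by omega)]; simp
  | succ m ih => cases p with
    | zero => rw [sh_zero, sh_zero, map_one, map_one, one_mul]; rfl
    | succ p =>
      rw [sh_succ_succ, sh_succ_succ, map_add (cabMod k hN φ), map_mul (cabMod k hN φ),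
        LinearMap.add_apply, Module.End.mul_apply, ih _ (by omega), ih _ (by omega),
        map_add (MonoidAlgebra.mapDomainAlgHom k k φ),
        map_mul (MonoidAlgebra.mapDomainAlgHom k k φ), add_mul, map_add, Nat.zero_add, mul_assoc]
      congr 1
      have hj := j.2
      by_cases hp : m < p
      · rw [sh_of_lt _ _ _ _ _ hp]; simp
      have hc : IsCable hN φ (up M p (m - p)) j j (up N p (m - p)) :=
        isCable_up_left p (m - p) j (by omega) (by omega)
      rw [cabMod_atPos k hN φ hc]
      congr 2
      exact MonoidAlgebra.mapDomain_single.symm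

end ShuffleComp

/-! ### Shuffles in which a cabled strand goes left or right -/

section ShuffleSplit

variable (k : Type*) [Field k] {M N n : ℕ} {G : Type*} [Group G] (hN : N + 1 = M + (n + 1))
  (φ : B N →* G)

/-- The terms of the shuffle elements in which the block that starts at `j` moves to the left. -/
noncomputable def leftTerms (j : ℕ) (y : MonoidAlgebra k G) (p : ℕ) : MonoidAlgebra k G :=
  if n + 1 ≤ p then MonoidAlgebra.mapDomainAlgHom k k φ
    (MonoidAlgebra.of k (B N) (blk N (p - (n + 1)) (j - (p - (n + 1))) (n + 1)) *
      sh k N 0 j (p - (n + 1))) * y else 0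

/-- The terms of the shuffle elements in which the block that starts at `j` stays. -/
noncomputable def rightTerms (j : ℕ) (y : MonoidAlgebra k G) (p : ℕ) : MonoidAlgebra k G :=
  MonoidAlgebra.mapDomainAlgHom k k φ (sh k N 0 j p) * y

/-- Induction over the `r` strands to the right of position `j`. If the strand at `j` goes left, its
cable contributes `n + 1` strands to the left part where it contributed one, which turns the index
`p` into `p + n`; if it stays, the index is still `p`. -/
theorem cabMod_sh_split (β : MonoidAlgebra k (B (n + 1))) (j : Fin M) (y : MonoidAlgebra k G)
    (r p : ℕ) (hr : j.1 + 1 + r ≤ M) : ∃ l ∈ suppPos k M G {a | a < p},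
      ∃ ρ ∈ suppPos k M G {a | p ≤ a ∧ a < j.1 + 1 + r},
      cabMod k hN φ (sh k M 0 (j.1 + 1 + r) p) (atPos k j y) = l + ρ ∧
      insertBlock k hN φ β l =
        shRec k φ (j.1 + (n + 1)) (leftTerms k (n := n) φ j (place k hN φ j β * y)) r (p + n) ∧
      insertBlock k hN φ β ρ =
        shRec k φ (j.1 + (n + 1)) (rightTerms k φ j (place k hN φ j β * y)) r p := by
  -- Shuffles of the first `j` strands commute with braids in the cable, as they involve disjoint
  -- strands. This is deduced from the fact that `insertBlock` turns the cabled action on a fixed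
  -- position into left multiplication.
  have place_comm : ∀ p, MonoidAlgebra.mapDomainAlgHom k k φ (sh k N 0 j p) * place k hN φ j β =
      place k hN φ j β * MonoidAlgebra.mapDomainAlgHom k k φ (sh k N 0 j p) := by
    intro p
    have h1 := insertBlock_atPos k hN φ β j (MonoidAlgebra.mapDomainAlgHom k k φ (sh k N 0 j p) * 1)
    rw [← cabMod_sh_atPos k hN φ j j p le_rfl, mul_one] at h1
    rw [← h1]
    clear h1
    generalize hm : j.1 = m
    have hm' : m ≤ j.1 := hm.ge
    clear hm
    induction m generalizing p with
    | zero => cases p with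
      | zero => rw [sh_zero, sh_zero, map_one, map_one, Module.End.one_apply, insertBlock_atPos,
          one_mul, mul_one]
      | succ p => rw [sh_of_lt _ _ _ _ _ (by omega), sh_of_lt _ _ _ _ _ (by omega)]; simp
    | succ m ih => cases p with
      | zero => rw [sh_zero, sh_zero, map_one, map_one, Module.End.one_apply, insertBlock_atPos,
          one_mul, mul_one]
      | succ p =>
        rw [sh_succ_succ, sh_succ_succ, map_add, map_add, map_mul, map_mul, LinearMap.add_apply,
          Module.End.mul_apply, map_add, ← ih _ (by omega), add_mul, mul_assoc, ih p (by omega),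
          Nat.zero_add]
        congr 1
        by_cases hp : m < p
        · rw [sh_of_lt _ _ _ _ _ hp]; simp
        have hj := j.2
        rw [insertBlock_up k hN φ β (s := {j.1}) (c := up N p (m - p))
          (fun a ha => ⟨j, by
            rw [Set.mem_singleton_iff.1 ha]
            exact isCable_up_left p (m - p) j (by omega) (by omega)⟩)]
        · congr 1
          exact MonoidAlgebra.mapDomain_single
        · rw [cabMod_sh_atPos k hN φ j m p (by omega)]
          exact atPos_mem k j _ rfl
  induction r generalizing p with
  | zero =>
    cases p with
    | zero =>
      refine ⟨0, Submodule.zero_mem _, atPos k j y, atPos_mem k j _ ⟨Nat.zero_le _, by omega⟩, ?_,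
        ?_, ?_⟩
      · rw [sh_zero, map_one, zero_add]; rfl
      · rw [map_zero, shRec, leftTerms, if_neg (by omega)]
      · rw [insertBlock_atPos, shRec, rightTerms, sh_zero, map_one, one_mul]
    | succ p =>
      by_cases hp : j.1 < p
      · refine ⟨0, Submodule.zero_mem _, 0, Submodule.zero_mem _, ?_, ?_, ?_⟩
        · rw [sh_of_lt _ _ _ _ _ (by omega)]; simp
        · rw [map_zero, shRec, leftTerms, if_pos (by omega), sh_of_lt _ _ _ _ _ (by omega)]; simp
        · rw [map_zero, shRec, rightTerms, sh_of_lt _ _ _ _ _ (by omega)]; simp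
      have hj := j.2
      have hc : IsCable hN φ (up M p (j.1 - p)) j (⟨p, by omega⟩ : Fin M)
          (blk N p (j.1 - p) (n + 1)) := by
        have := isCable_up_last (hN := hN) (φ := φ) p (j.1 - p) (by omega)
        rwa [show p + (j.1 - p) = j.1 by omega] at this
      refine ⟨cabMod k hN φ (MonoidAlgebra.of k _ (up M p (j.1 - p)))
        (cabMod k hN φ (sh k M 0 j p) (atPos k j y)), ?_,
        cabMod k hN φ (sh k M 0 j (p + 1)) (atPos k j y), ?_, ?_, ?_, ?_⟩
      · rw [cabMod_sh_atPos k hN φ j j _ le_rfl, cabMod_atPos k hN φ hc]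
        exact atPos_mem k _ _ (Nat.lt_succ_self p)
      · rw [cabMod_sh_atPos k hN φ j j _ le_rfl]
        by_cases hp' : j.1 < p + 1
        · rw [sh_of_lt _ _ _ _ _ hp']; simp
        · exact atPos_mem k _ _ ⟨by omega, by omega⟩
      · rw [add_zero, sh_succ_succ, map_add, map_mul, LinearMap.add_apply, Module.End.mul_apply,
          add_comm, Nat.zero_add]
      · rw [cabMod_sh_atPos k hN φ j j _ le_rfl,
          insertBlock_up k hN φ β (s := {j.1}) (c := blk N p (j.1 - p) (n + 1))
          (fun a ha => ⟨p, by rw [Set.mem_singleton_iff.1 ha]; exact hc⟩) (atPos_mem k j _ rfl),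
          insertBlock_atPos, shRec, leftTerms, if_pos (by omega),
          show p + 1 + n - (n + 1) = p by omega, map_mul,
          ← mul_assoc (place k hN φ j β), ← place_comm]
        simp only [mul_assoc]
        congr 1
        exact MonoidAlgebra.mapDomain_single.symm
      · rw [cabMod_sh_atPos k hN φ j j _ le_rfl, insertBlock_atPos, shRec, rightTerms, ← mul_assoc,
          ← place_comm, mul_assoc]
  | succ r ih =>
    cases p with
    | zero =>
      obtain ⟨l, hl, ρ, hρ, h1, h2, h3⟩ := ih 0 (by omega)
      refine ⟨l, hl, ρ, by
        refine suppPos_mono k ?_ hρ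
        rintro a ⟨h1, h2⟩
        exact ⟨h1, by omega⟩, h1, ?_, h3⟩
      -- For `p = 0` nothing goes left, and correspondingly the left terms only begin at index `n +
      -- 1`.
      have e0 : ∀ r, shRec k φ (j.1 + (n + 1))
          (leftTerms k (n := n) φ j (place k hN φ j β * y)) r (0 + n) = 0 := fun r =>
        shRec_eq_zero k φ _ _ (n + 1) (fun p hp => if_neg (by omega)) r _ (by omega)
      rw [h2, e0, e0]
    | succ p =>
      obtain ⟨l0, hl0, ρ0, hρ0, h10, h20, h30⟩ := ih p (by omega)
      obtain ⟨l, hl, ρ, hρ, h1, h2, h3⟩ := ih (p + 1) (by omega)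
      generalize hm : j.1 + 1 + r = m at *
      -- If the cable is already on the left, the new strand does not reach it. Its crossings are
      -- only moved by the `n` additional strands.
      have hcl : ∀ a ∈ {a | a < p}, IsCable hN φ (up M p (m - p)) a a
          (up N (p + n) (m - p)) := by
        intro a ha
        refine (isCable_up_right p (m - p) a (by omega) ha).congr rfl ?_
        congr 1
      -- If the cable is on the right, the new strand passes it, crossing `n` more strands and
      -- moving the cable one position to the right.
      have hcr : ∀ a ∈ {a | p ≤ a ∧ a < m}, IsCable hN φ (up M p (m - p)) a (a + 1)
          (up N p (m + n - p)) := by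
        rintro a ⟨ha, ha'⟩
        refine (isCable_up_mid p (m - p) a (by omega) ha (by omega)).congr rfl ?_
        congr 1
        omega
      refine ⟨l + cabMod k hN φ (MonoidAlgebra.of k _ (up M p (m - p))) l0, ?_,
        ρ + cabMod k hN φ (MonoidAlgebra.of k _ (up M p (m - p))) ρ0, ?_, ?_, ?_, ?_⟩
      · refine Submodule.add_mem _ hl (cabMod_mem k hN φ (fun x hx => ?_) hl0)
        have := (hcl x.1 hx x rfl).1
        have hx' : x.1.1 < p := hx
        rw [Set.mem_ofPred_eq]
        omega
      · refine Submodule.add_mem _ (by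
        refine suppPos_mono k ?_ hρ
        rintro a ⟨h1, h2⟩
        exact ⟨h1, by omega⟩) (cabMod_mem k hN φ (fun x hx => ?_) hρ0)
        have := (hcr x.1 hx x rfl).1
        obtain ⟨hx1, hx2⟩ := hx
        exact ⟨by omega, by omega⟩
      · rw [← add_assoc (j.1 + 1) r 1, hm, sh_succ_succ, map_add, map_mul, LinearMap.add_apply,
          Module.End.mul_apply, h1, h10, map_add, Nat.zero_add]
        abel
      · rw [map_add, h2, insertBlock_up k hN φ β (fun a ha => ⟨a, hcl a ha⟩) hl0, h20,
          show p + 1 + n = p + n + 1 by omega, shRec, show j.1 + (n + 1) + r - (p + n) = m - p by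
            omega]
      · rw [map_add, h3, insertBlock_up k hN φ β (fun a ha => ⟨a + 1, hcr a ha⟩) hρ0, h30,
          shRec, show j.1 + (n + 1) + r - p = m + n - p by omega]

end ShuffleSplit

/-! ### Shuffles of a composition whose inner element is primitive -/

section ShuffleInsert

variable (k : Type*) [Field k] {M N n : ℕ} {G : Type*} [Group G]

theorem place_sh (hN : N + 1 = M + n) (φ : B N →* G) (j : Fin M) (m p : ℕ) (hm : m ≤ n) :
    place k hN φ j (sh k n 0 m p) = MonoidAlgebra.mapDomainAlgHom k k φ (sh k N j m p) := by
  induction m generalizing p with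
  | zero => cases p with
    | zero => rw [sh_zero, sh_zero, map_one, map_one]
    | succ p => rw [sh_of_lt _ _ _ _ _ (by omega), sh_of_lt _ _ _ _ _ (by omega), map_zero, map_zero]
  | succ m ih => cases p with
    | zero => rw [sh_zero, sh_zero, map_one, map_one]
    | succ p =>
      rw [sh_succ_succ, sh_succ_succ, map_add, map_add, map_mul, map_mul, ih _ (by omega),
        ih _ (by omega), place_of, shift_up _ _ _ _ _ _ (by omega), Nat.zero_add]
      congr 2
      exact MonoidAlgebra.mapDomain_single.symm

variable (hN : N + 1 = M + (n + 1)) (φ : B N →* G)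

/-- The projection to the vectors which are supported on the positions in `s`. -/
noncomputable def prPos (M : ℕ) (G : Type*) (s : Set ℕ) :
    ((Fin M × G) →₀ k) →ₗ[k] ((Fin M × G) →₀ k) :=
  open Classical in
  Finsupp.linearCombination k fun x => if x.1.1 ∈ s then Finsupp.single x 1 else 0

theorem prPos_of_mem {G : Type*} {s : Set ℕ} {y : (Fin M × G) →₀ k} (hy : y ∈ suppPos k M G s) :
    prPos k M G s y = y :=
  suppPos_induction k (P := fun y => prPos k M G s y = y) (map_zero _)
    (fun a b ha hb => by rw [map_add, ha, hb]) (fun x c hx => by simp [prPos, hx]) hy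

theorem prPos_of_mem_compl {G : Type*} {s t : Set ℕ} (hst : ∀ a ∈ t, a ∉ s)
    {y : (Fin M × G) →₀ k} (hy : y ∈ suppPos k M G t) : prPos k M G s y = 0 :=
  suppPos_induction k (P := fun y => prPos k M G s y = 0) (map_zero _)
    (fun a b ha hb => by rw [map_add, ha, hb, add_zero])
    (fun x c hx => by simp [prPos, hst _ hx]) hy

/-- In the Vandermonde decomposition at the cable, a term that splits the cable contains an inner
shuffle with `0 < s < n + 1`, which kills `β`. There remain `s = n + 1` and `s = 0`, where the cable
goes left or right as a whole. -/
theorem sh_mul_place {β : MonoidAlgebra k (B (n + 1))} {j : Fin M}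
    (hβ : ∀ s, 0 < s → s < n + 1 → place k hN φ j (sh k (n + 1) 0 (n + 1) s * β) = 0)
    (y : MonoidAlgebra k G) (p : ℕ) :
    MonoidAlgebra.mapDomainAlgHom k k φ (sh k N 0 (j + (n + 1)) p) * (place k hN φ j β * y) =
      leftTerms k (n := n) φ j (place k hN φ j β * y) p +
        rightTerms k φ j (place k hN φ j β * y) p := by
  have hz : ∀ s, 0 < s → s ≠ n + 1 → MonoidAlgebra.mapDomainAlgHom k k φ (sh k N j (n + 1) s) *
      (place k hN φ j β * y) = 0 := by
    intro s h0 h1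
    by_cases hs : s < n + 1
    · rw [← place_sh k hN φ j (n + 1) s le_rfl, ← mul_assoc, ← map_mul, hβ s h0 hs, zero_mul]
    · rw [sh_of_lt _ _ _ _ _ (by omega), map_zero, zero_mul]
  have e1 : ∀ x : ℕ × ℕ, MonoidAlgebra.mapDomainAlgHom k k φ
      (MonoidAlgebra.of k (B N) (blk N x.1 (j - x.1) x.2) *
      (sh k N 0 j x.1 * sh k N j (n + 1) x.2)) * (place k hN φ j β * y) =
      MonoidAlgebra.mapDomainAlgHom k k φ (MonoidAlgebra.of k (B N) (blk N x.1 (j - x.1) x.2) *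
      sh k N 0 j x.1) * (MonoidAlgebra.mapDomainAlgHom k k φ (sh k N j (n + 1) x.2) *
        (place k hN φ j β * y)) := fun x => by
    rw [← mul_assoc (MonoidAlgebra.of k (B N) _), map_mul _ _ (sh k N j (n + 1) x.2), mul_assoc]
  rw [sh_add, map_sum, Finset.sum_mul, Finset.sum_congr rfl fun x _ => e1 x]
  have e2 : ∀ p, MonoidAlgebra.mapDomainAlgHom k k φ
      (MonoidAlgebra.of k (B N) (blk N p (j - p) 0) * sh k N 0 j p) *
      (MonoidAlgebra.mapDomainAlgHom k k φ (sh k N j (n + 1) 0) *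
        (place k hN φ j β * y)) = rightTerms k φ j (place k hN φ j β * y) p := fun p => by
    rw [blk, map_one, one_mul, sh_zero, map_one, one_mul, rightTerms]
  by_cases hp : n + 1 ≤ p
  · rw [Finset.sum_eq_add_of_mem (p - (n + 1), n + 1) (p, 0) (by simp; omega) (by simp)
      (by simp)]
    · rw [e2, leftTerms, if_pos hp, sh_self, map_one, one_mul]
    · rintro ⟨q, s⟩ hx ⟨h1, h2⟩
      rw [Finset.HasAntidiagonal.mem_antidiagonal] at hx
      dsimp only at hx
      simp only [ne_eq, Prod.mk.injEq, not_and] at h1 h2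
      rw [hz s (by by_contra h; exact h2 (by omega) (by omega)) (fun h => h1 (by omega) h), mul_zero]
  · rw [Finset.sum_eq_single (p, 0), e2, leftTerms, if_neg hp, zero_add]
    · rintro ⟨q, s⟩ hx h1
      rw [Finset.HasAntidiagonal.mem_antidiagonal] at hx
      dsimp only at hx
      simp only [ne_eq, Prod.mk.injEq, not_and] at h1
      rw [hz s (by by_contra h; exact h1 (by omega) (by omega)) (by omega), mul_zero]
    · simp

/-- By linearity `y` sits in a single position `j`. Both sides then obey the recursion over the
strands to the right of `j`, with initial values compared by `sh_mul_place`. For `p ≤ n` the first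
summand is a projection to no positions at all. -/
theorem sh_mul_insertBlock {β : MonoidAlgebra k (B (n + 1))}
    (hβ : ∀ j s, 0 < s → s < n + 1 → place k hN φ j (sh k (n + 1) 0 (n + 1) s * β) = 0)
    (p : ℕ) (y : (Fin M × G) →₀ k) :
    MonoidAlgebra.mapDomainAlgHom k k φ (sh k N 0 N p) * insertBlock k hN φ β y =
      insertBlock k hN φ β (prPos k M G {a | a < p - n} (cabMod k hN φ (sh k M 0 M (p - n)) y)) +
        insertBlock k hN φ β (prPos k M G {a | p ≤ a} (cabMod k hN φ (sh k M 0 M p) y)) := by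
  induction y using Finsupp.induction_linear with
  | zero => simp
  | add a b ha hb => simp only [map_add, mul_add, ha, hb]; abel
  | single x s =>
    obtain ⟨j, g⟩ := x
    obtain ⟨r, hr⟩ := Nat.exists_eq_add_of_lt j.2
    have hM : j.1 + 1 + r = M := by omega
    rw [← atPos_of]
    generalize s • MonoidAlgebra.of k G g = y
    obtain ⟨l, hl, ρ, hρ, h1, h2, -⟩ := cabMod_sh_split k hN φ β j y r (p - n) (by omega)
    obtain ⟨l', hl', ρ', hρ', h1', -, h3'⟩ := cabMod_sh_split k hN φ β j y r p (by omega)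
    rw [hM] at h1 h1'
    rw [h1, h1', map_add (prPos k M G {a | a < p - n}), map_add (prPos k M G {a | p ≤ a}),
      prPos_of_mem k hl, prPos_of_mem_compl k (t := {a | a < p}) ?_ hl',
      prPos_of_mem_compl k (s := {a | a < p - n}) ?_ hρ,
      prPos_of_mem k (s := {a | p ≤ a}) (suppPos_mono k ?_ hρ'), add_zero, zero_add, h2, h3',
      insertBlock_atPos]
    -- For `p < n` the truncated index `p - n + n` is not `p`, but both lie below `n + 1`, where the
    -- left terms vanish.
    · have e : shRec k φ (j.1 + (n + 1)) (leftTerms k (n := n) φ j (place k hN φ j β * y)) r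
          (p - n + n) = shRec k φ (j.1 + (n + 1))
          (leftTerms k (n := n) φ j (place k hN φ j β * y)) r p := by
        by_cases hp : n ≤ p
        · rw [Nat.sub_add_cancel hp]
        · have hz : ∀ p < n + 1, leftTerms k (n := n) φ j (place k hN φ j β * y) p = 0 :=
            fun p hp => if_neg (by omega)
          rw [shRec_eq_zero _ _ _ _ _ hz _ _ (by omega), shRec_eq_zero _ _ _ _ _ hz _ _ (by omega)]
      rw [e, ← shRec_add, ← funext fun p => sh_mul_place k hN φ (hβ j) y p, shRec_sh,
        show j.1 + (n + 1) + r = N by omega]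
    · rintro a ⟨ha, -⟩
      exact ha
    · rintro a ⟨ha, -⟩
      rw [Set.mem_ofPred_eq]
      omega
    · intro a ha
      rw [Set.mem_ofPred_eq] at ha ⊢
      omega

end ShuffleInsert

/-! ### Operadic composition by lifts -/

section Composition

variable {k : Type*} [Field k]

/-- The canonical lift to `k[B n]` of an element of `k[Q]`. -/
noncomputable def outLift {n : ℕ} {Q : FinQuot n} (a : GroupRing k Q) : MonoidAlgebra k (B n) :=
  a.coeff.sum fun x s => MonoidAlgebra.single x.out s

theorem toLevel_single {n : ℕ} (Q : FinQuot n) (g : B n) (s : k) :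
    toLevel k Q (MonoidAlgebra.single g s) = MonoidAlgebra.single (QuotientGroup.mk g) s :=
  MonoidAlgebra.mapDomain_single

theorem toLevel_outLift {n : ℕ} {Q : FinQuot n} (a : GroupRing k Q) :
    toLevel k Q (outLift a) = a := by
  rw [outLift, map_finsuppSum]
  simp only [toLevel_single, QuotientGroup.out_eq']
  exact MonoidAlgebra.sum_coeff_single a

/-- An algebra morphism on `k[B n]` which comes from a group morphism that is trivial on the kernel
of `Q` factors through the level `Q`. -/
theorem lift_eq_zero {n : ℕ} {A : Type*} [Semiring A] [Algebra k A] (Q : FinQuot n) (f : B n →* A)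
    (hf : ∀ g ∈ Q.toSubgroup, f g = 1) {x : MonoidAlgebra k (B n)} (hx : toLevel k Q x = 0) :
    MonoidAlgebra.lift k A (B n) f x = 0 := by
  let f' : B n ⧸ Q.toSubgroup →* A := QuotientGroup.lift Q.toSubgroup f hf
  have : (MonoidAlgebra.lift k A (B n ⧸ Q.toSubgroup) f').comp (toLevel k Q) =
      MonoidAlgebra.lift k A (B n) f := by
    refine MonoidAlgebra.algHom_ext (fun g => ?_) (Subsingleton.elim _ _)
    rw [AlgHom.comp_apply, toLevel_single, MonoidAlgebra.lift_single, MonoidAlgebra.lift_single]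
    rfl
  rw [← this, AlgHom.comp_apply, hx, map_zero]

theorem algHom_eq_zero {n : ℕ} {A : Type*} [Semiring A] [Algebra k A] (Q : FinQuot n)
    (F : MonoidAlgebra k (B n) →ₐ[k] A) (hf : ∀ g ∈ Q.toSubgroup, F (MonoidAlgebra.of k _ g) = 1)
    {x : MonoidAlgebra k (B n)} (hx : toLevel k Q x = 0) : F x = 0 := by
  rw [← lift_eq_zero Q ((F : MonoidAlgebra k (B n) →* A).comp (MonoidAlgebra.of k (B n))) hf hx]
  refine DFunLike.congr_fun (?_ : F = _) x
  refine MonoidAlgebra.algHom_ext (fun g => ?_) (Subsingleton.elim _ _)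
  rw [MonoidAlgebra.lift_single, one_smul]
  rfl

variable (i n r : ℕ) (R : FinQuot (i + n + r))

theorem cable_eq_one_of_mem {g : B (i + 1 + r)} (hg : g ∈ (outerQuot i n r R).toSubgroup) :
    cable (show (i + n + r) + 1 = (i + 1 + r) + n by omega)
      (QuotientGroup.mk' R.toSubgroup) g = 1 := by
  exact hg

theorem shift_mem_of_mem {g : B n} (hg : g ∈ (innerQuot i n r R).toSubgroup) (j : Fin (i + 1 + r)) :
    shift n (i + n + r) j (by omega) g ∈ R.toSubgroup := by
  have : g ∈ (⨅ j : Fin (i + 1 + r), (FiniteIndexNormalSubgroup.comap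
      (shift n (i + n + r) j (by omega)) R).toSubgroup) := hg
  rw [Subgroup.mem_iInf] at this
  exact this j

theorem cable_map {M N n : ℕ} {G : Type*} [Group G] (hN : N + 1 = M + n) (φ : B N →* G) (γ : B M)
    (x : Fin M × B N) : cable hN φ γ (x.1, φ x.2) =
      ((cable hN (MonoidHom.id _) γ x).1, φ (cable hN (MonoidHom.id _) γ x).2) := by
  refine (braid_equivariant (cable hN (MonoidHom.id _)) (fun γ y => cable hN φ γ y)
    (fun y => by rw [map_one]; rfl) (fun g h y => by rw [map_mul]; rfl)
    (fun x => (x.1, φ x.2)) (fun l hl x => ?_) γ x).symm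
  rw [cable_σ hN _ l hl, cable_σ hN φ l hl, MonoidHom.id_apply, map_mul]

/-- The position `i`, with trivial braid. -/
noncomputable def startVec (k : Type*) [Field k] (i n r : ℕ) (R : FinQuot (i + n + r)) :
    (Fin (i + 1 + r) × (B (i + n + r) ⧸ R.toSubgroup)) →₀ k :=
  Finsupp.single (⟨i, by omega⟩, 1) 1

/-- The operadic composition in `k[R]`, on elements of the group rings of the braid groups. -/
noncomputable def levelComp (α : MonoidAlgebra k (B (i + 1 + r))) (β : MonoidAlgebra k (B n)) :
    GroupRing k R :=
  insertBlock k (show (i + n + r) + 1 = (i + 1 + r) + n by omega)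
    (QuotientGroup.mk' R.toSubgroup) β (cabMod k (show (i + n + r) + 1 = (i + 1 + r) + n by omega)
    (QuotientGroup.mk' R.toSubgroup) α (startVec k i n r R))

theorem levelComp_single (γ : B (i + 1 + r)) (ρ : B n) (s t : k) :
    levelComp i n r R (MonoidAlgebra.single γ s) (MonoidAlgebra.single ρ t) =
      (s * t) • braidClass k R (cabling i r γ ρ) := by
  have e1 : MonoidAlgebra.single γ s = s • MonoidAlgebra.of k (B (i + 1 + r)) γ := by simp
  have e2 : MonoidAlgebra.single ρ t = t • MonoidAlgebra.of k (B n) ρ := by simp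
  have h := cable_map (show (i + n + r) + 1 = (i + 1 + r) + n by omega)
    (QuotientGroup.mk' R.toSubgroup) γ (⟨i, by omega⟩, 1)
  rw [map_one] at h
  rw [levelComp, startVec, e1, e2, map_smul, LinearMap.smul_apply, map_smul, cabMod_of,
    insertBlock_single, one_smul, map_smul, smul_mul_assoc, smul_smul, place_of, ← map_mul, h,
    ← map_mul]
  congr 1
  exact MonoidAlgebra.mapDomain_single.symm

theorem insertBlock_add {M N n : ℕ} {G : Type*} [Group G] (hN : N + 1 = M + n) (φ : B N →* G)
    (β β' : MonoidAlgebra k (B n)) (y : (Fin M × G) →₀ k) :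
    insertBlock k hN φ (β + β') y = insertBlock k hN φ β y + insertBlock k hN φ β' y := by
  induction y using Finsupp.induction_linear with
  | zero => simp
  | add a b ha hb => simp only [map_add, ha, hb]; abel
  | single x s => simp only [insertBlock_single, map_add, add_mul, smul_add]

/-- The composition on `k[R]` as a bilinear map. -/
noncomputable def levelCompHom : MonoidAlgebra k (B (i + 1 + r)) →+ MonoidAlgebra k (B n) →+
    GroupRing k R :=
  AddMonoidHom.mk' (fun α => AddMonoidHom.mk' (levelComp i n r R α)
    fun β β' => insertBlock_add (k := k) (show (i + n + r) + 1 = (i + 1 + r) + n by omega)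
      (QuotientGroup.mk' R.toSubgroup) β β' _)
    fun α α' => by
      refine AddMonoidHom.ext fun β => ?_
      change levelComp i n r R (α + α') β = levelComp i n r R α β + levelComp i n r R α' β
      rw [levelComp, map_add, LinearMap.add_apply, map_add]
      rfl

theorem operadComp_eq_levelComp_out (a : Family k (i + 1 + r)) (b : Family k n) :
    operadComp i n r a b R =
      levelComp i n r R (outLift (a (outerQuot i n r R))) (outLift (b (innerQuot i n r R))) := by
  change _ = levelCompHom i n r R _ _
  have h : levelCompHom i n r R (outLift (a (outerQuot i n r R))) =
      (a (outerQuot i n r R)).coeff.sum fun x s =>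
        levelCompHom i n r R (MonoidAlgebra.single x.out s) := map_finsuppSum _ _ _
  rw [h, operadComp, Finsupp.sum, Finsupp.sum, AddMonoidHom.finsetSum_apply]
  refine Finset.sum_congr rfl fun x _ => ?_
  rw [outLift, map_finsuppSum]
  exact Finset.sum_congr rfl fun y _ => (levelComp_single i n r R _ _ _ _).symm

theorem cabMod_eq_zero {α : MonoidAlgebra k (B (i + 1 + r))}
    (hα : toLevel k (outerQuot i n r R) α = 0) :
    cabMod k (show (i + n + r) + 1 = (i + 1 + r) + n by omega)
      (QuotientGroup.mk' R.toSubgroup) α = 0 := by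
  refine algHom_eq_zero (outerQuot i n r R) _ (fun g hg => ?_) hα
  refine Finsupp.lhom_ext fun x s => ?_
  rw [cabMod_of, cable_eq_one_of_mem i n r R hg]
  rfl

theorem place_eq_zero {β : MonoidAlgebra k (B n)} (hβ : toLevel k (innerQuot i n r R) β = 0)
    (j : Fin (i + 1 + r)) : place k (show (i + n + r) + 1 = (i + 1 + r) + n by omega)
      (QuotientGroup.mk' R.toSubgroup) j β = 0 := by
  refine algHom_eq_zero (innerQuot i n r R) _ (fun g hg => ?_) hβ
  rw [place_of, QuotientGroup.mk'_apply, (QuotientGroup.eq_one_iff _).2 (shift_mem_of_mem i n r R hg j),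
    map_one]

theorem insertBlock_eq_zero {M N n : ℕ} {G : Type*} [Group G] (hN : N + 1 = M + n) (φ : B N →* G)
    {β : MonoidAlgebra k (B n)} (hβ : ∀ j, place k hN φ j β = 0) (y : (Fin M × G) →₀ k) :
    insertBlock k hN φ β y = 0 := by
  induction y using Finsupp.induction_linear with
  | zero => simp
  | add a b ha hb => rw [map_add, ha, hb, add_zero]
  | single x s => rw [insertBlock_single, hβ, zero_mul, smul_zero]

/-- The operadic composition in `k[R]` can be computed from arbitrary lifts. -/
theorem operadComp_eq_levelComp {a : Family k (i + 1 + r)} {b : Family k n}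
    {α : MonoidAlgebra k (B (i + 1 + r))} {β : MonoidAlgebra k (B n)}
    (hα : toLevel k (outerQuot i n r R) α = a (outerQuot i n r R))
    (hβ : toLevel k (innerQuot i n r R) β = b (innerQuot i n r R)) :
    operadComp i n r a b R = levelComp i n r R α β := by
  rw [operadComp_eq_levelComp_out]
  change levelCompHom i n r R _ _ = levelCompHom i n r R _ _
  have h1 : levelCompHom i n r R (outLift (a (outerQuot i n r R)) - α) = 0 := by
    refine AddMonoidHom.ext fun β => ?_
    have h := cabMod_eq_zero i n r R (α := outLift (a (outerQuot i n r R)) - α)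
      (by rw [map_sub, toLevel_outLift, hα, sub_self])
    change levelComp i n r R _ β = 0
    rw [levelComp, h, LinearMap.zero_apply, map_zero]
  have h2 : levelCompHom i n r R α (outLift (b (innerQuot i n r R)) - β) = 0 := by
    have h := place_eq_zero i n r R (β := outLift (b (innerQuot i n r R)) - β)
      (by rw [map_sub, toLevel_outLift, hβ, sub_self])
    exact insertBlock_eq_zero (show (i + n + r) + 1 = (i + 1 + r) + n by omega)
      (QuotientGroup.mk' R.toSubgroup) h _
  rw [map_sub, sub_eq_zero] at h1 h2
  rw [h1, h2]

/-- The levels `P` and `Q` have the common refinement `P ⊓ Q`, so one element of `k[B n]` represents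
the family at both. -/
theorem exists_lift {n : ℕ} {O : BraidedSubseq k} {a : Family k n} (ha : a ∈ O.elements n)
    (P Q : FinQuot n) : ∃ α : MonoidAlgebra k (B n), toLevel k P α = a P ∧ toLevel k Q α = a Q := by
  refine ⟨outLift (a (P ⊓ Q)), ?_, ?_⟩
  · rw [← levelMap_toLevel k (inf_le_left : P ⊓ Q ≤ P), toLevel_outLift]
    exact ha.2 _ _ _
  · rw [← levelMap_toLevel k (inf_le_right : P ⊓ Q ≤ Q), toLevel_outLift]
    exact ha.2 _ _ _

theorem levelMap_levelComp {R R' : FinQuot (i + n + r)} (h : R ≤ R')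
    (α : MonoidAlgebra k (B (i + 1 + r))) (β : MonoidAlgebra k (B n)) :
    levelMap k h (levelComp i n r R α β) = levelComp i n r R' α β := by
  change (levelMap k h).toRingHom.toAddMonoidHom (levelCompHom i n r R α β) =
    levelCompHom i n r R' α β
  induction α using MonoidAlgebra.induction_linear with
  | zero => simp
  | add a b ha hb => simp only [map_add, AddMonoidHom.add_apply, ha, hb]
  | single γ s =>
    induction β using MonoidAlgebra.induction_linear with
    | zero => simp
    | add a b ha hb => simp only [map_add, ha, hb]
    | single ρ t =>
      change levelMap k h (levelComp i n r R _ _) = levelComp i n r R' _ _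
      rw [levelComp_single, levelComp_single, map_smul, braidClass, levelMap_toLevel]
      rfl

/-- A description uniform in the arity: in arity `1` the range of `p` is empty, while arity `0`
needs its own clause because without it the level would be everything. -/
theorem mem_brPrimLevel {n : ℕ} (Q : FinQuot n) (a : GroupRing k Q) :
    a ∈ brPrimLevel k Q ↔ (n = 0 → a = 0) ∧
      ∀ p, 0 < p → p < n → toLevel k Q (sh k n 0 n p) * a = 0 := by
  obtain _ | _ | n := n
  · simp [brPrimLevel]
  · simp only [brPrimLevel, Submodule.mem_top, true_iff]
    exact ⟨fun h => absurd h one_ne_zero, fun p h1 h2 => by omega⟩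
  · simp only [brPrimLevel, Submodule.mem_iInf, LinearMap.mem_ker, LinearMap.mulLeft_apply,
      Finset.mem_Ioo]
    refine ⟨fun h => ⟨fun h => by omega, fun p h1 h2 => ?_⟩, fun h p hp => ?_⟩
    · rw [← shuffleElt_eq k _ p h2.le]
      exact h p ⟨h1, h2⟩
    · rw [shuffleElt_eq k _ p hp.2.le]
      exact h.2 p hp.1 hp.2

/-- `sh_mul_insertBlock` is applied to the orbit vector of `α`. On the left, `S_{p-n} α` vanishes
unless `p ≤ n`, when there are no positions below `p - n`; on the right, `S_p α` vanishes unless `p`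
is at least the arity of `α`, when there are no positions from `p` on. -/
theorem operadComp_mem_brPrimLevel {a : Family k (i + 1 + r)} {b : Family k n}
    (ha : a ∈ (brPrim k).elements (i + 1 + r)) (hb : b ∈ (brPrim k).elements n) :
    operadComp i n r a b R ∈ brPrimLevel k R := by
  obtain _ | n := n
  -- The cabling argument needs at least one strand in the cable. In arity `0` the inserted
  -- operation is itself zero.
  · have : outLift (b (innerQuot i 0 r R)) = 0 := by
      rw [((mem_brPrimLevel _ _).1 (hb.1 (innerQuot i 0 r R))).1 rfl]
      exact Finsupp.sum_zero_index
    rw [operadComp_eq_levelComp_out, this]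
    have h0 : levelComp i 0 r R (outLift (a (outerQuot i 0 r R))) 0 = 0 :=
      (levelCompHom i 0 r R (outLift (a (outerQuot i 0 r R)))).map_zero
    rw [h0]
    exact Submodule.zero_mem _
  rw [mem_brPrimLevel]
  refine ⟨fun h => by omega, fun p h1 h2 => ?_⟩
  have hα := toLevel_outLift (a (outerQuot i (n + 1) r R))
  have hβ := toLevel_outLift (b (innerQuot i (n + 1) r R))
  rw [operadComp_eq_levelComp_out]
  generalize outLift (a (outerQuot i (n + 1) r R)) = α at *
  generalize outLift (b (innerQuot i (n + 1) r R)) = β at *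
  have key := sh_mul_insertBlock k (show (i + (n + 1) + r) + 1 = (i + 1 + r) + (n + 1) by omega)
    (QuotientGroup.mk' R.toSubgroup) (β := β) (fun j s h3 h4 => by
      refine place_eq_zero i (n + 1) r R ?_ j
      rw [map_mul, hβ]
      exact ((mem_brPrimLevel _ _).1 (hb.1 (innerQuot i (n + 1) r R))).2 s h3 h4) p
      (cabMod k (show (i + (n + 1) + r) + 1 = (i + 1 + r) + (n + 1) by omega)
        (QuotientGroup.mk' R.toSubgroup) α (startVec k i (n + 1) r R))
  refine key.trans ?_
  have hz : ∀ q, 0 < q → q < i + 1 + r → cabMod k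
      (show (i + (n + 1) + r) + 1 = (i + 1 + r) + (n + 1) by omega)
      (QuotientGroup.mk' R.toSubgroup) (sh k (i + 1 + r) 0 (i + 1 + r) q) (cabMod k
      (show (i + (n + 1) + r) + 1 = (i + 1 + r) + (n + 1) by omega)
        (QuotientGroup.mk' R.toSubgroup) α (startVec k i (n + 1) r R)) = 0 := by
    intro q h3 h4
    rw [← Module.End.mul_apply, ← map_mul, cabMod_eq_zero, LinearMap.zero_apply]
    rw [map_mul, hα]
    exact ((mem_brPrimLevel _ _).1 (ha.1 (outerQuot i (n + 1) r R))).2 q h3 h4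
  have mem_univ : ∀ y, y ∈ suppPos k (i + 1 + r) (B (i + (n + 1) + r) ⧸ R.toSubgroup)
      {a | a < i + 1 + r} := fun y x _ => x.1.2
  have hl : prPos k (i + 1 + r) (B (i + (n + 1) + r) ⧸ R.toSubgroup) {a | a < p - n}
      (cabMod k (show (i + (n + 1) + r) + 1 = (i + 1 + r) + (n + 1) by omega)
      (QuotientGroup.mk' R.toSubgroup) (sh k (i + 1 + r) 0 (i + 1 + r) (p - n)) (cabMod k
      (show (i + (n + 1) + r) + 1 = (i + 1 + r) + (n + 1) by omega)
        (QuotientGroup.mk' R.toSubgroup) α (startVec k i (n + 1) r R))) = 0 := by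
    by_cases hp : p ≤ n
    · rw [show p - n = 0 by omega]
      exact prPos_of_mem_compl k (fun a _ h => Nat.not_lt_zero a h) (mem_univ _)
    · rw [hz _ (by omega) (by omega), map_zero]
  have hr : prPos k (i + 1 + r) (B (i + (n + 1) + r) ⧸ R.toSubgroup) {a | p ≤ a}
      (cabMod k (show (i + (n + 1) + r) + 1 = (i + 1 + r) + (n + 1) by omega)
      (QuotientGroup.mk' R.toSubgroup) (sh k (i + 1 + r) 0 (i + 1 + r) p) (cabMod k
      (show (i + (n + 1) + r) + 1 = (i + 1 + r) + (n + 1) by omega)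
        (QuotientGroup.mk' R.toSubgroup) α (startVec k i (n + 1) r R))) = 0 := by
    by_cases hp : p < i + 1 + r
    · rw [hz _ h1 hp, map_zero]
    · refine prPos_of_mem_compl k (fun a ha h => ?_) (mem_univ _)
      rw [Set.mem_ofPred_eq] at ha h
      omega
  rw [hl, hr, map_zero, add_zero]

theorem isSuboperad_brPrim : IsSuboperad (brPrim k) where
  one_mem := ⟨fun _ => trivial, fun P Q h => map_one _⟩
  comp_mem i n r a b ha hb := by
    refine ⟨fun R => operadComp_mem_brPrimLevel i n r R ha hb, fun R R' h => ?_⟩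
    obtain ⟨α, h1, h2⟩ := exists_lift ha (outerQuot i n r R) (outerQuot i n r R')
    obtain ⟨β, h3, h4⟩ := exists_lift hb (innerQuot i n r R) (innerQuot i n r R')
    rw [operadComp_eq_levelComp i n r R h1 h3, operadComp_eq_levelComp i n r R' h2 h4,
      levelMap_levelComp]

end Composition

/-! ### The canonical idempotents -/

section Idempotent

/-- The linear extension of the inversion of a group. -/
noncomputable def adjoint (k : Type*) [Field k] (H : Type*) [Group H] :
    MonoidAlgebra k H → MonoidAlgebra k H := MonoidAlgebra.mapDomain fun h => h⁻¹

section Finite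

variable {H : Type*} [Fintype H]

/-- The standard inner product on a rational group ring. -/
noncomputable def dot : LinearMap.BilinForm ℚ (MonoidAlgebra ℚ H) :=
  LinearMap.mk₂ ℚ (fun a b => ∑ g, a.coeff g * b.coeff g)
    (fun a a' b => by simp [add_mul, Finset.sum_add_distrib])
    (fun c a b => by simp [Finset.mul_sum, mul_assoc])
    (fun a b b' => by simp [mul_add, Finset.sum_add_distrib])
    (fun c a b => by simp [Finset.mul_sum, mul_left_comm])

theorem dot_self_eq_zero {a : MonoidAlgebra ℚ H} (h : dot a a = 0) : a = 0 := by
  have h' : ∑ g, a.coeff g * a.coeff g = 0 := h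
  rw [Finset.sum_eq_zero_iff_of_nonneg fun g _ => mul_self_nonneg _] at h'
  ext g
  exact mul_self_eq_zero.1 (h' g (Finset.mem_univ g))

theorem dot_comm (a b : MonoidAlgebra ℚ H) : dot a b = dot b a :=
  Finset.sum_congr rfl fun _ _ => mul_comm _ _

theorem dot_single (g : H) (a : MonoidAlgebra ℚ H) (s : ℚ) :
    dot (MonoidAlgebra.single g s) a = s * a.coeff g := by
  classical
  change ∑ _, _ = _
  rw [Finset.sum_eq_single g]
  · simp
  · intro b _ hb
    simp [hb.symm]
  · simp

variable [Group H]

/-- The group acts on its group ring by isometries, so the adjoint of right multiplication by `t` is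
right multiplication by the image of `t` under inversion. -/
theorem dot_mul (e x t : MonoidAlgebra ℚ H) : dot e (x * t) = dot (e * adjoint ℚ H t) x := by
  induction e using MonoidAlgebra.induction_linear with
  | zero => simp
  | add a b ha hb => simp only [map_add, LinearMap.add_apply, add_mul, ha, hb]
  | single a r =>
    induction t using MonoidAlgebra.induction_linear with
    | zero => simp [adjoint]
    | add b c hb hc =>
      have : adjoint ℚ H (b + c) = adjoint ℚ H b + adjoint ℚ H c := MonoidAlgebra.mapDomain_add _ _ _
      simp only [this, mul_add, map_add, LinearMap.add_apply, hb, hc]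
    | single b s =>
      have : adjoint ℚ H (MonoidAlgebra.single b s) = MonoidAlgebra.single b⁻¹ s :=
        MonoidAlgebra.mapDomain_single
      rw [this, MonoidAlgebra.single_mul_single, dot_single, dot_single]
      induction x using MonoidAlgebra.induction_linear with
      | zero => simp
      | add c d hc hd => simp only [add_mul, MonoidAlgebra.coeff_add, Finsupp.add_apply, mul_add, hc, hd]
      | single c u =>
        classical
        rw [MonoidAlgebra.single_mul_single, MonoidAlgebra.coeff_single, MonoidAlgebra.coeff_single,
          Finsupp.single_apply, Finsupp.single_apply]
        simp only [← eq_mul_inv_iff_mul_eq]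
        split_ifs <;> ring

variable {ι : Type*} [Fintype ι] (t : ι → MonoidAlgebra ℚ H)

/-- The linear map whose range is the left ideal generated by the elements `t i`. -/
noncomputable def leftIdealMap : (ι → MonoidAlgebra ℚ H) →ₗ[ℚ] MonoidAlgebra ℚ H where
  toFun c := ∑ i, c i * t i
  map_add' a b := by simp [add_mul, Finset.sum_add_distrib]
  map_smul' s a := by simp [Finset.smul_sum]

theorem leftIdealMap_apply (c : ι → MonoidAlgebra ℚ H) : leftIdealMap t c = ∑ i, c i * t i := rfl

theorem dot_leftIdealMap {e : MonoidAlgebra ℚ H} (he : ∀ i, e * adjoint ℚ H (t i) = 0)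
    (c : ι → MonoidAlgebra ℚ H) : dot e (leftIdealMap t c) = 0 := by
  rw [leftIdealMap_apply, map_sum]
  exact Finset.sum_eq_zero fun i _ => by rw [dot_mul, he i, map_zero, LinearMap.zero_apply]

/-- The annihilation conditions make `e - e'` orthogonal to the left ideal that contains it, and the
inner product is definite. -/
theorem eq_of_sub_mem_leftIdeal {e e' : MonoidAlgebra ℚ H} (he : ∀ i, e * adjoint ℚ H (t i) = 0)
    (he' : ∀ i, e' * adjoint ℚ H (t i) = 0) (h : e - e' ∈ LinearMap.range (leftIdealMap t)) :
    e = e' := by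
  obtain ⟨c, hc⟩ := h
  have := dot_leftIdealMap t (e := e - e') (fun i => by rw [sub_mul, he, he', sub_zero]) c
  rw [hc] at this
  exact sub_eq_zero.1 (dot_self_eq_zero this)

/-- Definiteness over `ℚ` makes the left ideal and its orthogonal complement complementary; `e` is
the component of `1` in the latter. Working over `ℚ` first is essential, as a general field of
characteristic `0` has no positivity. -/
theorem exists_idempotent : ∃ e : MonoidAlgebra ℚ H, (∀ i, e * adjoint ℚ H (t i) = 0) ∧
    1 - e ∈ LinearMap.range (leftIdealMap t) := by
  have hc : IsCompl (LinearMap.range (leftIdealMap t))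
      (dot.orthogonal (LinearMap.range (leftIdealMap t))) := by
    refine LinearMap.BilinForm.isCompl_orthogonal_of_restrict_nondegenerate
      (fun a b h => by rw [dot_comm, h]) ?_
    refine ⟨fun a ha => ?_, fun a ha => ?_⟩
    · exact Subtype.ext (dot_self_eq_zero (ha a))
    · exact Subtype.ext (dot_self_eq_zero (ha a))
  obtain ⟨f, hf, e, he, h⟩ := Submodule.mem_sup.1 (hc.sup_eq_top ▸ Submodule.mem_top :
    (1 : MonoidAlgebra ℚ H) ∈ LinearMap.range (leftIdealMap t) ⊔ _)
  refine ⟨e, fun i => ?_, ?_⟩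
  -- The norm of `e tᵢ*` is `⟨e, (e tᵢ*) tᵢ⟩`, which is zero since the second argument lies in the
  -- left ideal.
  · refine dot_self_eq_zero ?_
    rw [← dot_mul, dot_comm]
    classical
    refine he _ ⟨Pi.single i (e * adjoint ℚ H (t i)), ?_⟩
    rw [leftIdealMap_apply, Finset.sum_eq_single i]
    · rw [Pi.single_eq_same]
    · intro j _ hj
      rw [Pi.single_eq_of_ne hj, zero_mul]
    · simp
  · rw [← h, add_sub_cancel_right]
    exact hf

end Finite

theorem toLevel_adjoint (k : Type*) [Field k] {n : ℕ} (Q : FinQuot n) (x : MonoidAlgebra k (B n)) :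
    toLevel k Q (adjoint k _ x) = adjoint k _ (toLevel k Q x) := by
  induction x using MonoidAlgebra.induction_linear with
  | zero => simp [adjoint]
  | add a b ha hb =>
    have (H : Type) [Group H] (a b : MonoidAlgebra k H) :
      adjoint k H (a + b) = adjoint k H a + adjoint k H b := MonoidAlgebra.mapDomain_add _ _ _
    rw [this, map_add, map_add, this, ha, hb]
  | single g s =>
    have (H : Type) [Group H] (g : H) :
      adjoint k H (MonoidAlgebra.single g s) = MonoidAlgebra.single g⁻¹ s :=
        MonoidAlgebra.mapDomain_single
    rw [this, toLevel_single, toLevel_single, this]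
    rfl

/-- The defining properties of the canonical idempotent at the level `Q`. -/
theorem exists_rat_idem {n : ℕ} (Q : FinQuot n) : ∃ e : GroupRing ℚ Q,
    (∀ p ∈ Finset.Ioo 0 n, e * toLevel ℚ Q (adjoint ℚ _ (sh ℚ n 0 n p)) = 0) ∧
    ∃ c : ℕ → GroupRing ℚ Q, 1 - e = ∑ p ∈ Finset.Ioo 0 n, c p * toLevel ℚ Q (sh ℚ n 0 n p) := by
  have : Finite (B n ⧸ Q.toSubgroup) := Subgroup.finite_quotient_of_finiteIndex
  have := Fintype.ofFinite (B n ⧸ Q.toSubgroup)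
  obtain ⟨e, h1, c, hc⟩ := exists_idempotent (fun p : Finset.Ioo 0 n => toLevel ℚ Q (sh ℚ n 0 n p))
  refine ⟨e, fun p hp => ?_, fun p => if h : p ∈ Finset.Ioo 0 n then c ⟨p, h⟩ else 0, ?_⟩
  · rw [toLevel_adjoint]
    exact h1 ⟨p, hp⟩
  · rw [← hc, ← Finset.sum_coe_sort, leftIdealMap_apply]
    refine Finset.sum_congr rfl fun p _ => ?_
    beta_reduce
    rw [dif_pos p.2]

theorem rat_idem_unique {n : ℕ} {Q : FinQuot n} {e e' : GroupRing ℚ Q}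
    (h : ∀ p ∈ Finset.Ioo 0 n, e * toLevel ℚ Q (adjoint ℚ _ (sh ℚ n 0 n p)) = 0)
    (h' : ∀ p ∈ Finset.Ioo 0 n, e' * toLevel ℚ Q (adjoint ℚ _ (sh ℚ n 0 n p)) = 0)
    {c c' : ℕ → GroupRing ℚ Q}
    (hc : 1 - e = ∑ p ∈ Finset.Ioo 0 n, c p * toLevel ℚ Q (sh ℚ n 0 n p))
    (hc' : 1 - e' = ∑ p ∈ Finset.Ioo 0 n, c' p * toLevel ℚ Q (sh ℚ n 0 n p)) : e = e' := by
  have : Finite (B n ⧸ Q.toSubgroup) := Subgroup.finite_quotient_of_finiteIndex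
  have := Fintype.ofFinite (B n ⧸ Q.toSubgroup)
  refine eq_of_sub_mem_leftIdeal (fun p : Finset.Ioo 0 n => toLevel ℚ Q (sh ℚ n 0 n p))
    (fun p => ?_) (fun p => ?_) ⟨fun p => c' p - c p, ?_⟩
  · rw [← toLevel_adjoint]
    exact h p p.2
  · rw [← toLevel_adjoint]
    exact h' p p.2
  · rw [← sub_sub_sub_cancel_left e' e 1, hc, hc', ← Finset.sum_sub_distrib,
      ← Finset.sum_coe_sort, leftIdealMap_apply]
    exact Finset.sum_congr rfl fun p _ => sub_mul _ _ _

/-- The canonical idempotent, over the rational numbers. -/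
noncomputable def ratIdem (n : ℕ) : Family ℚ n := fun Q => (exists_rat_idem Q).choose

/-- The image of the idempotent satisfies the equations that characterize the one at the coarser
level. An arbitrary choice of idempotents would not be compatible, whence the inner product. -/
theorem ratIdem_compat {n : ℕ} {P Q : FinQuot n} (h : P ≤ Q) :
    levelMap ℚ h (ratIdem n P) = ratIdem n Q := by
  obtain ⟨h1, c, hc⟩ := (exists_rat_idem P).choose_spec
  obtain ⟨h2, c', hc'⟩ := (exists_rat_idem Q).choose_spec
  refine rat_idem_unique (fun p hp => ?_) h2 (c := fun p => levelMap ℚ h (c p)) ?_ hc'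
  · rw [← levelMap_toLevel ℚ h, ← map_mul]
    exact (congrArg _ (h1 p hp)).trans (map_zero _)
  · rw [← map_one (levelMap ℚ h), ← map_sub]
    refine (congrArg _ hc).trans ?_
    rw [map_sum]
    exact Finset.sum_congr rfl fun p _ => by rw [map_mul, levelMap_toLevel]

/-- The element `S_p e = S_p - S_p (1 - e)` lies in the left ideal of the shuffle elements. It also
annihilates their adjoints because `e` does, so it equals `0` by uniqueness. -/
theorem ratIdem_sh {n : ℕ} (Q : FinQuot n) {p : ℕ} (hp : p ∈ Finset.Ioo 0 n) :
    toLevel ℚ Q (sh ℚ n 0 n p) * ratIdem n Q = 0 := by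
  have : Finite (B n ⧸ Q.toSubgroup) := Subgroup.finite_quotient_of_finiteIndex
  have := Fintype.ofFinite (B n ⧸ Q.toSubgroup)
  obtain ⟨h1, c, hc⟩ := (exists_rat_idem Q).choose_spec
  change _ = _ at hc
  refine eq_of_sub_mem_leftIdeal (fun p : Finset.Ioo 0 n => toLevel ℚ Q (sh ℚ n 0 n p))
    (fun q => ?_) (fun q => zero_mul _) ?_
  · rw [mul_assoc, ← toLevel_adjoint]
    exact (congrArg _ (h1 q q.2)).trans (mul_zero _)
  · classical
    refine ⟨fun q => (if q.1 = p then 1 else 0) - toLevel ℚ Q (sh ℚ n 0 n p) * c q, ?_⟩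
    rw [show ratIdem n Q = 1 - (1 - ratIdem n Q) by abel]
    refine Eq.trans ?_ (congrArg (fun y => toLevel ℚ Q (sh ℚ n 0 n p) * (1 - y) - 0) hc).symm
    rw [mul_sub, mul_one, sub_zero, Finset.mul_sum, ← Finset.sum_coe_sort]
    rw [leftIdealMap_apply]
    simp only [sub_mul, Finset.sum_sub_distrib, ite_mul, one_mul, zero_mul, mul_assoc]
    congr 1
    rw [Finset.sum_eq_single ⟨p, hp⟩]
    · rw [if_pos rfl]
    · intro q _ hq
      rw [if_neg fun h => hq (Subtype.ext h)]
    · simp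

variable (k : Type*) [Field k] [CharZero k]

/-- The extension of scalars of group rings from the rational numbers. -/
noncomputable def ratMap (H : Type*) [Group H] : MonoidAlgebra ℚ H →+* MonoidAlgebra k H :=
  MonoidAlgebra.mapRingHom H (algebraMap ℚ k)

theorem ratMap_single {H : Type*} [Group H] (h : H) (s : ℚ) :
    ratMap k H (MonoidAlgebra.single h s) = MonoidAlgebra.single h (algebraMap ℚ k s) := by
  simp [ratMap]

theorem ratMap_of {H : Type*} [Group H] (h : H) :
    ratMap k H (MonoidAlgebra.of ℚ H h) = MonoidAlgebra.of k H h := by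
  rw [MonoidAlgebra.of_apply, ratMap_single, map_one, MonoidAlgebra.of_apply]

theorem ratMap_toLevel {n : ℕ} (Q : FinQuot n) (x : MonoidAlgebra ℚ (B n)) :
    ratMap k _ (toLevel ℚ Q x) = toLevel k Q (ratMap k _ x) := by
  induction x using MonoidAlgebra.induction_linear with
  | zero => simp
  | add a b ha hb => simp only [map_add, ha, hb]
  | single g s => rw [toLevel_single, ratMap_single, ratMap_single, toLevel_single]

theorem ratMap_levelMap {n : ℕ} {P Q : FinQuot n} (h : P ≤ Q) (x : GroupRing ℚ P) :
    ratMap k _ (levelMap ℚ h x) = levelMap k h (ratMap k _ x) := by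
  induction x using MonoidAlgebra.induction_linear with
  | zero => simp
  | add a b ha hb => simp only [map_add, ha, hb]
  | single g s =>
    change ratMap k _ (MonoidAlgebra.mapDomain _ _) = MonoidAlgebra.mapDomain _ _
    rw [MonoidAlgebra.mapDomain_single, ratMap_single, ratMap_single,
      MonoidAlgebra.mapDomain_single]

theorem ratMap_sh (N j n p : ℕ) : ratMap k _ (sh ℚ N j n p) = sh k N j n p := by
  induction n generalizing p with
  | zero => cases p with
    | zero => rw [sh_zero, sh_zero, map_one]
    | succ p => rw [sh_of_lt _ _ _ _ _ (by omega), sh_of_lt _ _ _ _ _ (by omega), map_zero]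
  | succ n ih => cases p with
    | zero => rw [sh_zero, sh_zero, map_one]
    | succ p => rw [sh_succ_succ, sh_succ_succ, map_add, map_mul, ih, ih, ratMap_of]

/-- The canonical idempotent, a compatible family of projections to the levels of the braided
primitive operad. -/
noncomputable def idem (n : ℕ) : Family k n := fun Q =>
  -- With no shuffle conditions in arity `0`, the rational idempotent is `1` there, whereas the
  -- operad is zero.
  if n = 0 then 0 else ratMap k _ (ratIdem n Q)

theorem idem_mem (n : ℕ) : idem k n ∈ (brPrim k).elements n := by
  refine ⟨fun Q => ?_, fun P Q h => ?_⟩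
  · refine (mem_brPrimLevel Q _).2 ⟨fun h => if_pos h, fun p h1 h2 => ?_⟩
    rw [idem, if_neg (by omega), ← ratMap_sh, ← ratMap_toLevel, ← map_mul,
      ratIdem_sh Q (Finset.mem_Ioo.2 ⟨h1, h2⟩), map_zero]
  · by_cases h0 : n = 0
    · rw [idem, idem, if_pos h0, if_pos h0, map_zero]
    · rw [idem, idem, if_neg h0, if_neg h0, ← ratMap_levelMap, ratIdem_compat]

theorem idem_zero : idem k 0 = 0 := rfl

theorem one_sub_idem {n : ℕ} (hn : 0 < n) (Q : FinQuot n) : ∃ c : ℕ → GroupRing k Q,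
    1 - idem k n Q = ∑ p ∈ Finset.Ioo 0 n, c p * toLevel k Q (sh k n 0 n p) := by
  obtain ⟨h1, c, hc⟩ := (exists_rat_idem Q).choose_spec
  refine ⟨fun p => ratMap k _ (c p), ?_⟩
  have := congrArg (ratMap k _) hc
  rw [map_sub, map_one, map_sum] at this
  rw [idem, if_neg (by omega)]
  refine this.trans (Finset.sum_congr rfl fun p _ => ?_)
  rw [map_mul, ratMap_toLevel, ratMap_sh]

/-- The complement `1 - e` is a left combination of shuffle elements, all of which kill `a`.
Together with `idem_mem`, each level of the operad is the right ideal generated by `e`. -/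
theorem idem_mul {n : ℕ} {Q : FinQuot n} {a : GroupRing k Q} (ha : a ∈ brPrimLevel k Q) :
    idem k n Q * a = a := by
  rw [mem_brPrimLevel] at ha
  obtain rfl | hn := Nat.eq_zero_or_pos n
  · rw [ha.1 rfl, mul_zero]
  · obtain ⟨c, hc⟩ := one_sub_idem k hn Q
    have : (1 - idem k n Q) * a = 0 := by
      rw [hc, Finset.sum_mul]
      refine Finset.sum_eq_zero fun p hp => ?_
      rw [Finset.mem_Ioo] at hp
      rw [mul_assoc, ha.2 p hp.1 hp.2, mul_zero]
    rw [sub_mul, one_mul, sub_eq_zero] at this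
    exact this.symm

end Idempotent

/-! ### Tensor powers -/

section TensorPower

variable {C : Type u} [Category.{v} C] [MonoidalCategory C]

/-- The identification of tensor powers with equal exponents. -/
def tpc (V : C) {a b : ℕ} (h : a = b) : tp V a ≅ tp V b := eqToIso (congrArg (tp V) h)

theorem tpc_rfl (V : C) (a : ℕ) : tpc V (rfl : a = a) = Iso.refl _ := rfl

theorem tpc_trans (V : C) {a b c : ℕ} (h : a = b) (h' : b = c) :
    (tpc V h).hom ≫ (tpc V h').hom = (tpc V (h.trans h')).hom := by
  subst h h'
  exact Category.id_comp _

theorem tpc_whisker (V : C) {a b : ℕ} (h : a = b) (h' : a + 1 = b + 1) :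
    (tpc V h).hom ▷ V = (tpc V h').hom := by
  subst h
  exact id_whiskerRight _ _

theorem tpc_inv (V : C) {a b : ℕ} (h : a = b) : (tpc V h).inv = (tpc V h.symm).hom := by
  subst h
  rfl

theorem tpMap_id (V : C) (n : ℕ) : tpMap (𝟙 V) n = 𝟙 _ := by
  induction n with
  | zero => rfl
  | succ n ih => exact (congrArg (· ⊗ₘ 𝟙 V) ih).trans (id_tensorHom_id _ _)

theorem tpMap_comp {U V W : C} (f : U ⟶ V) (g : V ⟶ W) (n : ℕ) :
    tpMap (f ≫ g) n = tpMap f n ≫ tpMap g n := by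
  induction n with
  | zero => exact (Category.comp_id _).symm
  | succ n ih =>
    exact (congrArg (· ⊗ₘ (f ≫ g)) ih).trans (tensorHom_comp_tensorHom _ _ _ _).symm

theorem tpAdd_succ_hom (V : C) (p q : ℕ) :
    (tpAdd V p (q + 1)).hom = (α_ (tp V p) (tp V q) V).inv ≫ (tpAdd V p q).hom ▷ V := rfl

theorem tpAdd_succ_inv (V : C) (p q : ℕ) :
    (tpAdd V p (q + 1)).inv = (tpAdd V p q).inv ▷ V ≫ (α_ (tp V p) (tp V q) V).hom := rfl

theorem tpAdd_naturality {V W : C} (f : V ⟶ W) (p q : ℕ) :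
    (tpMap f p ⊗ₘ tpMap f q) ≫ (tpAdd W p q).hom = (tpAdd V p q).hom ≫ tpMap f (p + q) := by
  induction q with
  | zero =>
    change (tpMap f p ⊗ₘ 𝟙 (𝟙_ C)) ≫ (ρ_ _).hom = (ρ_ _).hom ≫ tpMap f p
    rw [tensorHom_id, rightUnitor_naturality]
  | succ q ih =>
    rw [tpAdd_succ_hom, tpAdd_succ_hom]
    change (tpMap f p ⊗ₘ (tpMap f q ⊗ₘ f)) ≫ _ = _ ≫ (tpMap f (p + q) ⊗ₘ f)
    rw [associator_inv_naturality_assoc, Category.assoc, ← tensorHom_id,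
      tensorHom_comp_tensorHom, ← tensorHom_id, tensorHom_comp_tensorHom, ih, Category.comp_id,
      Category.id_comp]

theorem tpAdd_assoc (V : C) (p q r : ℕ) (h : p + (q + r) = p + q + r) :
    (tpAdd V p q).hom ▷ tp V r ≫ (tpAdd V (p + q) r).hom =
      (α_ _ _ _).hom ≫ tp V p ◁ (tpAdd V q r).hom ≫ (tpAdd V p (q + r)).hom ≫ (tpc V h).hom := by
  induction r with
  | zero =>
    change _ ▷ 𝟙_ C ≫ (ρ_ _).hom = (α_ _ _ (𝟙_ C)).hom ≫ tp V p ◁ (ρ_ _).hom ≫ _ ≫ 𝟙 _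
    rw [rightUnitor_naturality, Category.comp_id]
    simp
  | succ r ih =>
    rw [tpAdd_succ_hom, tpAdd_succ_hom]
    change _ = (α_ _ _ _).hom ≫ _ ≫ ((α_ (tp V p) (tp V (q + r)) V).inv ≫
      (tpAdd V p (q + r)).hom ▷ V) ≫ _
    rw [← tpc_whisker V (show p + (q + r) = p + q + r by omega) h]
    change (tpAdd V p q).hom ▷ (tp V r ⊗ V) ≫ _ = _
    rw [associator_inv_naturality_left_assoc, ← comp_whiskerRight, ih (by omega)]
    simp only [comp_whiskerRight, MonoidalCategory.whiskerLeft_comp, Category.assoc]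
    rw [associator_inv_naturality_middle_assoc]
    monoidal

theorem tpAdd_zero_left (V : C) (q : ℕ) :
    (tpAdd V 0 q).hom ≫ (tpc V (Nat.zero_add q)).hom = (λ_ (tp V q)).hom := by
  induction q with
  | zero => exact (Category.comp_id _).trans unitors_equal.symm
  | succ q ih =>
    rw [tpAdd_succ_hom, ← tpc_whisker V (Nat.zero_add q) _, Category.assoc, ← comp_whiskerRight, ih]
    exact (leftUnitor_tensor_hom _ _).symm

/-- The morphism `f ⊗ id^{⊗ r}`. -/
def pad {A : C} {a b : ℕ} (f : tp A a ⟶ tp A b) : ∀ r, tp A (a + r) ⟶ tp A (b + r)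
  | 0 => f
  | r + 1 => pad f r ▷ A

theorem tpAdd_pad {A : C} {a b : ℕ} (f : tp A a ⟶ tp A b) (r : ℕ) :
    f ▷ tp A r ≫ (tpAdd A b r).hom = (tpAdd A a r).hom ≫ pad f r := by
  induction r with
  | zero => exact rightUnitor_naturality f
  | succ r ih =>
    rw [tpAdd_succ_hom, tpAdd_succ_hom]
    change f ▷ (tp A r ⊗ A) ≫ _ = _ ≫ pad f r ▷ A
    rw [associator_inv_naturality_left_assoc, ← comp_whiskerRight, ih, Category.assoc,
      ← comp_whiskerRight]

theorem pad_eq {A : C} {a b : ℕ} (f : tp A a ⟶ tp A b) (r : ℕ) :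
    pad f r = (tpAdd A a r).inv ≫ f ▷ tp A r ≫ (tpAdd A b r).hom := by
  rw [tpAdd_pad, Iso.inv_hom_id_assoc]

theorem pad_comp {A : C} {a b c : ℕ} (f : tp A a ⟶ tp A b) (g : tp A b ⟶ tp A c) (r : ℕ) :
    pad (f ≫ g) r = pad f r ≫ pad g r := by
  induction r with
  | zero => rfl
  | succ r ih => exact (congrArg (· ▷ A) ih).trans (comp_whiskerRight _ _ _)

theorem pad_id {A : C} {a : ℕ} (r : ℕ) : pad (𝟙 (tp A a)) r = 𝟙 _ := by
  induction r with
  | zero => rfl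
  | succ r ih => exact (congrArg (· ▷ A) ih).trans (id_whiskerRight _ _)

theorem tpInsert_eq {A : C} (i n r : ℕ) (g : tp A n ⟶ A) :
    tpInsert i n r g = pad (a := i + n) (b := i + 1) ((tpAdd A i n).inv ≫ tp A i ◁ g) r := by
  rw [pad_eq]
  rfl

theorem tpInsert_zero {A : C} (i n : ℕ) (g : tp A n ⟶ A) :
    tpInsert i n 0 g = (tpAdd A i n).inv ≫ tp A i ◁ g := tpInsert_eq i n 0 g

theorem tpInsert_succ {A : C} (i n r : ℕ) (g : tp A n ⟶ A) :
    tpInsert i n (r + 1) g = tpInsert i n r g ▷ A := by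
  rw [tpInsert_eq, tpInsert_eq]
  rfl

/-- For an endomorphism `f` of `A^{⊗ n}`, the endomorphism `id^{⊗ i} ⊗ f ⊗ id^{⊗ r}`. -/
def tpEnd {A : C} (i n r : ℕ) (f : tp A n ⟶ tp A n) : tp A (i + n + r) ⟶ tp A (i + n + r) :=
  pad ((tpAdd A i n).inv ≫ tp A i ◁ f ≫ (tpAdd A i n).hom) r

theorem tpEnd_comp {A : C} (i n r : ℕ) (f g : tp A n ⟶ tp A n) :
    tpEnd i n r (f ≫ g) = tpEnd i n r f ≫ tpEnd i n r g := by
  rw [tpEnd, tpEnd, tpEnd, ← pad_comp]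
  simp

theorem tpEnd_id {A : C} (i n r : ℕ) : tpEnd i n r (𝟙 (tp A n)) = 𝟙 _ := by
  rw [tpEnd, ← pad_id]
  simp

theorem tpEnd_insert {A : C} (i n r : ℕ) (f : tp A n ⟶ tp A n) (g : tp A n ⟶ A) :
    tpEnd i n r f ≫ tpInsert i n r g = tpInsert i n r (f ≫ g) := by
  rw [tpEnd, tpInsert_eq, tpInsert_eq, ← pad_comp]
  simp

theorem tpInsert_naturality {A A' : C} (φ : A ⟶ A') (i n r : ℕ) {g : tp A n ⟶ A}
    {g' : tp A' n ⟶ A'} (h : g ≫ φ = tpMap φ n ≫ g') :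
    tpInsert i n r g ≫ tpMap φ (i + 1 + r) = tpMap φ (i + n + r) ≫ tpInsert i n r g' := by
  induction r with
  | zero =>
    rw [tpInsert_zero, tpInsert_zero]
    change (_ ≫ tp A i ◁ g) ≫ (tpMap φ i ⊗ₘ φ) = tpMap φ (i + n) ≫ _
    rw [Category.assoc, Iso.inv_comp_eq, ← Category.assoc (tpAdd A i n).hom, ← tpAdd_naturality,
      Category.assoc, Iso.hom_inv_id_assoc, ← id_tensorHom, tensorHom_comp_tensorHom, h,
      ← id_tensorHom, tensorHom_comp_tensorHom, Category.id_comp, Category.comp_id]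
  | succ r ih =>
    rw [tpInsert_succ, tpInsert_succ]
    change tpInsert i n r g ▷ A ≫ (tpMap φ (i + 1 + r) ⊗ₘ φ) = (tpMap φ (i + n + r) ⊗ₘ φ) ≫ _
    rw [← tensorHom_id, tensorHom_comp_tensorHom, ih, ← tensorHom_id, tensorHom_comp_tensorHom,
      Category.id_comp, Category.comp_id]

/-! ### Iterated multiplication -/

theorem tpMap_foldMul {V W A : C} [MonObj A] (f : V ⟶ W) (g : W ⟶ A) (n : ℕ) :
    tpMap f n ≫ foldMul g n = foldMul (f ≫ g) n := by
  induction n with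
  | zero => exact Category.id_comp _
  | succ n ih =>
    change (tpMap f n ⊗ₘ f) ≫ (foldMul g n ⊗ₘ g) ≫ _ = (foldMul (f ≫ g) n ⊗ₘ (f ≫ g)) ≫ _
    rw [← Category.assoc, tensorHom_comp_tensorHom, ih]

theorem tpAdd_foldMul {V A : C} [MonObj A] (f : V ⟶ A) (p q : ℕ) :
    (tpAdd V p q).hom ≫ foldMul f (p + q) = (foldMul f p ⊗ₘ foldMul f q) ≫ MonObj.mul := by
  induction q with
  | zero =>
    change (ρ_ _).hom ≫ foldMul f p = (foldMul f p ⊗ₘ MonObj.one) ≫ MonObj.mul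
    rw [MonoidalCategory.tensorHom_def, Category.assoc, MonObj.mul_one, rightUnitor_naturality]
  | succ q ih =>
    rw [tpAdd_succ_hom]
    change (_ ≫ _) ≫ (foldMul f (p + q) ⊗ₘ f) ≫ _ =
      (foldMul f p ⊗ₘ ((foldMul f q ⊗ₘ f) ≫ MonObj.mul)) ≫ _
    have h1 : (tpAdd V p q).hom ▷ V ≫ (foldMul f (p + q) ⊗ₘ f) =
        ((foldMul f p ⊗ₘ foldMul f q) ⊗ₘ f) ≫ MonObj.mul ▷ A := by
      rw [← tensorHom_id, tensorHom_comp_tensorHom, Category.id_comp, ih, ← tensorHom_id,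
        tensorHom_comp_tensorHom, Category.comp_id]
    have h2 : (foldMul f p ⊗ₘ ((foldMul f q ⊗ₘ f) ≫ MonObj.mul)) =
        (foldMul f p ⊗ₘ (foldMul f q ⊗ₘ f)) ≫ A ◁ MonObj.mul := by
      rw [← id_tensorHom, tensorHom_comp_tensorHom, Category.comp_id]
    rw [Category.assoc, reassoc_of% h1, h2, MonObj.mul_assoc]
    simp

theorem tpInsert_foldMul {A : C} [MonObj A] (i n r : ℕ) :
    tpInsert i n r (foldMul (𝟙 A) n) ≫ foldMul (𝟙 A) (i + 1 + r) = foldMul (𝟙 A) (i + n + r) := by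
  induction r with
  | zero =>
    rw [tpInsert_zero]
    change (_ ≫ _) ≫ (foldMul (𝟙 A) i ⊗ₘ 𝟙 A) ≫ _ = foldMul (𝟙 A) (i + n)
    rw [Category.assoc, Iso.inv_comp_eq, tpAdd_foldMul, ← Category.assoc, ← id_tensorHom,
      tensorHom_comp_tensorHom, Category.id_comp, Category.comp_id]
  | succ r ih =>
    rw [tpInsert_succ]
    change _ ▷ A ≫ (foldMul (𝟙 A) (i + 1 + r) ⊗ₘ 𝟙 A) ≫ _ =
      (foldMul (𝟙 A) (i + n + r) ⊗ₘ 𝟙 A) ≫ _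
    rw [← Category.assoc, ← tensorHom_id, tensorHom_comp_tensorHom, ih, Category.id_comp]

/-! ### The action of the braid groups -/

variable [BraidedCategory C]

theorem braidAction_mul (V : C) (n : ℕ) (x y : B n) :
    (braidAction V n (x * y)).hom = (braidAction V n y).hom ≫ (braidAction V n x).hom := by
  rw [map_mul]
  rfl

theorem braidAction_one (V : C) (n : ℕ) : (braidAction V n 1).hom = 𝟙 _ := by
  rw [map_one]
  rfl

theorem braidAction_inv_eq (V : C) (n : ℕ) {x : B n} {f : tp V n ⟶ tp V n}
    (h : (braidAction V n x).hom ≫ f = 𝟙 _) : (braidAction V n x⁻¹).hom = f := by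
  rw [← Category.comp_id (braidAction V n x⁻¹).hom, ← h, ← Category.assoc, ← braidAction_mul,
    mul_inv_cancel, braidAction_one, Category.id_comp]

theorem braidAction_σ (V : C) (n i : ℕ) (h : i + 1 < n) :
    (braidAction V n (σ n i)).hom = (braidGen V n i).hom := by
  exact congrArg Iso.hom (braidLift_σ n (G := Aut (tp V n)) _ _ _ i h)

theorem braidGen_succ (V : C) (n i : ℕ) (h : i + 1 < n) :
    (braidGen V (n + 1) i).hom = (braidGen V n i).hom ▷ V := by
  obtain ⟨m, rfl⟩ : ∃ m, n = m + 2 := ⟨n - 2, by omega⟩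
  rw [braidGen_ne V (m + 1) i (by omega)]
  rfl

theorem braidGen_pad (V : C) (n i r : ℕ) (h : i + 1 < n) :
    (braidGen V (n + r) i).hom = pad (braidGen V n i).hom r := by
  induction r with
  | zero => rfl
  | succ r ih =>
    refine (braidGen_succ V (n + r) i (by omega)).trans ?_
    rw [ih]
    rfl

theorem braidGen_naturality {V W : C} (f : V ⟶ W) (n i : ℕ) :
    tpMap f n ≫ (braidGen W n i).hom = (braidGen V n i).hom ≫ tpMap f n := by
  induction n with
  | zero => exact (Category.comp_id _).trans (Category.id_comp _).symm
  | succ n ih =>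
    obtain _ | n := n
    · exact (Category.comp_id _).trans (Category.id_comp _).symm
    by_cases h : i = n
    · subst h
      rw [braidGen_last, braidGen_last]
      change ((tpMap f i ⊗ₘ f) ⊗ₘ f) ≫ (α_ _ _ _).hom ≫ _ ◁ _ ≫ (α_ _ _ _).inv =
        ((α_ _ _ _).hom ≫ _ ◁ _ ≫ (α_ _ _ _).inv) ≫ ((tpMap f i ⊗ₘ f) ⊗ₘ f)
      rw [associator_naturality_assoc, ← id_tensorHom, ← Category.assoc (_ ⊗ₘ (_ ⊗ₘ _)),
        tensorHom_comp_tensorHom, BraidedCategory.braiding_naturality, Category.comp_id,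
        Category.assoc, Category.assoc, ← associator_inv_naturality, ← id_tensorHom,
        ← Category.assoc (_ ⊗ₘ _), tensorHom_comp_tensorHom, Category.id_comp]
    · rw [braidGen_ne _ _ _ h, braidGen_ne _ _ _ h]
      change (tpMap f (n + 1) ⊗ₘ f) ≫ _ ▷ W = _ ▷ V ≫ (tpMap f (n + 1) ⊗ₘ f)
      rw [← tensorHom_id, tensorHom_comp_tensorHom, ih, ← tensorHom_id, tensorHom_comp_tensorHom,
        Category.id_comp, Category.comp_id]

theorem braidAction_naturality {V W : C} (f : V ⟶ W) (n : ℕ) (g : B n) :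
    tpMap f n ≫ (braidAction W n g).hom = (braidAction V n g).hom ≫ tpMap f n := by
  induction g using braid_induction with
  | one => rw [braidAction_one, braidAction_one, Category.id_comp, Category.comp_id]
  | mul x y hx hy =>
    rw [braidAction_mul, braidAction_mul, ← Category.assoc, hy, Category.assoc, hx, Category.assoc]
  | inv x hx =>
    rw [map_inv, map_inv]
    exact ((Iso.comp_inv_eq _).2 (by rw [Category.assoc, hx]; exact (Iso.inv_hom_id_assoc _ _).symm))
  | gen i hi => rw [braidAction_σ _ _ _ hi, braidAction_σ _ _ _ hi, braidGen_naturality]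

theorem braidGen_add (V : C) (j n i : ℕ) (h : i + 1 < n) :
    (tpAdd V j n).hom ≫ (braidGen V (j + n) (j + i)).hom =
      tp V j ◁ (braidGen V n i).hom ≫ (tpAdd V j n).hom := by
  induction n with
  | zero => omega
  | succ n ih =>
    obtain ⟨n, rfl⟩ : ∃ m, n = m + 1 := ⟨n - 1, by omega⟩
    by_cases hi : i = n
    · subst hi
      have e := braidGen_last V (j + i)
      rw [braidGen_last, tpAdd_succ_hom, tpAdd_succ_hom]
      change _ ≫ (braidGen V (j + i + 2) (j + i)).hom = _
      rw [e]
      simp only [Iso.trans_hom, Iso.symm_hom, whiskerLeftIso_hom, comp_whiskerRight,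
        MonoidalCategory.whiskerLeft_comp, Category.assoc]
      rw [associator_naturality_left_assoc, ← whisker_exchange_assoc,
        associator_inv_naturality_left]
      monoidal
    · have e := braidGen_succ V (j + (n + 1)) (j + i) (by omega)
      change _ ≫ (braidGen V (j + (n + 1) + 1) (j + i)).hom = _
      rw [e, braidGen_succ V (n + 1) i (by omega), tpAdd_succ_hom, Category.assoc,
        ← comp_whiskerRight, ih (by omega), comp_whiskerRight]
      change _ = _ ◁ (_ ▷ V) ≫ _
      rw [associator_inv_naturality_middle_assoc]

theorem braidAction_shift (V : C) (j n r : ℕ) (h : j + n ≤ j + n + r) (g : B n) :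
    (braidAction V (j + n + r) (shift n (j + n + r) j h g)).hom =
      tpEnd j n r (braidAction V n g).hom := by
  induction g using braid_induction with
  | one => rw [map_one, braidAction_one, braidAction_one, tpEnd_id]
  | mul x y hx hy => rw [map_mul, braidAction_mul, hx, hy, braidAction_mul, tpEnd_comp]
  | inv x hx =>
    rw [map_inv]
    refine braidAction_inv_eq _ _ ?_
    rw [hx, ← tpEnd_comp, ← braidAction_mul, inv_mul_cancel, braidAction_one, tpEnd_id]
  | gen i hi =>
    rw [shift_σ _ _ _ _ _ hi, braidAction_σ _ _ _ hi, braidAction_σ _ _ _ (by omega),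
      braidGen_pad V (j + n) _ _ (by omega), tpEnd, ← braidGen_add V j n i hi,
      Iso.inv_hom_id_assoc]

/-- Adding a strand on the right. -/
theorem braidAction_shift_succ (V : C) (n : ℕ) (h : 0 + n ≤ n + 1) (g : B n) :
    (braidAction V (n + 1) (shift n (n + 1) 0 h g)).hom = (braidAction V n g).hom ▷ V := by
  induction g using braid_induction with
  | one => rw [map_one, braidAction_one, braidAction_one, id_whiskerRight]
  | mul x y hx hy => rw [map_mul, braidAction_mul, hx, hy, braidAction_mul, comp_whiskerRight]
  | inv x hx =>
    rw [map_inv]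
    refine braidAction_inv_eq _ _ ?_
    rw [hx, ← comp_whiskerRight, ← braidAction_mul, inv_mul_cancel, braidAction_one,
      id_whiskerRight]
  | gen i hi =>
    rw [shift_σ _ _ _ _ _ hi, braidAction_σ _ _ _ hi, braidAction_σ _ _ _ (by omega),
      Nat.zero_add, braidGen_succ _ _ _ hi]

end TensorPower

/-! ### Naturality of the action with respect to cabling -/

section CableAction

variable {C : Type u} [Category.{v} C] [MonoidalCategory C]

/-- The morphism `A^{⊗ N} ⟶ A^{⊗ M}` which applies `g : A^{⊗ n} ⟶ A` to the tensor factors in the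
positions `j, …, j + n - 1`. -/
def insPos {A : C} {N M n : ℕ} (hN : N + 1 = M + n) (j : ℕ) (hj : j < M) (g : tp A n ⟶ A) :
    tp A N ⟶ tp A M :=
  (tpc A (show j + n + (M - 1 - j) = N by omega)).inv ≫ tpInsert j n (M - 1 - j) g ≫
    (tpc A (show j + 1 + (M - 1 - j) = M by omega)).hom

theorem insPos_eq {A : C} {N M n : ℕ} (hN : N + 1 = M + n) (j r : ℕ) (hj : j < M)
    (h : j + n + r = N) (h' : j + 1 + r = M) (g : tp A n ⟶ A) :
    insPos hN j hj g = (tpc A h).inv ≫ tpInsert j n r g ≫ (tpc A h').hom := by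
  obtain rfl : r = M - 1 - j := by omega
  rfl

theorem insPos_self {A : C} (i n r : ℕ) (h : (i + n + r) + 1 = (i + 1 + r) + n)
    (hi : i < i + 1 + r) (g : tp A n ⟶ A) : insPos h i hi g = tpInsert i n r g := by
  rw [insPos_eq h i r hi rfl rfl]
  exact (Category.id_comp _).trans (Category.comp_id _)

theorem insPos_succ {A : C} {N M n : ℕ} (hN : N + 1 = M + n) (hN' : N + 1 + 1 = M + 1 + n) (j : ℕ)
    (hj : j < M) (hj' : j < M + 1) (g : tp A n ⟶ A) :
    insPos hN' j hj' g = insPos hN j hj g ▷ A := by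
  obtain ⟨r, rfl⟩ : ∃ r, M = j + 1 + r := ⟨M - 1 - j, by omega⟩
  obtain rfl : N = j + n + r := by omega
  rw [insPos_self, ← tpInsert_succ]
  exact insPos_self j n (r + 1) _ _ g

variable [BraidedCategory C]

/-- The hexagon identity for `β_{Q ⊗ V, V}`, in the form of the inductive step of `braidAction_up`:
the moving factor passes one more tensor factor. -/
theorem up_aux {P Q T V W : C} (a : P ⊗ Q ≅ T) (b : (P ⊗ V) ⊗ Q ⟶ W) :
    ((α_ T V V).hom ≫ T ◁ (β_ V V).hom ≫ (α_ T V V).inv) ≫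
      (a.inv ▷ V ≫ (α_ P Q V).hom ≫ P ◁ (β_ Q V).hom ≫ (α_ P V Q).inv ≫ b) ▷ V =
    (a.inv ▷ V ≫ (α_ P Q V).hom) ▷ V ≫ (α_ P (Q ⊗ V) V).hom ≫ P ◁ (β_ (Q ⊗ V) V).hom ≫
      (α_ P V (Q ⊗ V)).inv ≫ (α_ (P ⊗ V) Q V).inv ≫ b ▷ V := by
  have h : T ◁ (β_ V V).hom ≫ (α_ T V V).inv ≫ a.inv ▷ V ▷ V =
      a.inv ▷ (V ⊗ V) ≫ (α_ P Q (V ⊗ V)).hom ≫ P ◁ Q ◁ (β_ V V).hom ≫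
        (α_ P Q (V ⊗ V)).inv ≫ (α_ (P ⊗ Q) V V).inv := by
    rw [← associator_inv_naturality_left, whisker_exchange_assoc]
    simp
  simp only [comp_whiskerRight, Category.assoc, reassoc_of% h,
    BraidedCategory.braiding_tensor_left_hom, MonoidalCategory.whiskerLeft_comp]
  monoidal

theorem down_aux {P Q T V W : C} (a : P ⊗ Q ≅ T) (b : W ⟶ (P ⊗ V) ⊗ Q) :
    (b ≫ (α_ P V Q).hom ≫ P ◁ (β_ V Q).hom ≫ (α_ P Q V).inv ≫ a.hom ▷ V) ▷ V ≫
      ((α_ T V V).hom ≫ T ◁ (β_ V V).hom ≫ (α_ T V V).inv) =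
    b ▷ V ≫ (α_ (P ⊗ V) Q V).hom ≫ (α_ P V (Q ⊗ V)).hom ≫ P ◁ (β_ V (Q ⊗ V)).hom ≫
      (α_ P (Q ⊗ V) V).inv ≫ ((α_ P Q V).inv ≫ a.hom ▷ V) ▷ V := by
  have h : a.hom ▷ V ▷ V ≫ (α_ T V V).hom ≫ T ◁ (β_ V V).hom ≫ (α_ T V V).inv =
      (α_ (P ⊗ Q) V V).hom ≫ (α_ P Q (V ⊗ V)).hom ≫ P ◁ Q ◁ (β_ V V).hom ≫
        (α_ P Q (V ⊗ V)).inv ≫ (α_ (P ⊗ Q) V V).inv ≫ a.hom ▷ V ▷ V := by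
    rw [associator_naturality_left_assoc, ← whisker_exchange_assoc, associator_inv_naturality_left]
    simp
  simp only [comp_whiskerRight, Category.assoc, h,
    BraidedCategory.braiding_tensor_right_hom, MonoidalCategory.whiskerLeft_comp]
  monoidal

theorem braidAction_up_whisker (V : C) (n j c : ℕ) (h : c = 0 ∨ j + c < n) :
    (braidAction V (n + 1) (up (n + 1) j c)).hom = (braidAction V n (up n j c)).hom ▷ V := by
  rw [← braidAction_shift_succ V n (by omega), shift_up _ _ _ _ _ _ h, Nat.zero_add]

theorem shift_down (n N j : ℕ) (h : j + n ≤ N) (i c : ℕ) (hi : c = 0 ∨ i + c < n) :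
    shift n N j h (down n i c) = down N (j + i) c := by
  induction c with
  | zero => exact map_one _
  | succ c ih => rw [down, map_mul, ih (by omega), shift_σ _ _ _ _ _ (by omega), down, add_assoc]

theorem braidAction_down_whisker (V : C) (n j c : ℕ) (h : c = 0 ∨ j + c < n) :
    (braidAction V (n + 1) (down (n + 1) j c)).hom = (braidAction V n (down n j c)).hom ▷ V := by
  rw [← braidAction_shift_succ V n (by omega), shift_down _ _ _ _ _ _ h, Nat.zero_add]

/-- The braid `up` acts by the braiding `β_{V^{⊗ q}, V}`. -/
theorem braidAction_up (V : C) (p q : ℕ) (h : p + 1 + q = p + q + 1) :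
    (braidAction V (p + q + 1) (up (p + q + 1) p q)).hom =
      (tpAdd V p q).inv ▷ V ≫ (α_ (tp V p) (tp V q) V).hom ≫ tp V p ◁ (β_ (tp V q) V).hom ≫
        (α_ (tp V p) V (tp V q)).inv ≫ (tpAdd V (p + 1) q).hom ≫ (tpc V h).hom := by
  induction q with
  | zero =>
    rw [up, braidAction_one]
    change 𝟙 (tp V p ⊗ V) = (ρ_ _).inv ▷ V ≫ (α_ (tp V p) (𝟙_ C) V).hom ≫
      tp V p ◁ (β_ (𝟙_ C) V).hom ≫ (α_ (tp V p) V (𝟙_ C)).inv ≫ (ρ_ (tp V p ⊗ V)).hom ≫ 𝟙 _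
    rw [braiding_tensorUnit_left]
    simp
  | succ q ih =>
    rw [up, braidAction_mul, braidAction_σ _ _ _ (by omega)]
    have e := braidAction_up_whisker V (p + q + 1) p q (by omega)
    change (braidGen V (p + q + 2) (p + q)).hom ≫
      (braidAction V (p + q + 1 + 1) (up (p + q + 1 + 1) p q)).hom = _
    rw [e, ih (by omega), braidGen_last]
    refine (up_aux (tpAdd V p q) ((tpAdd V (p + 1) q).hom ≫ (tpc V _).hom)).trans ?_
    rw [comp_whiskerRight (tpAdd V (p + 1) q).hom (tpc V _).hom, tpc_whisker V _ h,
      tpAdd_succ_inv, tpAdd_succ_hom]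
    simp only [Category.assoc]

/-- The braid `down` acts by the braiding `β_{V, V^{⊗ q}}`. -/
theorem braidAction_down (V : C) (p q : ℕ) (h : p + q + 1 = p + 1 + q) :
    (braidAction V (p + q + 1) (down (p + q + 1) p q)).hom =
      (tpc V h).hom ≫ (tpAdd V (p + 1) q).inv ≫ (α_ (tp V p) V (tp V q)).hom ≫
        tp V p ◁ (β_ V (tp V q)).hom ≫ (α_ (tp V p) (tp V q) V).inv ≫ (tpAdd V p q).hom ▷ V := by
  induction q with
  | zero =>
    rw [down, braidAction_one]
    change 𝟙 (tp V p ⊗ V) = 𝟙 _ ≫ (ρ_ (tp V p ⊗ V)).inv ≫ (α_ (tp V p) V (𝟙_ C)).hom ≫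
      tp V p ◁ (β_ V (𝟙_ C)).hom ≫ (α_ (tp V p) (𝟙_ C) V).inv ≫ (ρ_ _).hom ▷ V
    rw [braiding_tensorUnit_right]
    simp
  | succ q ih =>
    rw [down, braidAction_mul, braidAction_σ _ _ _ (by omega)]
    have e := braidAction_down_whisker V (p + q + 1) p q (by omega)
    change (braidAction V (p + q + 1 + 1) (down (p + q + 1 + 1) p q)).hom ≫
      (braidGen V (p + q + 2) (p + q)).hom = _
    have e2 := down_aux (tpAdd V p q) ((tpc V (show p + q + 1 = p + 1 + q by omega)).hom ≫
      (tpAdd V (p + 1) q).inv)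
    simp only [Category.assoc] at e2
    rw [e, ih (by omega), braidGen_last]
    refine e2.trans ?_
    rw [comp_whiskerRight, tpc_whisker V _ h, Category.assoc, tpAdd_succ_inv, tpAdd_succ_hom,
      Category.assoc]

theorem cableGen_last_aux {T T' A : C} (f : T ⟶ T') :
    ((α_ T A A).hom ≫ T ◁ (β_ A A).hom ≫ (α_ T A A).inv) ≫ f ▷ A ▷ A =
      f ▷ A ▷ A ≫ (α_ T' A A).hom ≫ T' ◁ (β_ A A).hom ≫ (α_ T' A A).inv := by
  rw [associator_naturality_left_assoc, ← whisker_exchange_assoc, associator_inv_naturality_left]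
  simp

/-- Naturality of the braiding in its first argument: `g` may be applied to the cable before or
after the strand passes it. -/
theorem cableGen_up_aux {P Q T A : C} (a : P ⊗ Q ≅ T) (g : Q ⟶ A) :
    (a.inv ▷ A ≫ (α_ P Q A).hom ≫ P ◁ (β_ Q A).hom ≫ (α_ P A Q).inv) ≫ (P ⊗ A) ◁ g =
      (a.inv ≫ P ◁ g) ▷ A ≫ (α_ P A A).hom ≫ P ◁ (β_ A A).hom ≫ (α_ P A A).inv := by
  have h := BraidedCategory.braiding_naturality_left g A
  simp only [comp_whiskerRight, Category.assoc]
  rw [associator_naturality_middle_assoc, ← MonoidalCategory.whiskerLeft_comp_assoc, h]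
  simp

theorem cableGen_down_aux {P Q T A : C} (a : P ⊗ Q ≅ T) (g : Q ⟶ A) :
    ((α_ P A Q).hom ≫ P ◁ (β_ A Q).hom ≫ (α_ P Q A).inv ≫ a.hom ▷ A) ≫ (a.inv ≫ P ◁ g) ▷ A =
      (P ⊗ A) ◁ g ≫ (α_ P A A).hom ≫ P ◁ (β_ A A).hom ≫ (α_ P A A).inv := by
  have h := BraidedCategory.braiding_naturality_right A g
  simp only [comp_whiskerRight, Category.assoc, hom_inv_whiskerRight_assoc]
  rw [← associator_inv_naturality_middle, ← MonoidalCategory.whiskerLeft_comp_assoc, ← h]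
  simp
  rw [← MonoidalCategory.whiskerLeft_comp, ← h, MonoidalCategory.whiskerLeft_comp]

theorem cableGen_whisker (A : C) {N M n : ℕ} (hN : N + 1 = M + n) {l j : ℕ} (hl : l + 1 < M)
    (hj : j < M) : (braidAction A (N + 1) (cableGen (N + 1) n l j)).hom =
      (braidAction A N (cableGen N n l j)).hom ▷ A := by
  rw [← braidAction_shift_succ A N (by omega)]
  congr 2
  unfold cableGen
  split_ifs with h1 h2 h3
  · rw [shift_up _ _ _ _ _ _ (by omega), Nat.zero_add]
  · rw [shift_down _ _ _ _ _ _ (by omega), Nat.zero_add]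
  · rw [shift_σ _ _ _ _ _ (by omega), Nat.zero_add]
  · rw [shift_σ _ _ _ _ _ (by omega), Nat.zero_add]

/-- The naturality of the action with respect to cabling, for the generators. -/
theorem cableGen_insPos {A : C} {n : ℕ} (g : tp A n ⟶ A) (M N l j : ℕ) (hN : N + 1 = M + n)
    (hl : l + 1 < M) (hj : j < M) (hj' : sw l j < M) :
    (braidAction A N (cableGen N n l j)).hom ≫ insPos hN (sw l j) hj' g =
      insPos hN j hj g ≫ (braidGen A M l).hom := by
  induction M generalizing N with
  | zero => omega
  | succ M ih =>
    -- If neither the generator nor the cable involves the last tensor factor, this factor is a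
    -- spectator and the induction applies. Otherwise the cable is last and far from the generator,
    -- or the generator acts on the last two factors.
    by_cases hs : l + 1 < M ∧ j < M
    · obtain ⟨N, rfl⟩ : ∃ N', N = N' + 1 := ⟨N - 1, by omega⟩
      have hs' : sw l j < M := sw_lt hs.1 hs.2
      rw [insPos_succ (by omega) hN _ hs', insPos_succ (by omega) hN _ hs.2,
        cableGen_whisker A (M := M) (by omega) hs.1 hs.2, braidGen_succ _ _ _ hs.1,
        ← comp_whiskerRight, ← comp_whiskerRight, ih N (by omega) hs.1 hs.2 hs']
    · by_cases hl' : l + 1 < M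
      · obtain rfl : j = M := by omega
        obtain rfl : N = j + n := by omega
        have e1 : sw l j = j := by rw [sw, if_neg (by omega), if_neg (by omega)]
        have e2 : cableGen (j + n) n l j = σ (j + n) l := by
          rw [cableGen, if_neg (by omega), if_neg (by omega), if_neg (by omega)]
        simp only [e1]
        have e3 := insPos_self (A := A) j n 0 hN hj g
        change insPos hN j hj g = _ at e3
        rw [e3, tpInsert_zero, e2, braidAction_σ _ _ _ (by omega), braidGen_pad _ _ _ _ hl',
          braidGen_succ _ _ _ hl', pad_eq]
        simp only [Category.assoc, Iso.hom_inv_id_assoc]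
        rw [whisker_exchange]
      · obtain rfl : M = l + 1 := by omega
        obtain rfl : N = l + n + 1 := by omega
        -- With the generator in the last two positions, the cable is to its left, is its left
        -- strand, or is its right strand.
        have h3 : j < l ∨ j = l ∨ j = l + 1 := by omega
        obtain h | rfl | rfl := h3
        · obtain ⟨r, rfl⟩ : ∃ r, l = j + 1 + r := ⟨l - 1 - j, by omega⟩
          have e1 : sw (j + 1 + r) j = j := by rw [sw, if_neg (by omega), if_neg (by omega)]
          have e2 : cableGen (j + 1 + r + n + 1) n (j + 1 + r) j =
              σ (j + 1 + r + n + 1) (j + 1 + r + n - 1) := by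
            rw [cableGen, if_neg (by omega), if_neg (by omega), if_pos (by omega)]
          simp only [e1]
          obtain ⟨N, hN'⟩ : ∃ N, N + 1 + 1 = j + 1 + r + n + 1 := ⟨j + r + n, by omega⟩
          rw [e2, braidAction_σ _ _ _ (by omega), show j + 1 + r + n - 1 = N by omega]
          generalize j + 1 + r + n + 1 = N' at *
          subst hN'
          rw [insPos_succ (M := j + 1 + r + 1) (by omega) hN _ (by omega),
            insPos_succ (N := N) (M := j + 1 + r) (by omega) (by omega) _ (by omega),
            braidGen_last, braidGen_last]
          exact cableGen_last_aux _
        · have e1 : sw j j = j + 1 := by rw [sw, if_pos rfl]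
          have e2 : cableGen (j + n + 1) n j j = up (j + n + 1) j n := by
            rw [cableGen, if_pos rfl]
          simp only [e1]
          have e3 := insPos_self (A := A) j n 1 hN hj g
          rw [e2, insPos_eq hN (j + 1) 0 _ (by omega) rfl, braidGen_last, braidAction_up A j n (by omega), e3,
            tpInsert_succ, tpInsert_zero, tpInsert_zero, tpc_inv]
          simp only [Category.assoc]
          rw [← Category.assoc (tpc A _).hom (tpc A _).hom, tpc_trans]
          refine Eq.trans ?_ (cableGen_up_aux (tpAdd A j n) g)
          simp only [Category.assoc]
          change _ ≫ _ ≫ _ ≫ _ ≫ _ ≫ 𝟙 _ ≫ _ ≫ _ ≫ 𝟙 _ = _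
          simp
        · have e1 : sw l (l + 1) = l := by rw [sw, if_neg (by omega), if_pos rfl]
          have e2 : cableGen (l + n + 1) n l (l + 1) = down (l + n + 1) l n := by
            rw [cableGen, if_neg (by omega), if_pos rfl]
          simp only [e1]
          have e3 := insPos_self (A := A) l n 1 hN (by omega) g
          rw [e2, insPos_eq hN (l + 1) 0 _ (by omega) rfl, braidGen_last, braidAction_down A l n (by omega), e3,
            tpInsert_succ, tpInsert_zero, tpInsert_zero, tpc_inv]
          have e4 := cableGen_down_aux (tpAdd A l n) g
          simp only [Category.assoc] at e4 ⊢
          rw [e4]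
          change _ = _ ≫ _ ≫ _ ≫ 𝟙 _ ≫ _
          rw [Category.id_comp]
          rfl

/-- Equivariance extends the naturality from generators to all braids. It translates operadic
composition into insertion of operations. -/
theorem cable_insPos {A : C} {N M n : ℕ} (hN : N + 1 = M + n) (g : tp A n ⟶ A) (γ : B M)
    (x : Fin M × B N) :
    (braidAction A N (cable hN (MonoidHom.id _) γ x).2).hom ≫
      insPos hN (cable hN (MonoidHom.id _) γ x).1 (cable hN (MonoidHom.id _) γ x).1.2 g =
    ((braidAction A N x.2).hom ≫ insPos hN x.1 x.1.2 g) ≫ (braidAction A M γ).hom := by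
  refine braid_equivariant (cable hN (MonoidHom.id _)) (fun γ f => f ≫ (braidAction A M γ).hom)
    (fun f => by rw [braidAction_one, Category.comp_id])
    (fun a b f => by rw [braidAction_mul, Category.assoc])
    (fun x => (braidAction A N x.2).hom ≫ insPos hN x.1 x.1.2 g) (fun l hl x => ?_) γ x
  refine (congrArg (fun x : Fin M × B N => (braidAction A N x.2).hom ≫ insPos hN x.1 x.1.2 g)
    (cable_σ hN _ l hl x)).trans ?_
  rw [braidAction_σ _ _ _ hl, MonoidHom.id_apply, braidAction_mul, Category.assoc, Category.assoc,
    ← cableGen_insPos g M N l x.1 hN hl x.1.2 (sw_lt hl x.1.2)]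

end CableAction

/-! ### The action of the group rings of the braid groups -/

section GroupRingAction

variable (k : Type*) [Field k] {C : Type u} [Category.{v} C] [Preadditive C] [Linear k C]
  [MonoidalCategory C] [BraidedCategory C]

/-- The linear extension of the action of `B n` on `V^{⊗ n}`. -/
noncomputable def gact (V : C) (n : ℕ) : MonoidAlgebra k (B n) →ₗ[k] (tp V n ⟶ tp V n) where
  toFun x := MonoidAlgebra.lift k (End (tp V n)) (B n)
    ((Aut.toEnd (tp V n)).comp (braidAction V n)) x
  map_add' := map_add (MonoidAlgebra.lift k (End (tp V n)) (B n)
    ((Aut.toEnd (tp V n)).comp (braidAction V n)))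
  map_smul' := map_smul (MonoidAlgebra.lift k (End (tp V n)) (B n)
    ((Aut.toEnd (tp V n)).comp (braidAction V n)))

theorem gact_single (V : C) (n : ℕ) (g : B n) (s : k) :
    gact k V n (MonoidAlgebra.single g s) = s • (braidAction V n g).hom := by
  have h : MonoidAlgebra.lift k (End (tp V n)) (B n)
      ((Aut.toEnd (tp V n)).comp (braidAction V n)) (MonoidAlgebra.single g s) =
        s • (Aut.toEnd (tp V n)).comp (braidAction V n) g := MonoidAlgebra.lift_single ..
  exact h

theorem gact_mul (V : C) (n : ℕ) (x y : MonoidAlgebra k (B n)) :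
    gact k V n (x * y) = gact k V n y ≫ gact k V n x :=
  map_mul (MonoidAlgebra.lift k (End (tp V n)) (B n)
    ((Aut.toEnd (tp V n)).comp (braidAction V n))) x y

theorem gact_of (V : C) (n : ℕ) (g : B n) :
    gact k V n (MonoidAlgebra.of k (B n) g) = (braidAction V n g).hom := by
  rw [MonoidAlgebra.of_apply, gact_single, one_smul]

theorem gact_one (V : C) (n : ℕ) : gact k V n 1 = 𝟙 _ := by
  rw [← map_one (MonoidAlgebra.of k (B n)), gact_of, braidAction_one]

theorem gact_naturality {V W : C} (f : V ⟶ W) (n : ℕ) (x : MonoidAlgebra k (B n)) :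
    tpMap f n ≫ gact k W n x = gact k V n x ≫ tpMap f n := by
  induction x using MonoidAlgebra.induction_linear with
  | zero => simp
  | add a b ha hb => simp only [map_add, Preadditive.comp_add, Preadditive.add_comp, ha, hb]
  | single g s =>
    rw [gact_single, gact_single, Linear.comp_smul, Linear.smul_comp, braidAction_naturality]

theorem out_inv_mul_mem {n : ℕ} (R : FinQuot n) (g : B n) :
    (Quotient.out (QuotientGroup.mk g : B n ⧸ R.toSubgroup))⁻¹ * g ∈ R.toSubgroup := by
  rw [← QuotientGroup.eq, QuotientGroup.out_eq']

/-- The endomorphisms of `A^{⊗ n}` which vanish on the invariants of `R`, in a strong sense. -/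
noncomputable def augSpan {n : ℕ} (R : FinQuot n) (A : C) : Submodule k (tp A n ⟶ tp A n) :=
  Submodule.span k {h | ∃ g ∈ R.toSubgroup, ∃ X : tp A n ⟶ tp A n,
    h = ((braidAction A n g).hom - 𝟙 _) ≫ X}

theorem gact_sub_outLift_mem {n : ℕ} (R : FinQuot n) (A : C) (x : MonoidAlgebra k (B n)) :
    gact k A n x - gact k A n (outLift (toLevel k R x)) ∈ augSpan k R A := by
  induction x using MonoidAlgebra.induction_linear with
  | zero =>
    rw [map_zero, map_zero, outLift, MonoidAlgebra.coeff_zero, Finsupp.sum_zero_index, map_zero, sub_zero]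
    exact Submodule.zero_mem _
  | add a b ha hb =>
    have e : outLift (toLevel k R (a + b)) = outLift (toLevel k R a) + outLift (toLevel k R b) := by
      rw [map_add]
      exact Finsupp.sum_add_index' (fun _ => MonoidAlgebra.single_zero _)
        (fun _ _ _ => MonoidAlgebra.single_add _ _ _)
    rw [e, map_add, map_add, add_sub_add_comm]
    exact Submodule.add_mem _ ha hb
  | single g s =>
    have e : outLift (toLevel k R (MonoidAlgebra.single g s)) =
        MonoidAlgebra.single (Quotient.out (QuotientGroup.mk g : B n ⧸ R.toSubgroup)) s := by
      rw [toLevel_single]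
      exact Finsupp.sum_single_index (MonoidAlgebra.single_zero _)
    rw [e, gact_single, gact_single, ← smul_sub]
    refine Submodule.smul_mem _ _ (Submodule.subset_span ⟨_, out_inv_mul_mem R g,
      (braidAction A n (Quotient.out (QuotientGroup.mk g : B n ⧸ R.toSubgroup))).hom, ?_⟩)
    rw [Preadditive.sub_comp, ← braidAction_mul, mul_inv_cancel_left, Category.id_comp]

theorem gact_mem_augSpan {n : ℕ} {R : FinQuot n} (A : C) {x : MonoidAlgebra k (B n)}
    (hx : toLevel k R x = 0) : gact k A n x ∈ augSpan k R A := by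
  have h := gact_sub_outLift_mem k R A x
  rwa [hx, outLift, MonoidAlgebra.coeff_zero, Finsupp.sum_zero_index, map_zero, sub_zero] at h

end GroupRingAction

/-! ### Morphisms into invariants of finite-index subgroups -/

section Fixed

variable {C : Type u} [Category.{v} C] [MonoidalCategory C] [BraidedCategory C] {A : C} {n : ℕ}

/-- The morphism `f` has values in the invariants of the kernel of the finite quotient `R`. -/
def FixedBy {Z : C} (f : Z ⟶ tp A n) (R : FinQuot n) : Prop :=
  ∀ g ∈ R.toSubgroup, f ≫ (braidAction A n g).hom = f

namespace FixedBy

variable {Z : C} {f : Z ⟶ tp A n} {R : FinQuot n}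

theorem mono (hf : FixedBy f R) {R' : FinQuot n} (h : R' ≤ R) : FixedBy f R' :=
  fun g hg => hf g (h hg)

theorem precomp (hf : FixedBy f R) {Y : C} (v : Y ⟶ Z) : FixedBy (v ≫ f) R :=
  fun g hg => by rw [Category.assoc, hf g hg]

theorem map (hf : FixedBy f R) {A' : C} (φ : A ⟶ A') : FixedBy (f ≫ tpMap φ n) R :=
  fun g hg => by rw [Category.assoc, braidAction_naturality, ← Category.assoc, hf g hg]

theorem tpc {m : ℕ} (hf : FixedBy f R) (h : n = m) :
    ∃ R' : FinQuot m, FixedBy (f ≫ (tpc A h).hom) R' := by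
  subst h
  exact ⟨R, by rwa [tpc_rfl, Iso.refl_hom, Category.comp_id]⟩

/-- Let `γ` have trivial cabling modulo `R`. By naturality, acting by `γ` after inserting `g` is the
same as acting before by a braid in the kernel of `R`, which `f` absorbs. -/
theorem insert {i m r : ℕ} {f : Z ⟶ tp A (i + m + r)} {R : FinQuot (i + m + r)}
    (hf : FixedBy f R) (g : tp A m ⟶ A) :
    FixedBy (f ≫ tpInsert i m r g) (outerQuot i m r R) := by
  intro γ hγ
  have hN : (i + m + r) + 1 = (i + 1 + r) + m := by omega
  have h1 := cable_insPos hN g γ (⟨i, by omega⟩, 1)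
  have h2 := cable_map hN (QuotientGroup.mk' R.toSubgroup) γ (⟨i, by omega⟩, 1)
  rw [cable_eq_one_of_mem i m r R hγ, Equiv.Perm.one_apply, map_one] at h2
  generalize cable hN (MonoidHom.id _) γ (⟨i, by omega⟩, 1) = x at h1 h2
  obtain ⟨j, h⟩ := x
  obtain ⟨rfl, h3⟩ := Prod.mk.inj h2
  have h4 : h ∈ R.toSubgroup := (QuotientGroup.eq_one_iff h).1 h3.symm
  rw [braidAction_one, Category.id_comp] at h1
  rw [← insPos_self i m r hN (by omega), Category.assoc, ← h1, ← Category.assoc, hf h h4]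

theorem end_eq {i m r : ℕ} {f : Z ⟶ tp A (i + m + r)} {R : FinQuot (i + m + r)}
    (hf : FixedBy f R) {g : B m} (hg : g ∈ (innerQuot i m r R).toSubgroup) :
    f ≫ tpEnd i m r (braidAction A m g).hom = f := by
  rw [← braidAction_shift A i m r (by omega)]
  exact hf _ (shift_mem_of_mem i m r R hg ⟨i, by omega⟩)

end FixedBy

end Fixed

/-! ### Linearity of padding and insertion -/

section Linear

variable (k : Type*) [Field k] {C : Type u} [Category.{v} C] [Preadditive C] [Linear k C]
  [MonoidalCategory C] {A : C} [MonoidalPreadditive C] [MonoidalLinear k C]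

/-- The linear dependence of `pad` on the morphism. -/
noncomputable def padₗ (a b r : ℕ) : (tp A a ⟶ tp A b) →ₗ[k] (tp A (a + r) ⟶ tp A (b + r)) where
  toFun f := pad f r
  map_add' f g := by
    induction r with
    | zero => rfl
    | succ r ih => exact (congrArg (· ▷ A) ih).trans (MonoidalPreadditive.add_whiskerRight ..)
  map_smul' s f := by
    induction r with
    | zero => rfl
    | succ r ih => exact (congrArg (· ▷ A) ih).trans (MonoidalLinear.smul_whiskerRight ..)

/-- The linear dependence of `tpInsert` on the morphism. -/
noncomputable def tpInsertₗ (i n r : ℕ) : (tp A n ⟶ A) →ₗ[k] (tp A (i + n + r) ⟶ tp A (i + 1 + r)) where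
  toFun g := tpInsert i n r g
  map_add' f g := by
    simp only [tpInsert_eq, MonoidalPreadditive.whiskerLeft_add, Preadditive.comp_add]
    exact map_add (padₗ k (A := A) (i + n) (i + 1) r) _ _
  map_smul' s f := by
    simp only [tpInsert_eq, MonoidalLinear.whiskerLeft_smul, Linear.comp_smul]
    exact map_smul (padₗ k (A := A) (i + n) (i + 1) r) _ _

/-- The linear dependence of `tpEnd` on the morphism. -/
noncomputable def tpEndₗ (i n r : ℕ) :
    (tp A n ⟶ tp A n) →ₗ[k] (tp A (i + n + r) ⟶ tp A (i + n + r)) where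
  toFun g := tpEnd i n r g
  map_add' f g := by
    simp only [tpEnd, MonoidalPreadditive.whiskerLeft_add, Preadditive.comp_add,
      Preadditive.add_comp]
    exact map_add (padₗ k (A := A) (i + n) (i + n) r) _ _
  map_smul' s f := by
    simp only [tpEnd, MonoidalLinear.whiskerLeft_smul, Linear.comp_smul, Linear.smul_comp]
    exact map_smul (padₗ k (A := A) (i + n) (i + n) r) _ _

end Linear

/-! ### Profinite actions and their restriction to invariants -/

section ProfiniteAction

variable {k : Type*} [Field k] {C : Type u} [Category.{v} C] [Preadditive C] [Linear k C]
  [MonoidalCategory C] [BraidedCategory C] {A : C}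

theorem FixedBy.comp_augSpan {n : ℕ} {Z : C} {f : Z ⟶ tp A n} {R : FinQuot n} (hf : FixedBy f R)
    {h : tp A n ⟶ tp A n} (hh : h ∈ augSpan k R A) : f ≫ h = 0 := by
  induction hh using Submodule.span_induction with
  | mem x hx =>
    obtain ⟨g, hg, X, rfl⟩ := hx
    rw [Preadditive.sub_comp, Preadditive.comp_sub, ← Category.assoc, hf g hg, Category.id_comp,
      sub_self]
  | zero => exact comp_zero
  | add x y _ _ hx hy => rw [Preadditive.comp_add, hx, hy, add_zero]
  | smul s x _ hx => rw [Linear.comp_smul, hx, smul_zero]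

theorem FixedBy.gact_eq_zero {n : ℕ} {Z : C} {f : Z ⟶ tp A n} {R : FinQuot n} (hf : FixedBy f R)
    {x : MonoidAlgebra k (B n)} (hx : toLevel k R x = 0) : f ≫ gact k A n x = 0 :=
  hf.comp_augSpan (gact_mem_augSpan k A hx)

theorem FixedBy.gact_eq {n : ℕ} {Z : C} {f : Z ⟶ tp A n} {R : FinQuot n} (hf : FixedBy f R)
    {x y : MonoidAlgebra k (B n)} (h : toLevel k R x = toLevel k R y) :
    f ≫ gact k A n x = f ≫ gact k A n y := by
  rw [← sub_eq_zero, ← Preadditive.comp_sub, ← map_sub, hf.gact_eq_zero]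
  rw [map_sub, h, sub_self]

/-- This is why `augSpan` is spanned by morphisms of the form `(g - 1) ≫ X` and does not consist of
all morphisms vanishing on invariants. The former property survives `id ⊗ - ⊗ id`, whereas the
tensor product is not assumed to be exact. -/
theorem FixedBy.comp_end_augSpan [MonoidalPreadditive C] [MonoidalLinear k C] {i n r : ℕ} {Z : C}
    {f : Z ⟶ tp A (i + n + r)} {R : FinQuot (i + n + r)} (hf : FixedBy f R)
    {h : tp A n ⟶ tp A n} (hh : h ∈ augSpan k (innerQuot i n r R) A) : f ≫ tpEnd i n r h = 0 := by
  change f ≫ tpEndₗ k i n r h = 0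
  induction hh using Submodule.span_induction with
  | mem x hx =>
    obtain ⟨g, hg, X, rfl⟩ := hx
    rw [Preadditive.sub_comp, map_sub, Category.id_comp, Preadditive.comp_sub, sub_eq_zero]
    change f ≫ tpEnd i n r _ = f ≫ tpEnd i n r _
    rw [tpEnd_comp, ← Category.assoc, hf.end_eq hg]
  | zero => rw [map_zero, comp_zero]
  | add x y _ _ hx hy => rw [map_add, Preadditive.comp_add, hx, hy, add_zero]
  | smul s x _ hx => rw [map_smul, Linear.comp_smul, hx, smul_zero]

variable (k A) in
/-- An action on the tensor powers of `A` of the elements of the braided primitive operad which is,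
on the invariants of each finite quotient `R`, given by the action of the braid groups. -/
structure ProfiniteAction where
  /-- the action -/
  act : ∀ n, (brPrim k).elements n → (tp A n ⟶ tp A n)
  sub_mem : ∀ (n : ℕ) (a : (brPrim k).elements n) (R : FinQuot n) (x : MonoidAlgebra k (B n)),
    toLevel k R x = a.1 R → act n a - gact k A n x ∈ augSpan k R A

theorem ProfiniteAction.comp_act (Θ : ProfiniteAction k A) {n : ℕ} {Z : C} {f : Z ⟶ tp A n}
    {R : FinQuot n} (hf : FixedBy f R) {a : (brPrim k).elements n} {x : MonoidAlgebra k (B n)}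
    (hx : toLevel k R x = a.1 R) : f ≫ Θ.act n a = f ≫ gact k A n x := by
  rw [← sub_eq_zero, ← Preadditive.comp_sub]
  exact hf.comp_augSpan (Θ.sub_mem n a R x hx)

theorem ProfiniteAction.comp_end_act [MonoidalPreadditive C] [MonoidalLinear k C]
    (Θ : ProfiniteAction k A) {i n r : ℕ} {Z : C} {f : Z ⟶ tp A (i + n + r)}
    {R : FinQuot (i + n + r)} (hf : FixedBy f R) {b : (brPrim k).elements n}
    {y : MonoidAlgebra k (B n)} (hy : toLevel k (innerQuot i n r R) y = b.1 (innerQuot i n r R)) :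
    f ≫ tpEnd i n r (Θ.act n b) = f ≫ tpEnd i n r (gact k A n y) := by
  have h := hf.comp_end_augSpan (Θ.sub_mem n b _ y hy)
  change f ≫ tpEndₗ k i n r _ = 0 at h
  rwa [map_sub, Preadditive.comp_sub, sub_eq_zero] at h

end ProfiniteAction

/-! ### The action for a finitely braided object -/

section ProfAct

variable {k : Type*} [Field k] {C : Type u} [Category.{v} C] [Abelian C] [Linear k C]
  [MonoidalCategory C] [BraidedCategory C] {A : C}

/-- The finite quotient through which the action on the tensor power of a finitely braided object
factors. -/
noncomputable def kerQuot (hA : FinitelyBraided A) (n : ℕ) : FinQuot n :=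
  haveI : Finite (braidAction A n).range := hA n
  haveI : (braidAction A n).ker.FiniteIndex := Subgroup.finiteIndex_ker (braidAction A n)
  FiniteIndexNormalSubgroup.ofSubgroup (braidAction A n).ker

theorem fixedBy_kerQuot (hA : FinitelyBraided A) {n : ℕ} {Z : C} (f : Z ⟶ tp A n) :
    FixedBy f (kerQuot hA n) := fun g hg => by
  have h : braidAction A n g = 1 := hg
  rw [h]
  exact Category.comp_id f

theorem profAct_eq (hA : FinitelyBraided A) {n : ℕ} (a : Family k n) :
    profAct hA a = gact k A n (outLift (a (kerQuot hA n))) := by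
  rw [outLift, map_finsuppSum]
  simp only [gact_single]
  rfl

theorem gact_eq_of_toLevel_eq (hA : FinitelyBraided A) {n : ℕ} {x y : MonoidAlgebra k (B n)}
    (h : toLevel k (kerQuot hA n) x = toLevel k (kerQuot hA n) y) :
    gact k A n x = gact k A n y := by
  rw [← Category.id_comp (gact k A n x), (fixedBy_kerQuot hA (𝟙 (tp A n))).gact_eq h,
    Category.id_comp]

/-- The profinite action on the tensor powers of a finitely braided object. -/
noncomputable def profiniteAction (hA : FinitelyBraided A) : ProfiniteAction k A where
  act n a := profAct hA a.1
  sub_mem n a R x hx := by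
    obtain ⟨y, h1, h2⟩ := exists_lift a.2 (kerQuot hA n) R
    rw [profAct_eq, gact_eq_of_toLevel_eq hA ((toLevel_outLift _).trans h1.symm), ← map_sub]
    exact gact_mem_augSpan k A (by rw [map_sub, h2, hx, sub_self])

end ProfAct

/-! ### The diagonal of the tensor algebra -/

section Diagonal

section Aux

variable {C : Type u} [Category.{v} C] [MonoidalCategory C] [BraidedCategory C]

theorem tensorμ_unit_left (X Y V : C) :
    (X ⊗ Y) ◁ (λ_ V).inv ≫ tensorμ X Y (𝟙_ C) V ≫ (ρ_ X).hom ▷ (Y ⊗ V) = (α_ X Y V).hom := by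
  rw [tensorμ, braiding_tensorUnit_right]
  monoidal

theorem tensorμ_unit_right (X Y V : C) :
    (X ⊗ Y) ◁ (ρ_ V).inv ≫ tensorμ X Y V (𝟙_ C) ≫ (X ⊗ V) ◁ (ρ_ Y).hom =
      (α_ X Y V).hom ≫ X ◁ (β_ Y V).hom ≫ (α_ X V Y).inv := by
  simp only [tensorμ, Category.assoc]
  rw [← associator_inv_naturality_right, ← MonoidalCategory.whiskerLeft_comp_assoc X (α_ V Y (𝟙_ C)).hom]
  have e : (α_ V Y (𝟙_ C)).hom ≫ V ◁ (ρ_ Y).hom = (ρ_ (V ⊗ Y)).hom := by simp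
  have e2 : X ◁ (β_ Y V).hom ▷ 𝟙_ C ≫ X ◁ (ρ_ (V ⊗ Y)).hom =
      X ◁ (ρ_ (Y ⊗ V)).hom ≫ X ◁ (β_ Y V).hom := by
    rw [← MonoidalCategory.whiskerLeft_comp, rightUnitor_naturality,
      MonoidalCategory.whiskerLeft_comp]
  rw [e, reassoc_of% e2]
  monoidal

variable {T V : C} [MonObj T]

theorem insR_mul (c : V ⟶ T) : (T ⊗ T) ◁ (c ≫ insR T) ≫ tensorμ T T T T ≫
    (MonObj.mul ⊗ₘ MonObj.mul) = (α_ T T V).hom ≫ T ◁ (T ◁ c ≫ MonObj.mul) := by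
  have e : c ≫ insR T = (λ_ V).inv ≫ (MonObj.one ⊗ₘ c) := by
    rw [insR, leftUnitor_inv_naturality_assoc, MonoidalCategory.tensorHom_def']
  have h := tensorμ_natural_right T T (MonObj.one : 𝟙_ C ⟶ T) c
  rw [e, MonoidalCategory.whiskerLeft_comp, Category.assoc, reassoc_of% h,
    tensorHom_comp_tensorHom, MonObj.mul_one, ← tensorμ_unit_left]
  simp only [Category.assoc]
  rw [MonoidalCategory.tensorHom_def]

/-- In the braided product of `T ⊗ T`, multiplying by `c ⊗ 1` on the right carries `c` past the
second factor. This braiding is the source of the moving strand in the recursion of the shuffle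
elements. -/
theorem insL_mul (c : V ⟶ T) : (T ⊗ T) ◁ (c ≫ insL T) ≫ tensorμ T T T T ≫
    (MonObj.mul ⊗ₘ MonObj.mul) =
      (α_ T T V).hom ≫ T ◁ (β_ T V).hom ≫ (α_ T V T).inv ≫ (T ◁ c ≫ MonObj.mul) ▷ T := by
  have e : c ≫ insL T = (ρ_ V).inv ≫ (c ⊗ₘ MonObj.one) := by
    rw [insL, rightUnitor_inv_naturality_assoc, MonoidalCategory.tensorHom_def]
  have h := tensorμ_natural_right T T c (MonObj.one : 𝟙_ C ⟶ T)
  have h2 := tensorμ_unit_right T T V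
  have h3 : (T ◁ c ≫ MonObj.mul ⊗ₘ (ρ_ T).hom) =
      (T ⊗ V) ◁ (ρ_ T).hom ≫ (T ◁ c ≫ MonObj.mul) ▷ T := by
    rw [MonoidalCategory.tensorHom_def']
  rw [e, MonoidalCategory.whiskerLeft_comp, Category.assoc, reassoc_of% h,
    tensorHom_comp_tensorHom, MonObj.mul_one, h3, ← Category.assoc _ (tensorμ _ _ _ _),
    ← Category.assoc _ ((T ⊗ V) ◁ _), Category.assoc _ (tensorμ _ _ _ _), h2]
  simp only [Category.assoc]

theorem cut_opR_aux {P Q T' V W : C} (a : P ⊗ Q ≅ W) (i : P ⟶ T') (j : Q ⟶ T') (j' : Q ⊗ V ⟶ T')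
    (s : T' ⊗ V ⟶ T') (h : j ▷ V ≫ s = j') :
    (a.inv ≫ (i ⊗ₘ j)) ▷ V ≫ (α_ T' T' V).hom ≫ T' ◁ s =
      (a.inv ▷ V ≫ (α_ P Q V).hom) ≫ (i ⊗ₘ j') := by
  rw [← h, comp_whiskerRight, ← tensorHom_id (i ⊗ₘ j), Category.assoc, Category.assoc,
    associator_naturality_assoc, ← id_tensorHom, tensorHom_comp_tensorHom, Category.comp_id,
    tensorHom_id]

theorem cut_opL_aux {P Q T' V W : C} (a : P ⊗ Q ≅ W) (i : P ⟶ T') (j : Q ⟶ T') (i' : P ⊗ V ⟶ T')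
    (s : T' ⊗ V ⟶ T') (h : i ▷ V ≫ s = i') :
    (a.inv ≫ (i ⊗ₘ j)) ▷ V ≫ (α_ T' T' V).hom ≫ T' ◁ (β_ T' V).hom ≫ (α_ T' V T').inv ≫ s ▷ T' =
      a.inv ▷ V ≫ (α_ P Q V).hom ≫ P ◁ (β_ Q V).hom ≫ (α_ P V Q).inv ≫ (i' ⊗ₘ j) := by
  have hb := BraidedCategory.braiding_naturality_left j V
  have e1 : (i ⊗ₘ j) ▷ V ≫ (α_ T' T' V).hom = (α_ P Q V).hom ≫ (i ⊗ₘ (j ▷ V)) := by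
    rw [← tensorHom_id (i ⊗ₘ j), associator_naturality, tensorHom_id]
  have e2 : (i ⊗ₘ (j ▷ V)) ≫ T' ◁ (β_ T' V).hom = P ◁ (β_ Q V).hom ≫ (i ⊗ₘ (V ◁ j)) := by
    rw [← id_tensorHom T', ← id_tensorHom P, tensorHom_comp_tensorHom, tensorHom_comp_tensorHom, hb,
      Category.comp_id, Category.id_comp]
  have e3 : (i ⊗ₘ (V ◁ j)) ≫ (α_ T' V T').inv = (α_ P V Q).inv ≫ ((i ▷ V) ⊗ₘ j) := by
    rw [← id_tensorHom V j, associator_inv_naturality, tensorHom_id]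
  have e4 : ((i ▷ V) ⊗ₘ j) ≫ s ▷ T' = ((i ▷ V ≫ s) ⊗ₘ j) := by
    rw [MonoidalCategory.tensorHom_def', MonoidalCategory.tensorHom_def', comp_whiskerRight,
      Category.assoc]
  rw [← h, comp_whiskerRight, Category.assoc, reassoc_of% e1, reassoc_of% e2, reassoc_of% e3, e4]

end Aux

variable {k : Type*} [Field k] {C : Type u} [Category.{v} C] [Abelian C] [Linear k C]
  [MonoidalCategory C] [BraidedCategory C] [MonoidalPreadditive C]
  [MonoidalLinear k C] [HasCountableCoproducts C]

/-- The morphism `V^{⊗ n} = V^{⊗ p} ⊗ V^{⊗ (n - p)} ⟶ T(V) ⊗ T(V)`. -/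
noncomputable def cut (V : C) (n p : ℕ) : tp V n ⟶ TA V ⊗ TA V :=
  if h : p ≤ n then (tpc V (show n = p + (n - p) by omega)).hom ≫ (tpAdd V p (n - p)).inv ≫
    (TA.inj V p ⊗ₘ TA.inj V (n - p)) else 0

theorem cut_eq (V : C) {n p q : ℕ} (h : n = p + q) : cut V n p =
    (tpc V h).hom ≫ (tpAdd V p q).inv ≫ (TA.inj V p ⊗ₘ TA.inj V q) := by
  obtain rfl : q = n - p := by omega
  rw [cut, dif_pos (by omega)]

theorem cut_add (V : C) (p q : ℕ) : cut V (p + q) p =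
    (tpAdd V p q).inv ≫ (TA.inj V p ⊗ₘ TA.inj V q) := by
  rw [cut_eq V rfl]
  exact Category.id_comp _

variable [TensorPreservesCountable C]

theorem inj_insL (V : C) (n : ℕ) : TA.inj V n ≫ insL (TA V) = cut V n n := by
  refine Eq.trans ?_ (cut_add V n 0).symm
  change _ ≫ (ρ_ _).inv ≫ TA V ◁ TA.inj V 0 = (ρ_ _).inv ≫ (TA.inj V n ⊗ₘ TA.inj V 0)
  rw [rightUnitor_inv_naturality_assoc, MonoidalCategory.tensorHom_def]

theorem inj_insR (V : C) (n : ℕ) : TA.inj V n ≫ insR (TA V) = cut V n 0 := by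
  have h := tpAdd_zero_left V n
  have h2 : (tpc V (Nat.zero_add n).symm).hom ≫ (tpAdd V 0 n).inv = (λ_ (tp V n)).inv := by
    have h3 : (tpc V (Nat.zero_add n).symm).hom = (tpc V (Nat.zero_add n)).inv := by rw [tpc_inv]
    rw [h3, ← cancel_mono (λ_ (tp V n)).hom, ← h, Category.assoc, Iso.inv_hom_id_assoc,
      Iso.inv_hom_id, h, Iso.inv_hom_id]
  rw [cut_eq V (Nat.zero_add n).symm, reassoc_of% h2]
  change _ ≫ (λ_ _).inv ≫ TA.inj V 0 ▷ TA V = (λ_ _).inv ≫ (TA.inj V 0 ⊗ₘ TA.inj V n)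
  rw [leftUnitor_inv_naturality_assoc, MonoidalCategory.tensorHom_def']

/-- The diagonal is multiplicative and generators are primitive, so `Δ(x v) = Δ(x) (v ⊗ 1 + 1 ⊗ v)`.
-/
theorem inj_succ_comul (V : C) (n : ℕ) : TA.inj V (n + 1) ≫ ComonObj.comul =
    (TA.inj V n ≫ ComonObj.comul) ▷ V ≫
      ((α_ (TA V) (TA V) V).hom ≫ TA V ◁ (β_ (TA V) V).hom ≫ (α_ (TA V) V (TA V)).inv ≫
        TA.snoc V ▷ TA V + (α_ (TA V) (TA V) V).hom ≫ TA V ◁ TA.snoc V) := by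
  have h1 : TA.incl V ≫ ComonObj.comul = TA.incl V ≫ (insL (TA V) + insR (TA V)) :=
    TA.incl_comul V
  have h2 : TA.snoc V = TA V ◁ TA.incl V ≫ MonObj.mul := TA.snoc_eq V
  have h3 := insL_mul (TA.incl V)
  have h4 := insR_mul (TA.incl V)
  have h5 : TA.snoc V ≫ ComonObj.comul = ComonObj.comul ▷ V ≫ (TA V ⊗ TA V) ◁
      (TA.incl V ≫ (insL (TA V) + insR (TA V))) ≫ tensorμ _ _ _ _ ≫ (MonObj.mul ⊗ₘ MonObj.mul) := by
    rw [h2, Category.assoc, BimonObj.mul_comul, ← h1, MonoidalCategory.tensorHom_def,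
      Category.assoc, whisker_exchange_assoc, MonoidalCategory.whiskerLeft_comp, Category.assoc]
  rw [← TA.inj_snoc, Category.assoc, h5, comp_whiskerRight, Category.assoc, Preadditive.comp_add,
    MonoidalPreadditive.whiskerLeft_add, Preadditive.add_comp, h3, h4, ← h2]

theorem gact_sh_whisker (V : C) (n m p : ℕ) (h : m ≤ n) :
    gact k V (n + 1) (sh k (n + 1) 0 m p) = gact k V n (sh k n 0 m p) ▷ V := by
  induction m generalizing p with
  | zero => cases p with
    | zero => rw [sh_zero, sh_zero, gact_one, gact_one, id_whiskerRight]
    | succ p =>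
      rw [sh_of_lt _ _ _ _ _ (by omega), sh_of_lt _ _ _ _ _ (by omega), map_zero, map_zero,
        MonoidalPreadditive.zero_whiskerRight]
  | succ m ih => cases p with
    | zero => rw [sh_zero, sh_zero, gact_one, gact_one, id_whiskerRight]
    | succ p =>
      rw [sh_succ_succ, sh_succ_succ, map_add, map_add, gact_mul, gact_mul, gact_of, gact_of,
        ih _ (by omega), ih _ (by omega), MonoidalPreadditive.add_whiskerRight, comp_whiskerRight,
        braidAction_up_whisker _ _ _ _ (by omega)]

theorem cut_opR (V : C) (p q : ℕ) : cut V (p + q) p ▷ V ≫ (α_ (TA V) (TA V) V).hom ≫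
    TA V ◁ TA.snoc V = cut V (p + q + 1) p := by
  rw [cut_add]
  refine (cut_opR_aux (tpAdd V p q) _ _ _ _ (TA.inj_snoc V q)).trans ?_
  exact (cut_add V p (q + 1)).symm

/-- To join the left part, the new generator crosses the `q` factors of the right part. By
`braidAction_up` this is the action of the braid `up`. -/
theorem cut_opL (V : C) (p q : ℕ) : cut V (p + q) p ▷ V ≫ (α_ (TA V) (TA V) V).hom ≫
    TA V ◁ (β_ (TA V) V).hom ≫ (α_ (TA V) V (TA V)).inv ≫ TA.snoc V ▷ TA V =
      (braidAction V (p + q + 1) (up (p + q + 1) p q)).hom ≫ cut V (p + q + 1) (p + 1) := by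
  rw [cut_add]
  refine (cut_opL_aux (tpAdd V p q) _ _ _ _ (TA.inj_snoc V p)).trans ?_
  rw [braidAction_up V p q (by omega), cut_eq V (show p + q + 1 = p + 1 + q by omega)]
  simp only [Category.assoc]
  rw [← Category.assoc (tpc V _).hom (tpc V _).hom, tpc_trans, tpc_rfl]
  change _ = _ ≫ _ ≫ _ ≫ _ ≫ _ ≫ 𝟙 _ ≫ _
  rw [Category.id_comp, Iso.hom_inv_id_assoc]

/-- The diagonal of the tensor algebra is given by the shuffle elements. -/
theorem inj_comul (V : C) (n : ℕ) : TA.inj V n ≫ ComonObj.comul =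
    ∑ p ∈ Finset.range (n + 1), gact k V n (sh k n 0 n p) ≫ cut V n p := by
  induction n with
  | zero =>
    rw [Finset.sum_range_one, sh_zero, gact_one, Category.id_comp, ← inj_insL]
    refine (TA.one_comul V).trans ?_
    change _ = TA.inj V 0 ≫ (ρ_ _).inv ≫ TA V ◁ TA.inj V 0
    rw [rightUnitor_inv_naturality_assoc, unitors_inv_equal, MonoidalCategory.tensorHom_def]
    rfl
  | succ n ih =>
    -- These are the terms in which the new factor stays on the right. The term `p = n + 1` missing
    -- on the right-hand side is zero, as there are only `n` old strands.
    have hg : ∑ p ∈ Finset.range (n + 1), gact k V (n + 1) (sh k (n + 1) 0 n (p + 1)) ≫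
        cut V (n + 1) (p + 1) + gact k V (n + 1) (sh k (n + 1) 0 n 0) ≫ cut V (n + 1) 0 =
        ∑ p ∈ Finset.range (n + 1), gact k V (n + 1) (sh k (n + 1) 0 n p) ≫ cut V (n + 1) p := by
      rw [← Finset.sum_range_succ' (fun p => gact k V (n + 1) (sh k (n + 1) 0 n p) ≫
        cut V (n + 1) p), Finset.sum_range_succ, sh_of_lt _ _ _ _ _ (by omega), map_zero, zero_comp,
        add_zero]
    have hc : ∀ p ∈ Finset.range (n + 1), (gact k V n (sh k n 0 n p) ≫ cut V n p) ▷ V ≫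
        ((α_ (TA V) (TA V) V).hom ≫ TA V ◁ (β_ (TA V) V).hom ≫ (α_ (TA V) V (TA V)).inv ≫
        TA.snoc V ▷ TA V + (α_ (TA V) (TA V) V).hom ≫ TA V ◁ TA.snoc V) =
        gact k V (n + 1) (MonoidAlgebra.of k _ (up (n + 1) p (n - p)) * sh k (n + 1) 0 n p) ≫
          cut V (n + 1) (p + 1) + gact k V (n + 1) (sh k (n + 1) 0 n p) ≫ cut V (n + 1) p := by
      intro p hp
      obtain ⟨q, rfl⟩ : ∃ q, n = p + q := ⟨n - p, by rw [Finset.mem_range] at hp; omega⟩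
      rw [comp_whiskerRight, Category.assoc, Preadditive.comp_add, cut_opR, cut_opL,
        ← gact_sh_whisker V (p + q) (p + q) p le_rfl, gact_mul, gact_of, Preadditive.comp_add,
        Category.assoc, Nat.add_sub_cancel_left]
    rw [inj_succ_comul, ih, sum_whiskerRight, Preadditive.sum_comp,
      Finset.sum_congr rfl hc, Finset.sum_add_distrib, ← hg, Finset.sum_range_succ' _ (n + 1),
      sh_zero, sh_zero, ← add_assoc, ← Finset.sum_add_distrib]
    congr 1
    refine Finset.sum_congr rfl fun p _ => ?_
    rw [sh_succ_succ, map_add, Preadditive.add_comp, add_comm]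
    simp only [Nat.zero_add]

end Diagonal

/-! ### The operations on the primitives of a bialgebra -/

section Cabling

variable {C : Type u} [Category.{v} C] [MonoidalCategory C] [BraidedCategory C] {A : C} [MonObj A]

theorem shift_insPos_foldMul {N M n : ℕ} (hN : N + 1 = M + n) (j : ℕ) (hj : j < M) (h : j + n ≤ N)
    (ρ : B n) : (braidAction A N (shift n N j h ρ)).hom ≫ foldMul (𝟙 A) N =
      insPos hN j hj ((braidAction A n ρ).hom ≫ foldMul (𝟙 A) n) ≫ foldMul (𝟙 A) M := by
  obtain ⟨r, rfl⟩ : ∃ r, M = j + 1 + r := ⟨M - 1 - j, by omega⟩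
  obtain rfl : N = j + n + r := by omega
  rw [insPos_self, braidAction_shift, ← tpEnd_insert, Category.assoc, tpInsert_foldMul]

/-- The braid `ρ` inside the cable is absorbed in the inserted operation by associativity, and the
cabled strand of `γ` is moved across it by `cable_insPos`. -/
theorem cabling_foldMul (i n r : ℕ) (γ : B (i + 1 + r)) (ρ : B n) :
    (braidAction A _ (cabling i r γ ρ)).hom ≫ foldMul (𝟙 A) (i + n + r) =
      tpInsert i n r ((braidAction A n ρ).hom ≫ foldMul (𝟙 A) n) ≫
        (braidAction A _ γ).hom ≫ foldMul (𝟙 A) (i + 1 + r) := by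
  have hN : (i + n + r) + 1 = (i + 1 + r) + n := by omega
  have h := cable_insPos hN ((braidAction A n ρ).hom ≫ foldMul (𝟙 A) n) γ (⟨i, by omega⟩, 1)
  rw [braidAction_one, Category.id_comp, insPos_self] at h
  rw [cabling, braidAction_mul, Category.assoc,
    shift_insPos_foldMul hN _ (cable hN (MonoidHom.id _) γ (⟨i, by omega⟩, 1)).1.2, ← Category.assoc,
    h, Category.assoc]

end Cabling

/-! ### Composition of group ring elements followed by multiplication -/

section Composition

variable {k : Type*} [Field k] {C : Type u} [Category.{v} C] [Preadditive C] [Linear k C]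
  [MonoidalCategory C] [BraidedCategory C] [MonoidalPreadditive C] [MonoidalLinear k C]

/-- The lift to `k[B (i + n + r)]` of the composition of elements of the group rings. -/
noncomputable def compLift (i n r : ℕ) {P : FinQuot (i + 1 + r)} {Q : FinQuot n}
    (x : GroupRing k P) (y : GroupRing k Q) : MonoidAlgebra k (B (i + n + r)) :=
  x.coeff.sum fun g s => y.coeff.sum fun h t =>
    MonoidAlgebra.single (cabling i r g.out h.out) (s * t)

theorem toLevel_compLift (i n r : ℕ) (R : FinQuot (i + n + r)) (a : Family k (i + 1 + r))
    (b : Family k n) : toLevel k R (compLift i n r (a (outerQuot i n r R))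
      (b (innerQuot i n r R))) = operadComp i n r a b R := by
  rw [compLift, operadComp, map_finsuppSum]
  refine Finsupp.sum_congr fun g _ => ?_
  rw [map_finsuppSum]
  refine Finsupp.sum_congr fun h _ => ?_
  rw [braidClass, ← map_smul, MonoidAlgebra.smul_single, smul_eq_mul, mul_one]

theorem gact_compLift_foldMul {A : C} [MonObj A] (i n r : ℕ) {P : FinQuot (i + 1 + r)}
    {Q : FinQuot n} (x : GroupRing k P) (y : GroupRing k Q) :
    gact k A _ (compLift i n r x y) ≫ foldMul (𝟙 A) (i + n + r) =
      tpInsert i n r (gact k A n (outLift y) ≫ foldMul (𝟙 A) n) ≫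
        gact k A _ (outLift x) ≫ foldMul (𝟙 A) (i + 1 + r) := by
  have e : tpInsert i n r (gact k A n (outLift y) ≫ foldMul (𝟙 A) n) =
      y.coeff.sum fun h t =>
        t • tpInsert i n r ((braidAction A n h.out).hom ≫ foldMul (𝟙 A) n) := by
    change ((tpInsertₗ k i n r).comp ((Linear.rightComp k _ (foldMul (𝟙 A) n)).comp
      (gact k A n))) (outLift y) = _
    rw [outLift, map_finsuppSum]
    refine Finsupp.sum_congr fun h _ => ?_
    change tpInsertₗ k i n r (gact k A n _ ≫ _) = _
    rw [gact_single, Linear.smul_comp, map_smul]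
    rfl
  have e2 : gact k A _ (outLift x) ≫ foldMul (𝟙 A) (i + 1 + r) =
      x.coeff.sum fun g s => s • ((braidAction A _ g.out).hom ≫ foldMul (𝟙 A) (i + 1 + r)) := by
    rw [outLift, map_finsuppSum, Finsupp.sum, Finsupp.sum, Preadditive.sum_comp]
    refine Finset.sum_congr rfl fun g _ => ?_
    rw [gact_single, Linear.smul_comp]
  rw [e, e2, compLift]
  simp only [Finsupp.sum, map_sum, Preadditive.sum_comp, Preadditive.comp_sum]
  refine Finset.sum_congr rfl fun g _ => Finset.sum_congr rfl fun h _ => ?_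
  rw [gact_single, Linear.smul_comp, cabling_foldMul, Linear.smul_comp, Linear.comp_smul, smul_smul,
    mul_comm]

theorem FixedBy.braid {A Z : C} {n : ℕ} {f : Z ⟶ tp A n} {R : FinQuot n} (hf : FixedBy f R)
    (g : B n) : FixedBy (f ≫ (braidAction A n g).hom) R := fun h hh => by
  have h1 : h * g = g * (g⁻¹ * h * g) := by group
  have h2 : g⁻¹ * h * g ∈ R.toSubgroup := by
    simpa using (inferInstance : R.toSubgroup.Normal).conj_mem h hh g⁻¹
  rw [Category.assoc, ← braidAction_mul, h1, braidAction_mul, ← Category.assoc, hf _ h2]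

end Composition

/-! ### Algebra structure on the primitives of a bialgebra -/

section Primitive

variable {k : Type*} [Field k] {C : Type u} [Category.{v} C] [Abelian C] [Linear k C]
  [MonoidalCategory C] [BraidedCategory C] [MonoidalPreadditive C] [MonoidalLinear k C]

/-- The morphisms `u : Y ⟶ P^{⊗ n}` whose composition with `ι^{⊗ n}` has values in the invariants
of some finite quotient are jointly epimorphic. -/
def EnoughFixed {P A : C} (ι : P ⟶ A) : Prop :=
  ∀ (n : ℕ) (Z : C) (f g : tp P n ⟶ Z), (∀ (Y : C) (u : Y ⟶ tp P n) (R : FinQuot n),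
    FixedBy (u ≫ tpMap ι n) R → u ≫ f = u ≫ g) → f = g

theorem enoughFixed_of_finitelyBraided {P A : C} (ι : P ⟶ A) (hA : FinitelyBraided A) :
    EnoughFixed ι := fun n Z f g h => by
  have := h _ (𝟙 _) _ (fixedBy_kerQuot hA (𝟙 _ ≫ tpMap ι n))
  rwa [Category.id_comp, Category.id_comp] at this

/-- The operation on the primitives of a bialgebra, with values in the bialgebra. -/
noncomputable def primVal {A : C} [BimonObj A] (Θ : ProfiniteAction k A) (n : ℕ)
    (a : (brPrim k).elements n) : tp (primitives A) n ⟶ A :=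
  tpMap (primι A) n ≫ Θ.act n a ≫ foldMul (𝟙 A) n

theorem comp_primVal {A : C} [BimonObj A] (Θ : ProfiniteAction k A) {n : ℕ} {Y : C}
    {u : Y ⟶ tp (primitives A) n} {R : FinQuot n} (hu : FixedBy (u ≫ tpMap (primι A) n) R)
    {a : (brPrim k).elements n} {x : MonoidAlgebra k (B n)} (hx : toLevel k R x = a.1 R) :
    u ≫ primVal Θ n a = u ≫ gact k (primitives A) n x ≫ foldMul (primι A) n := by
  have h := Θ.comp_act hu hx
  rw [primVal, ← Category.assoc, ← Category.assoc, h, Category.assoc, Category.assoc,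
    ← Category.assoc (tpMap _ _), gact_naturality, Category.assoc, tpMap_foldMul, Category.comp_id]

section Coproducts

variable [HasCountableCoproducts C] [TensorPreservesCountable C]

/-- Transfers the cut from the tensor powers of `V` to those of `A`, where the values are known to
be invariant under a finite-index subgroup. -/
theorem cut_lift {V A : C} [MonObj A] (f : V ⟶ A) (n p : ℕ) :
    cut V n p ≫ (TA.lift f ⊗ₘ TA.lift f) =
      tpMap f n ≫ cut A n p ≫ (TA.lift (𝟙 A) ⊗ₘ TA.lift (𝟙 A)) := by
  by_cases h : p ≤ n
  · obtain ⟨q, rfl⟩ := Nat.exists_eq_add_of_le h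
    have h1 : tpMap f (p + q) ≫ (tpAdd A p q).inv = (tpAdd V p q).inv ≫ (tpMap f p ⊗ₘ tpMap f q) := by
      rw [Iso.comp_inv_eq, Category.assoc, tpAdd_naturality, Iso.inv_hom_id_assoc]
    rw [cut_add, cut_add, Category.assoc, Category.assoc, reassoc_of% h1]
    simp only [tensorHom_comp_tensorHom, TA.inj_lift, tpMap_foldMul, Category.comp_id]
  · rw [cut, dif_neg h, cut, dif_neg h, zero_comp, zero_comp, comp_zero]

/-- A product of `n` primitives is the image of the universal one under the morphism of bialgebras
`T(V) ⟶ A`, so the shuffle formula applies. -/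
theorem foldMul_comul {V A : C} [BimonObj A] (f : V ⟶ A)
    (hf : f ≫ ComonObj.comul = f ≫ (insL A + insR A)) (n : ℕ) :
    foldMul f n ≫ ComonObj.comul = ∑ p ∈ Finset.range (n + 1),
      gact k V n (sh k n 0 n p) ≫ cut V n p ≫ (TA.lift f ⊗ₘ TA.lift f) := by
  rw [← TA.inj_lift, Category.assoc, TA.lift_comul f hf, ← Category.assoc, inj_comul (k := k),
    Preadditive.sum_comp]
  simp only [Category.assoc]

theorem foldMul_insL {V A : C} [MonObj A] (f : V ⟶ A) (n : ℕ) :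
    foldMul f n ≫ insL A = cut V n n ≫ (TA.lift f ⊗ₘ TA.lift f) := by
  rw [← inj_insL, Category.assoc, insL_map, ← Category.assoc, TA.inj_lift]

theorem foldMul_insR {V A : C} [MonObj A] (f : V ⟶ A) (n : ℕ) :
    foldMul f n ≫ insR A = cut V n 0 ≫ (TA.lift f ⊗ₘ TA.lift f) := by
  rw [← inj_insR, Category.assoc, insR_map, ← Category.assoc, TA.inj_lift]

/-- In the diagonal of the product, the terms with `0 < p < n` contain `S_p x`. This vanishes at the
level `R` because `a` belongs to the operad, and only `x ⊗ 1` and `1 ⊗ x` remain. -/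
theorem primVal_comul {A : C} [BimonObj A] (Θ : ProfiniteAction k A)
    (hA : EnoughFixed (primι A)) (n : ℕ) (a : (brPrim k).elements n) :
    primVal Θ n a ≫ ComonObj.comul = primVal Θ n a ≫ (insL A + insR A) := by
  refine hA n _ _ _ fun Y u R hu => ?_
  obtain ⟨x, hx, -⟩ := exists_lift a.2 R R
  obtain ⟨h0, h1⟩ := (mem_brPrimLevel R _).1 (a.2.1 R)
  rw [← Category.assoc, ← Category.assoc, comp_primVal Θ hu hx]
  obtain _ | n := n
  -- In arity `0` the two outer terms of the diagonal coincide, so the general count fails; but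
  -- there `a = 0`.
  · have h2 : u ≫ gact k _ 0 x ≫ foldMul (primι A) 0 = 0 := by
      rw [← comp_primVal Θ hu hx, comp_primVal Θ hu (x := 0) (by rw [map_zero, h0 rfl]), map_zero,
        zero_comp, comp_zero]
    rw [h2, zero_comp, zero_comp]
  · simp only [Category.assoc]
    have e : foldMul (primι A) (n + 1) ≫ (insL A + insR A) = foldMul (primι A) (n + 1) ≫ insL A +
      foldMul (primι A) (n + 1) ≫ insR A := Preadditive.comp_add ..
    rw [foldMul_comul (k := k) _ (primι_comul A), e, foldMul_insL, foldMul_insR, Finset.sum_range_succ, Finset.sum_range_succ', sh_self, sh_zero, gact_one,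
      Category.id_comp, Category.id_comp]
    simp only [Preadditive.comp_add]
    rw [Preadditive.comp_sum, Preadditive.comp_sum, Finset.sum_eq_zero, zero_add, add_comm]
    intro p hp
    rw [Finset.mem_range] at hp
    have h2 : toLevel k R (sh k (n + 1) 0 (n + 1) (p + 1) * x) = 0 := by
      rw [map_mul, hx, h1 _ (by omega) (by omega)]
    have h3 := hu.gact_eq_zero h2
    rw [Category.assoc, gact_naturality, gact_mul, Category.assoc] at h3
    rw [cut_lift, reassoc_of% h3, zero_comp]

/-- The operations on the primitives of a bialgebra. -/
noncomputable def primOp {A : C} [BimonObj A] (Θ : ProfiniteAction k A)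
    (hA : EnoughFixed (primι A)) (n : ℕ) :
    (brPrim k).elements n →ₗ[k] (tp (primitives A) n ⟶ primitives A) where
  toFun a := primLift (primVal Θ n a) (primVal_comul Θ hA n a)
  map_add' a b := by
    rw [← cancel_mono (primι A), Preadditive.add_comp, primLift_ι _ (primVal_comul Θ hA n _),
      primLift_ι _ (primVal_comul Θ hA n _), primLift_ι _ (primVal_comul Θ hA n _)]
    refine hA n _ _ _ fun Y u R hu => ?_
    obtain ⟨x, hx, -⟩ := exists_lift a.2 R R
    obtain ⟨y, hy, -⟩ := exists_lift b.2 R R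
    rw [comp_primVal Θ hu (x := x + y) (by rw [map_add, hx, hy]; rfl), Preadditive.comp_add,
      comp_primVal Θ hu hx, comp_primVal Θ hu hy, map_add, Preadditive.add_comp,
      Preadditive.comp_add]
  map_smul' s a := by
    rw [← cancel_mono (primι A), Linear.smul_comp, primLift_ι _ (primVal_comul Θ hA n _),
      primLift_ι _ (primVal_comul Θ hA n _)]
    refine hA n _ _ _ fun Y u R hu => ?_
    obtain ⟨x, hx, -⟩ := exists_lift a.2 R R
    rw [comp_primVal Θ hu (x := s • x) (by rw [map_smul, hx]; rfl), RingHom.id_apply,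
      Linear.comp_smul, comp_primVal Θ hu hx, map_smul, Linear.smul_comp, Linear.comp_smul]

theorem primOp_ι {A : C} [BimonObj A] (Θ : ProfiniteAction k A) (hA : EnoughFixed (primι A)) (n : ℕ)
    (a : (brPrim k).elements n) : primOp Θ hA n a ≫ primι A =
      tpMap (primι A) n ≫ Θ.act n a ≫ foldMul (𝟙 A) n :=
  primLift_ι _ (primVal_comul Θ hA n a)

/-- The primitives of a bialgebra with a profinite action are an algebra over the braided primitive
operad. -/
noncomputable def primOpAlgebra {A : C} [BimonObj A] (Θ : ProfiniteAction k A)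
    (hA : EnoughFixed (primι A)) :
    OpAlgebra (isSuboperad_brPrim (k := k)) (primitives A) where
  act := primOp Θ hA
  act_one := by
    rw [← cancel_mono (primι A), primOp_ι]
    refine hA 1 _ _ _ fun Y u R hu => ?_
    refine (comp_primVal Θ hu (x := 1) (map_one _)).trans ?_
    rw [gact_one, Category.id_comp]
    congr 1
    change (MonObj.one ⊗ₘ primι A) ≫ MonObj.mul = _
    rw [MonoidalCategory.tensorHom_def', Category.assoc, MonObj.one_mul, leftUnitor_naturality]
  act_braid n a g := by
    rw [← cancel_mono (primι A), Category.assoc, primOp_ι, primOp_ι]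
    refine hA n _ _ _ fun Y u R hu => ?_
    obtain ⟨x, hx, -⟩ := exists_lift a.2 R R
    have h2 : FixedBy ((u ≫ (braidAction _ n g).hom) ≫ tpMap (primι A) n) R := by
      rw [Category.assoc, ← braidAction_naturality, ← Category.assoc]
      exact hu.braid g
    refine (comp_primVal Θ hu (x := x * MonoidAlgebra.of k _ g) ?_).trans ?_
    · rw [map_mul, hx]
      rfl
    · rw [gact_mul, gact_of]
      refine Eq.trans ?_ ((comp_primVal Θ h2 hx).symm.trans (Category.assoc _ _ _))
      simp only [Category.assoc]
  act_comp i n r a b := by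
    rw [← cancel_mono (primι A), Category.assoc, primOp_ι, primOp_ι,
      ← Category.assoc (tpInsert _ _ _ _),
      tpInsert_naturality (primι A) i n r (primOp_ι Θ hA n b), Category.assoc]
    refine hA _ _ _ _ fun Y u R hu => ?_
    -- On invariants of `R`, the inner operation, the outer one and their composite act through
    -- lifts from the levels `innerQuot`, `outerQuot` and `R`. The lifts are chosen so that
    -- `gact_compLift_foldMul` relates them.
    have h1 := Θ.comp_end_act hu (b := b) (toLevel_outLift (b.1 (innerQuot i n r R)))
    have h2 := Θ.comp_act (hu.insert (gact k A n (outLift (b.1 (innerQuot i n r R))) ≫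
      foldMul (𝟙 A) n)) (a := a) (toLevel_outLift (a.1 (outerQuot i n r R)))
    have h3 := Θ.comp_act hu (a := ⟨operadComp i n r a.1 b.1,
      isSuboperad_brPrim.comp_mem i n r a.1 b.1 a.2 b.2⟩) (toLevel_compLift i n r R a.1 b.1)
    have h4 := gact_compLift_foldMul (A := A) i n r (a.1 (outerQuot i n r R))
      (b.1 (innerQuot i n r R))
    rw [← Category.assoc u, ← Category.assoc u]
    generalize u ≫ tpMap (primι A) (i + n + r) = f at h1 h2 h3
    rw [reassoc_of% h3, h4, ← tpEnd_insert, ← tpEnd_insert i n r (Θ.act n b), Category.assoc,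
      Category.assoc, reassoc_of% h1]
    simp only [← tpEnd_insert, Category.assoc] at h2
    rw [reassoc_of% h2]

theorem primOpAlgebra_isContinuous {A : C} [BimonObj A] (hA : FinitelyBraided A) :
    (primOpAlgebra (profiniteAction (k := k) hA)
      (enoughFixed_of_finitelyBraided (primι A) hA)).IsContinuous := fun n => by
  refine ⟨kerQuot hA n, fun a ha => ?_⟩
  have h : profAct hA a.1 = 0 := by
    rw [profAct_eq, ha, outLift, MonoidAlgebra.coeff_zero, Finsupp.sum_zero_index, map_zero]
  rw [← cancel_mono (primι A), zero_comp]
  refine (primOp_ι (profiniteAction hA) (enoughFixed_of_finitelyBraided (primι A) hA) n a).trans ?_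
  change _ ≫ profAct hA a.1 ≫ _ = 0
  rw [h, zero_comp, comp_zero]

end Coproducts

end Primitive

/-! ### The profinite action on the tensor algebra -/

section Kernel

instance (n : ℕ) : Group.FG (B n) :=
  ⟨⟨(Set.finite_range (PresentedGroup.of (rels := {w | BraidRel n w}))).toFinset, by
    rw [Set.Finite.coe_toFinset, PresentedGroup.closure_range_of]⟩⟩

variable (k : Type*) [Field k]

theorem of_sub_one_mem_span {G : Type*} [Group G] {S : Set G} {g : G} (hg : g ∈ Subgroup.closure S) :
    MonoidAlgebra.of k G g - 1 ∈ Submodule.span (MonoidAlgebra k G)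
      ((fun g => MonoidAlgebra.of k G g - 1) '' S) := by
  induction hg using Subgroup.closure_induction with
  | mem x hx => exact Submodule.subset_span ⟨x, hx, rfl⟩
  | one => rw [map_one, sub_self]; exact Submodule.zero_mem _
  | mul x y _ _ hx hy =>
    have e : MonoidAlgebra.of k G (x * y) - 1 =
        MonoidAlgebra.of k G x • (MonoidAlgebra.of k G y - 1) + (MonoidAlgebra.of k G x - 1) := by
      rw [map_mul, smul_eq_mul, mul_sub, mul_one, sub_add_sub_cancel]
    rw [e]
    exact Submodule.add_mem _ (Submodule.smul_mem _ _ hy) hx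
  | inv x _ hx =>
    have e : MonoidAlgebra.of k G x⁻¹ - 1 =
        (-MonoidAlgebra.of k G x⁻¹) • (MonoidAlgebra.of k G x - 1) := by
      rw [smul_eq_mul, neg_mul, mul_sub, ← map_mul, inv_mul_cancel, map_one, mul_one, neg_sub]
    rw [e]
    exact Submodule.smul_mem _ _ hx

variable {k} in
theorem sub_outLift_mem_span {n : ℕ} (R : FinQuot n) {S : Set (B n)}
    (hS : Subgroup.closure S = R.toSubgroup) (x : MonoidAlgebra k (B n)) :
    x - outLift (toLevel k R x) ∈ Submodule.span (MonoidAlgebra k (B n))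
      ((fun g => MonoidAlgebra.of k (B n) g - 1) '' S) := by
  induction x using MonoidAlgebra.induction_linear with
  | zero =>
    rw [map_zero, outLift, MonoidAlgebra.coeff_zero, Finsupp.sum_zero_index, sub_zero]
    exact Submodule.zero_mem _
  | add a b ha hb =>
    have e : outLift (toLevel k R (a + b)) = outLift (toLevel k R a) + outLift (toLevel k R b) := by
      rw [map_add]
      exact Finsupp.sum_add_index' (fun _ => MonoidAlgebra.single_zero _)
        (fun _ _ _ => MonoidAlgebra.single_add _ _ _)
    rw [e, add_sub_add_comm]
    exact Submodule.add_mem _ ha hb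
  | single g s =>
    set g' := Quotient.out (QuotientGroup.mk g : B n ⧸ R.toSubgroup) with hg'
    have e : outLift (toLevel k R (MonoidAlgebra.single g s)) = MonoidAlgebra.single g' s := by
      rw [toLevel_single]
      exact Finsupp.sum_single_index (MonoidAlgebra.single_zero _)
    have e2 : MonoidAlgebra.single g s - MonoidAlgebra.single g' s =
        MonoidAlgebra.single g' s • (MonoidAlgebra.of k (B n) (g'⁻¹ * g) - 1) := by
      rw [smul_eq_mul, mul_sub, MonoidAlgebra.of_apply, MonoidAlgebra.single_mul_single, mul_one,
        mul_one, mul_inv_cancel_left]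
    rw [e, e2]
    refine Submodule.smul_mem _ _ (of_sub_one_mem_span k ?_)
    rw [hS]
    exact out_inv_mul_mem R g

/-- The kernel of the projection to a finite quotient is a finitely generated left ideal. -/
theorem exists_generators {n : ℕ} (R : FinQuot n) : ∃ S : Finset (B n),
    (∀ g ∈ S, g ∈ R.toSubgroup) ∧ ∀ x : MonoidAlgebra k (B n), toLevel k R x = 0 →
      ∃ c : S → MonoidAlgebra k (B n), x = ∑ g : S, c g * (MonoidAlgebra.of k (B n) g.1 - 1) := by
  -- Schreier: a subgroup of finite index in a finitely generated group is finitely generated.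
  have h : Group.FG R.toSubgroup := Subgroup.fg_of_index_ne_zero _
  obtain ⟨S, hS⟩ := (Group.fg_iff_subgroup_fg R.toSubgroup).1 h
  refine ⟨S, fun g hg => hS ▸ Subgroup.subset_closure hg, fun x hx => ?_⟩
  have h2 := sub_outLift_mem_span R hS x
  rw [hx, outLift, MonoidAlgebra.coeff_zero, Finsupp.sum_zero_index, sub_zero,
    Submodule.mem_span_image_finset_iff_exists_fun] at h2
  obtain ⟨c, hc⟩ := h2
  exact ⟨c, hc.symm⟩

end Kernel

/-! ### The summands of the tensor powers of the tensor algebra -/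

section Pieces

/-- The indices of the summands `V^{⊗ t₁} ⊗ ⋯ ⊗ V^{⊗ tₙ}` of `T(V)^{⊗ n}`. -/
def Idx : ℕ → Type
  | 0 => Unit
  | n + 1 => Idx n × ℕ

/-- The total degree of a summand of `T(V)^{⊗ n}`. -/
def Idx.deg : ∀ {n : ℕ}, Idx n → ℕ
  | 0, _ => 0
  | _ + 1, s => Idx.deg s.1 + s.2

theorem Idx.finite_deg_le (n N : ℕ) : {s : Idx n | s.deg ≤ N}.Finite := by
  induction n with
  | zero =>
    have : Finite (Idx 0) := inferInstanceAs (Finite Unit)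
    exact Set.toFinite _
  | succ n ih =>
    refine (ih.prod (Set.finite_Iic N)).subset fun s hs => ?_
    have h : Idx.deg s.1 + s.2 ≤ N := hs
    exact ⟨show Idx.deg s.1 ≤ N by omega, show s.2 ≤ N by omega⟩

variable {C : Type u} [Category.{v} C] [MonoidalCategory C] [HasCountableCoproducts C]

/-- The summands `V^{⊗ t₁} ⊗ ⋯ ⊗ V^{⊗ tₙ}` of `T(V)^{⊗ n}`. -/
def tpPiece (V : C) : ∀ {n : ℕ}, Idx n → C
  | 0, _ => 𝟙_ C
  | _ + 1, s => tpPiece V s.1 ⊗ tp V s.2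

/-- The inclusions of the summands of `T(V)^{⊗ n}`. -/
noncomputable def tpIncl (V : C) : ∀ {n : ℕ} (s : Idx n), tpPiece V s ⟶ tp (TA V) n
  | 0, _ => 𝟙 _
  | _ + 1, s => tpIncl V s.1 ⊗ₘ TA.inj V s.2

variable [TensorPreservesCountable C]

theorem tpIncl_whisker_aux {X T Z P Y : C} (i : X ⟶ T) (j : P ⟶ Z) :
    (i ⊗ₘ j) ▷ Y = (α_ X P Y).hom ≫ i ▷ (P ⊗ Y) ≫ (α_ T P Y).inv ≫ (T ◁ j) ▷ Y := by
  rw [MonoidalCategory.tensorHom_def, comp_whiskerRight]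
  simp

theorem TA.ext_whisker {V X Y Z : C} {f g : (X ⊗ TA V) ⊗ Y ⟶ Z}
    (h : ∀ t, (X ◁ TA.inj V t) ▷ Y ≫ f = (X ◁ TA.inj V t) ▷ Y ≫ g) : f = g :=
  sig_ext (tensorLeft X ⋙ tensorRight Y) (fun n => tp V n) h

theorem TA.exists_desc_whisker {V X Y Z : C} (f : ∀ t, (X ⊗ tp V t) ⊗ Y ⟶ Z) :
    ∃ F : (X ⊗ TA V) ⊗ Y ⟶ Z, ∀ t, (X ◁ TA.inj V t) ▷ Y ≫ F = f t :=
  ⟨sigDesc (tensorLeft X ⋙ tensorRight Y) (fun n => tp V n) f,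
    map_ι_sigDesc (tensorLeft X ⋙ tensorRight Y) (fun n => tp V n) f⟩

/-- The extra factor `Y` makes the induction work: once the last factor `T(V)` has been decomposed,
its summand is reassociated into `Y`. At each stage coproducts have to be preserved in one variable
only. -/
theorem tpIncl_ext_whisker (V : C) {n : ℕ} {Y Z : C} {f g : tp (TA V) n ⊗ Y ⟶ Z}
    (h : ∀ s : Idx n, tpIncl V s ▷ Y ≫ f = tpIncl V s ▷ Y ≫ g) : f = g := by
  induction n generalizing Y with
  | zero =>
    have h1 : tpIncl V (n := 0) () ▷ Y = 𝟙 _ := id_whiskerRight _ _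
    have h2 := h ()
    rw [h1] at h2
    exact (Category.id_comp f).symm.trans (h2.trans (Category.id_comp g))
  | succ n ih =>
    refine TA.ext_whisker fun t => ?_
    rw [← cancel_epi (α_ _ _ _).inv]
    refine ih fun s => ?_
    rw [← cancel_epi (α_ _ _ _).hom]
    have h1 := h (s, t)
    have h2 := tpIncl_whisker_aux (Y := Y) (tpIncl V s) (TA.inj V t)
    change (tpIncl V s ⊗ₘ TA.inj V t) ▷ Y ≫ f = (tpIncl V s ⊗ₘ TA.inj V t) ▷ Y ≫ g at h1
    rw [h2] at h1
    simpa only [Category.assoc] using h1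

theorem exists_desc_whisker (V : C) {n : ℕ} {Y Z : C} (f : ∀ s : Idx n, tpPiece V s ⊗ Y ⟶ Z) :
    ∃ F : tp (TA V) n ⊗ Y ⟶ Z, ∀ s, tpIncl V s ▷ Y ≫ F = f s := by
  induction n generalizing Y with
  | zero =>
    have h1 : tpIncl V (n := 0) () ▷ Y = 𝟙 _ := id_whiskerRight _ _
    exact ⟨f (), fun s => (congrArg (· ≫ f ()) h1).trans (Category.id_comp _)⟩
  | succ n ih =>
    choose G hG using fun t : ℕ => ih (Y := tp V t ⊗ Y) fun s => (α_ _ _ _).inv ≫ f (s, t)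
    obtain ⟨F, hF⟩ := TA.exists_desc_whisker (V := V) fun t => (α_ (tp (TA V) n) (tp V t) Y).hom ≫ G t
    refine ⟨F, fun ⟨s, t⟩ => ?_⟩
    have h2 := tpIncl_whisker_aux (Y := Y) (tpIncl V s) (TA.inj V t)
    change (tpIncl V s ⊗ₘ TA.inj V t) ▷ Y ≫ F = _
    rw [h2, Category.assoc, Category.assoc, Category.assoc, hF, Iso.inv_hom_id_assoc, hG]
    exact Iso.hom_inv_id_assoc _ _

theorem tpIncl_ext (V : C) {n : ℕ} {Z : C} {f g : tp (TA V) n ⟶ Z}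
    (h : ∀ s : Idx n, tpIncl V s ≫ f = tpIncl V s ≫ g) : f = g := by
  rw [← cancel_epi (ρ_ _).hom]
  refine tpIncl_ext_whisker V fun s => ?_
  rw [rightUnitor_naturality_assoc, h, rightUnitor_naturality_assoc]

theorem exists_desc (V : C) {n : ℕ} {Z : C} (f : ∀ s : Idx n, tpPiece V s ⟶ Z) :
    ∃ F : tp (TA V) n ⟶ Z, ∀ s, tpIncl V s ≫ F = f s := by
  obtain ⟨F, hF⟩ := exists_desc_whisker V (Y := 𝟙_ C) fun s => (ρ_ _).hom ≫ f s
  refine ⟨(ρ_ _).inv ≫ F, fun s => ?_⟩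
  rw [rightUnitor_inv_naturality_assoc, hF, Iso.inv_hom_id_assoc]

variable [BraidedCategory C]

theorem tpIncl_braidGen_aux {X T P Q Z : C} (i : X ⟶ T) (a : P ⟶ Z) (b : Q ⟶ Z) :
    ((i ⊗ₘ a) ⊗ₘ b) ≫ (α_ T Z Z).hom ≫ T ◁ (β_ Z Z).hom ≫ (α_ T Z Z).inv =
      ((α_ X P Q).hom ≫ X ◁ (β_ P Q).hom ≫ (α_ X Q P).inv) ≫ ((i ⊗ₘ b) ⊗ₘ a) := by
  have h := BraidedCategory.braiding_naturality a b
  rw [associator_naturality_assoc, Category.assoc, Category.assoc, ← associator_inv_naturality,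
    ← id_tensorHom, ← id_tensorHom, tensorHom_comp_tensorHom_assoc, tensorHom_comp_tensorHom_assoc,
    h, Category.comp_id, Category.id_comp]

/-- A generator exchanges two neighbouring blocks. Braids permute the degrees of the blocks and
preserve only their sum, which is why `gradedAct` depends on the total degree alone. -/
theorem tpIncl_braidGen (V : C) {n : ℕ} (l : ℕ) (h : l + 1 < n) (s : Idx n) :
    ∃ (s' : Idx n) (f : tpPiece V s ⟶ tpPiece V s'), s'.deg = s.deg ∧
      tpIncl V s ≫ (braidGen (TA V) n l).hom = f ≫ tpIncl V s' := by
  induction n with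
  | zero => omega
  | succ n ih =>
    obtain _ | n := n
    · omega
    by_cases hl : l = n
    · subst hl
      obtain ⟨⟨s, t⟩, t'⟩ := s
      refine ⟨((s, t'), t), (α_ _ _ _).hom ≫ tpPiece V s ◁ (β_ _ _).hom ≫ (α_ _ _ _).inv, ?_, ?_⟩
      · change s.deg + t' + t = s.deg + t + t'
        omega
      · rw [braidGen_last]
        exact tpIncl_braidGen_aux _ _ _
    · obtain ⟨s, t⟩ := s
      obtain ⟨s', f, hd, hf⟩ := ih (by omega) s
      refine ⟨(s', t), f ▷ tp V t, congrArg (· + t) hd, ?_⟩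
      rw [braidGen_ne (TA V) n l hl]
      change (tpIncl V s ⊗ₘ TA.inj V t) ≫ _ ▷ TA V = f ▷ tp V t ≫ (tpIncl V s' ⊗ₘ TA.inj V t)
      rw [← tensorHom_id, ← tensorHom_id, tensorHom_comp_tensorHom, tensorHom_comp_tensorHom, hf,
        Category.comp_id, Category.id_comp]

end Pieces

/-! ### Endomorphisms defined degree by degree -/

section Graded

variable {k : Type*} [Field k] {C : Type u} [Category.{v} C] [Preadditive C] [Linear k C]
  [MonoidalCategory C] [BraidedCategory C] [HasCountableCoproducts C]
  [TensorPreservesCountable C]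

variable (k) in
/-- The endomorphism of `T(V)^{⊗ n}` which is given in total degree `N` by the action of `x N`. -/
noncomputable def gradedAct (V : C) (n : ℕ) :
    (ℕ → MonoidAlgebra k (B n)) →ₗ[k] (tp (TA V) n ⟶ tp (TA V) n) where
  toFun x := (exists_desc V fun s => tpIncl V s ≫ gact k (TA V) n (x s.deg)).choose
  map_add' x y := tpIncl_ext V fun s => by
    rw [(exists_desc V _).choose_spec, Preadditive.comp_add, (exists_desc V _).choose_spec,
      (exists_desc V _).choose_spec, ← Preadditive.comp_add, ← map_add, Pi.add_apply]
  map_smul' c x := tpIncl_ext V fun s => by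
    rw [(exists_desc V _).choose_spec, RingHom.id_apply, Linear.comp_smul,
      (exists_desc V _).choose_spec, ← Linear.comp_smul, ← map_smul, Pi.smul_apply]

theorem tpIncl_gradedAct (V : C) {n : ℕ} (x : ℕ → MonoidAlgebra k (B n)) (s : Idx n) :
    tpIncl V s ≫ gradedAct k V n x = tpIncl V s ≫ gact k (TA V) n (x s.deg) :=
  (exists_desc V fun s => tpIncl V s ≫ gact k (TA V) n (x s.deg)).choose_spec s

theorem gradedAct_const (V : C) {n : ℕ} (x : MonoidAlgebra k (B n)) :
    gradedAct k V n (fun _ => x) = gact k (TA V) n x :=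
  tpIncl_ext V fun s => tpIncl_gradedAct V _ s

theorem braid_gradedAct (V : C) {n : ℕ} (g : B n) (x : ℕ → MonoidAlgebra k (B n)) :
    (braidAction (TA V) n g).hom ≫ gradedAct k V n x =
      gradedAct k V n fun N => x N * MonoidAlgebra.of k (B n) g := by
  induction g using braid_induction generalizing x with
  | one => simp only [map_one, mul_one]; exact Category.id_comp _
  | mul a b ha hb =>
    rw [braidAction_mul, Category.assoc, ha, hb]
    simp only [map_mul, mul_assoc]
  | inv a ha =>
    have h := ha fun N => x N * MonoidAlgebra.of k (B n) a⁻¹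
    simp only [mul_assoc, ← map_mul, inv_mul_cancel, map_one, mul_one] at h
    rw [← h, ← Category.assoc, ← braidAction_mul, mul_inv_cancel, braidAction_one, Category.id_comp]
  | gen i hi =>
    refine tpIncl_ext V fun s => ?_
    obtain ⟨s', f, hd, hf⟩ := tpIncl_braidGen V i hi s
    rw [tpIncl_gradedAct, gact_mul, gact_of, braidAction_σ _ _ _ hi, reassoc_of% hf,
      reassoc_of% hf, tpIncl_gradedAct, hd]

/-- There are infinitely many degrees, but `augSpan` allows finite sums only. Each `x N` is a
combination of `g - 1` for the same finitely many `g`, and for each `g` the coefficients of all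
degrees are assembled into one endomorphism. -/
theorem gradedAct_mem_augSpan (V : C) {n : ℕ} {R : FinQuot n} {x : ℕ → MonoidAlgebra k (B n)}
    (hx : ∀ N, toLevel k R (x N) = 0) : gradedAct k V n x ∈ augSpan k R (TA V) := by
  obtain ⟨S, hS, hc⟩ := exists_generators k R
  choose c hc using fun N => hc (x N) (hx N)
  have e : x = ∑ g : S, ((fun N => c N g * MonoidAlgebra.of k (B n) g.1) - fun N => c N g) := by
    funext N
    rw [Finset.sum_apply, hc N]
    refine Finset.sum_congr rfl fun g _ => ?_
    rw [mul_sub, mul_one]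
    rfl
  rw [e, map_sum]
  refine Submodule.sum_mem _ fun g _ => Submodule.subset_span ⟨g.1, hS g.1 g.2,
    gradedAct k V n (fun N => c N g), ?_⟩
  rw [map_sub, ← braid_gradedAct, Preadditive.sub_comp, Category.id_comp]

end Graded

/-! ### The action on the tensor powers of the tensor algebra -/

section TensorAlgebraAction

variable {k : Type*} [Field k] {C : Type u} [Category.{v} C] [Abelian C] [Linear k C]
  [MonoidalCategory C] [BraidedCategory C] [HasCountableCoproducts C]
  [TensorPreservesCountable C] {V : C}

theorem TA.inj_eq_foldMul (V : C) (n : ℕ) :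
    TA.inj V n = tpMap (TA.incl V) n ≫ foldMul (𝟙 (TA V)) n := by
  have h : TA.lift (TA.incl V) = 𝟙 _ := TA.algHom_ext (by rw [TA.incl_lift, Category.comp_id])
  rw [tpMap_foldMul, Category.comp_id, ← TA.inj_lift, h, Category.comp_id]

theorem tpIncl_append_aux {X : C} (T : C) {V : C} (n m t : ℕ) (j : X ⟶ tp T n) (c : V ⟶ T)
    (g : tp T m ⟶ T) (h : n + (m + t) = n + m + t) :
    (α_ X (tp V m) (tp V t)).hom ≫ X ◁ (tpAdd V m t).hom ≫
      ((j ⊗ₘ tpMap c (m + t)) ≫ (tpAdd T n (m + t)).hom) ≫ (tpc T h).hom ≫ tpInsert n m t g =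
    ((j ⊗ₘ (tpMap c m ≫ g)) ⊗ₘ tpMap c t) ≫ (tpAdd T (n + 1) t).hom := by
  have h1 : X ◁ (tpAdd V m t).hom ≫ (j ⊗ₘ tpMap c (m + t)) =
      (j ⊗ₘ (tpMap c m ⊗ₘ tpMap c t)) ≫ tp T n ◁ (tpAdd T m t).hom := by
    rw [← id_tensorHom, ← id_tensorHom, tensorHom_comp_tensorHom, tensorHom_comp_tensorHom,
      tpAdd_naturality, Category.comp_id, Category.id_comp]
  have h2 := tpAdd_assoc T n m t h
  have h3 : ((j ⊗ₘ tpMap c m) ⊗ₘ tpMap c t) ≫ (tp T n ◁ g) ▷ tp T t =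
      ((j ⊗ₘ (tpMap c m ≫ g)) ⊗ₘ tpMap c t) := by
    rw [← tensorHom_id, tensorHom_comp_tensorHom, ← id_tensorHom, tensorHom_comp_tensorHom,
      Category.comp_id, Category.comp_id]
  have h4 : tpInsert n m t g = (tpAdd T (n + m) t).inv ≫ (((tpAdd T n m).inv ≫ tp T n ◁ g) ▷ tp T t) ≫
    (tpAdd T (n + 1) t).hom := rfl
  rw [Category.assoc, reassoc_of% h1, ← associator_naturality_assoc, ← reassoc_of% h2, h4,
    Iso.hom_inv_id_assoc, comp_whiskerRight, Category.assoc, hom_inv_whiskerRight_assoc,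
    reassoc_of% h3]

theorem tpIncl_append_fixed (hV : FinitelyBraided V) {n : ℕ} (s : Idx n) (t : ℕ) :
    ∃ R : FinQuot (n + t), FixedBy ((tpIncl V s ⊗ₘ tpMap (TA.incl V) t) ≫ (tpAdd (TA V) n t).hom)
      R := by
  induction n generalizing t with
  | zero =>
    have h1 := (fixedBy_kerQuot hV (𝟙 (tp V t))).map (TA.incl V)
    obtain ⟨R, hR⟩ := (h1.precomp (λ_ (tp V t)).hom).tpc (Nat.zero_add t).symm
    refine ⟨R, ?_⟩
    have h2 := tpAdd_zero_left (TA V) t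
    have e : (𝟙 (𝟙_ C) ⊗ₘ tpMap (TA.incl V) t) ≫ (tpAdd (TA V) 0 t).hom =
        ((λ_ (tp V t)).hom ≫ 𝟙 _ ≫ tpMap (TA.incl V) t) ≫ (tpc (TA V) (Nat.zero_add t).symm).hom := by
      rw [← cancel_mono (tpc (TA V) (Nat.zero_add t)).hom]
      simp only [Category.assoc]
      rw [h2, tpc_trans, tpc_rfl, Iso.refl_hom, Category.comp_id, Category.id_comp,
        ← leftUnitor_naturality, ← id_tensorHom]
    change FixedBy ((𝟙 (𝟙_ C) ⊗ₘ tpMap (TA.incl V) t) ≫ (tpAdd (TA V) 0 t).hom) R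
    rw [e]
    exact hR
  | succ n ih =>
    obtain ⟨s, m⟩ := s
    obtain ⟨R, hR⟩ := ih s (m + t)
    obtain ⟨R', hR'⟩ := hR.tpc (show n + (m + t) = n + m + t by omega)
    refine ⟨outerQuot n m t R', ?_⟩
    have h := (hR'.insert (foldMul (𝟙 (TA V)) m)).precomp
      ((α_ (tpPiece V s) (tp V m) (tp V t)).hom ≫ tpPiece V s ◁ (tpAdd V m t).hom)
    have e := tpIncl_append_aux (TA V) n m t (tpIncl V s) (TA.incl V) (foldMul (𝟙 (TA V)) m)
      (by omega)
    rw [← TA.inj_eq_foldMul] at e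
    simp only [Category.assoc] at e h
    rw [e] at h
    exact h

theorem tpIncl_fixed (hV : FinitelyBraided V) {n : ℕ} (s : Idx n) :
    ∃ R : FinQuot n, FixedBy (tpIncl V s) R := by
  obtain ⟨R, hR⟩ := tpIncl_append_fixed hV s 0
  refine ⟨R, ?_⟩
  have h := FixedBy.precomp hR (ρ_ (tpPiece V s)).inv
  have e : (ρ_ (tpPiece V s)).inv ≫ (tpIncl V s ⊗ₘ tpMap (TA.incl V) 0) ≫ (tpAdd (TA V) n 0).hom =
      tpIncl V s := by
    change (ρ_ (tpPiece V s)).inv ≫ (tpIncl V s ⊗ₘ 𝟙 _) ≫ (ρ_ _).hom = _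
    rw [tensorHom_id, rightUnitor_naturality, Iso.inv_hom_id_assoc]
  rwa [e] at h

theorem exists_fixing_level (hV : FinitelyBraided V) (n N : ℕ) :
    ∃ R : FinQuot n, ∀ s : Idx n, s.deg ≤ N → FixedBy (tpIncl V s) R := by
  refine Set.Finite.induction_on (motive := fun S _ => ∃ R : FinQuot n, ∀ s ∈ S,
    FixedBy (tpIncl V s) R) _ (Idx.finite_deg_le n N) ⟨Classical.arbitrary _, fun s hs => hs.elim⟩ ?_
  rintro s S - - ⟨R, hR⟩
  obtain ⟨R', hR'⟩ := tpIncl_fixed hV s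
  refine ⟨R ⊓ R', fun t ht => ?_⟩
  obtain rfl | ht := ht
  · exact hR'.mono inf_le_right
  · exact (hR t ht).mono inf_le_left

/-- A finite quotient which fixes the summands of `T(V)^{⊗ n}` of total degree `N`. -/
noncomputable def fixingLevel (hV : FinitelyBraided V) (n N : ℕ) : FinQuot n :=
  (exists_fixing_level hV n N).choose

theorem fixingLevel_spec (hV : FinitelyBraided V) {n : ℕ} (s : Idx n) :
    FixedBy (tpIncl V s) (fixingLevel hV n s.deg) :=
  (exists_fixing_level hV n s.deg).choose_spec s le_rfl

variable (k) in
/-- The profinite action on the tensor powers of the tensor algebra of a finitely braided object. -/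
noncomputable def tensorAlgebraAction (hV : FinitelyBraided V) : ProfiniteAction k (TA V) where
  act n a := gradedAct k V n fun N => outLift (a.1 (fixingLevel hV n N))
  sub_mem n a R x hx := by
    -- The values do not change if finer levels are used. Passing below `R` makes the lifts
    -- comparable with `x` in all degrees.
    have e : gradedAct k V n (fun N => outLift (a.1 (fixingLevel hV n N))) =
        gradedAct k V n (fun N => outLift (a.1 (fixingLevel hV n N ⊓ R))) := by
      refine tpIncl_ext V fun s => ?_
      rw [tpIncl_gradedAct, tpIncl_gradedAct]
      refine (fixingLevel_spec hV s).gact_eq ?_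
      rw [toLevel_outLift, ← levelMap_toLevel k (inf_le_left : fixingLevel hV n s.deg ⊓ R ≤ _),
        toLevel_outLift]
      exact (a.2.2 _ _ _).symm
    rw [e, ← gradedAct_const, ← map_sub]
    refine gradedAct_mem_augSpan V fun N => ?_
    rw [Pi.sub_apply, map_sub, hx, ← levelMap_toLevel k (inf_le_right : fixingLevel hV n N ⊓ R ≤ _),
      toLevel_outLift, a.2.2 _ _ (inf_le_right : fixingLevel hV n N ⊓ R ≤ _), sub_self]

end TensorAlgebraAction

/-! ### The projection of the tensor algebra to its primitives -/

section Projection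

variable {k : Type*} [Field k] {C : Type u} [Category.{v} C] [Abelian C] [Linear k C]
  [MonoidalCategory C] [BraidedCategory C] [MonoidalPreadditive C] [MonoidalLinear k C]
  [HasCountableCoproducts C] [TensorPreservesCountable C] {V : C}

/-- The reduced diagonal of the tensor algebra. -/
theorem inj_comul_sub (k : Type*) [Field k] [Linear k C] [MonoidalLinear k C] (V : C) {n : ℕ}
    (hn : 0 < n) : TA.inj V n ≫ (ComonObj.comul - (insL (TA V) + insR (TA V))) =
      ∑ p ∈ Finset.Ioo 0 n, gact k V n (sh k n 0 n p) ≫ cut V n p := by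
  obtain ⟨n, rfl⟩ : ∃ m, n = m + 1 := ⟨n - 1, by omega⟩
  have e : Finset.range (n + 1 + 1) = insert 0 (insert (n + 1) (Finset.Ioo 0 (n + 1))) := by
    ext p
    simp only [Finset.mem_range, Finset.mem_insert, Finset.mem_Ioo]
    omega
  rw [Preadditive.comp_sub, Preadditive.comp_add, inj_comul (k := k), inj_insL, inj_insR, e,
    Finset.sum_insert (by simp), Finset.sum_insert (by simp), sh_self, sh_zero, gact_one,
    Category.id_comp, Category.id_comp]
  abel

/-- The unit is group-like, so its reduced diagonal is `1 ⊗ 1 - 1 ⊗ 1 - 1 ⊗ 1`. -/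
theorem inj_zero_comul_sub (k : Type*) [Field k] [Linear k C] [MonoidalLinear k C] (V : C) :
    TA.inj V 0 ≫ (ComonObj.comul - (insL (TA V) + insR (TA V))) = -cut V 0 0 := by
  rw [Preadditive.comp_sub, Preadditive.comp_add, inj_comul (k := k), inj_insL, inj_insR,
    Finset.sum_range_one, sh_zero, gact_one, Category.id_comp]
  abel

theorem TA.exists_desc_left {Y Z : C} (f : ∀ n, Y ⊗ tp V n ⟶ Z) :
    ∃ F : Y ⊗ TA V ⟶ Z, ∀ n, Y ◁ TA.inj V n ≫ F = f n :=
  ⟨sigDesc (tensorLeft Y) (fun n => tp V n) f, map_ι_sigDesc (tensorLeft Y) (fun n => tp V n) f⟩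

theorem TA.exists_desc_right {Y Z : C} (f : ∀ n, tp V n ⊗ Y ⟶ Z) :
    ∃ F : TA V ⊗ Y ⟶ Z, ∀ n, TA.inj V n ▷ Y ≫ F = f n :=
  ⟨sigDesc (tensorRight Y) (fun n => tp V n) f, map_ι_sigDesc (tensorRight Y) (fun n => tp V n) f⟩

theorem TA.exists_desc_tensor {Z : C} (f : ∀ p q, tp V p ⊗ tp V q ⟶ Z) :
    ∃ G : TA V ⊗ TA V ⟶ Z, ∀ p q, (TA.inj V p ⊗ₘ TA.inj V q) ≫ G = f p q := by
  choose F hF using fun q => TA.exists_desc_right fun p => f p q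
  obtain ⟨G, hG⟩ := TA.exists_desc_left F
  exact ⟨G, fun p q => by rw [MonoidalCategory.tensorHom_def, Category.assoc, hG, hF]⟩

theorem profAct_comul_sub (hV : FinitelyBraided V) (n : ℕ) (a : (brPrim k).elements n) :
    profAct hV a.1 ≫ TA.inj V n ≫ (ComonObj.comul - (insL (TA V) + insR (TA V))) = 0 := by
  obtain ⟨h0, h1⟩ := (mem_brPrimLevel (kerQuot hV n) _).1 (a.2.1 (kerQuot hV n))
  rw [profAct_eq]
  obtain rfl | hn := Nat.eq_zero_or_pos n
  · rw [h0 rfl, outLift, MonoidAlgebra.coeff_zero, Finsupp.sum_zero_index, map_zero, zero_comp]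
  · rw [inj_comul_sub k V hn, Preadditive.comp_sum]
    refine Finset.sum_eq_zero fun p hp => ?_
    rw [Finset.mem_Ioo] at hp
    rw [← Category.assoc, ← gact_mul, gact_eq_of_toLevel_eq hV (y := 0), map_zero, zero_comp]
    rw [map_mul, toLevel_outLift, h1 p hp.1 hp.2, map_zero]

variable [CharZero k]

variable (k) in
/-- The canonical idempotents, as elements of the braided primitive operad. -/
noncomputable def idemElt (n : ℕ) : (brPrim k).elements n := ⟨idem k n, idem_mem k n⟩

variable (k) in
/-- The projection of the tensor algebra of a finitely braided object to the primitives. -/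
noncomputable def primProj (hV : FinitelyBraided V) : TA V ⟶ TA V :=
  Limits.Sigma.desc fun n => profAct hV (idem k n) ≫ TA.inj V n

variable (k) in
theorem inj_primProj (hV : FinitelyBraided V) (n : ℕ) :
    TA.inj V n ≫ primProj k hV = profAct hV (idem k n) ≫ TA.inj V n :=
  Limits.Sigma.ι_desc _ n

variable (k) in
theorem primProj_comul_sub (hV : FinitelyBraided V) :
    primProj k hV ≫ (ComonObj.comul - (insL (TA V) + insR (TA V))) = 0 :=
  TA.hom_ext fun n => by
    rw [← Category.assoc, inj_primProj, Category.assoc, comp_zero]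
    exact profAct_comul_sub hV n (idemElt k n)

variable (k) in
theorem exists_coeff (hV : FinitelyBraided V) {n : ℕ} (hn : 0 < n) :
    ∃ c : ℕ → MonoidAlgebra k (B n), 𝟙 _ - profAct hV (idem k n) =
      ∑ p ∈ Finset.Ioo 0 n, gact k V n (sh k n 0 n p) ≫ gact k V n (c p) := by
  obtain ⟨c, hc⟩ := one_sub_idem k hn (kerQuot hV n)
  refine ⟨fun p => outLift (c p), ?_⟩
  simp only [← gact_mul]
  rw [profAct_eq, ← gact_one k V n, ← map_sub, ← map_sum]
  refine gact_eq_of_toLevel_eq hV ?_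
  rw [map_sub, map_one, toLevel_outLift, hc, map_sum]
  refine Finset.sum_congr rfl fun p _ => ?_
  rw [map_mul, toLevel_outLift]

variable (k) in
-- Writing `1 - e` as the sum of the `c_p S_p`, it is recovered from the components `S_p x` of the
-- reduced diagonal by letting `c_p` act. So whatever the reduced diagonal kills is fixed by the
-- projection, with no exactness of coproducts involved.
theorem exists_comul_sub_comp (hV : FinitelyBraided V) : ∃ G : TA V ⊗ TA V ⟶ TA V,
    (ComonObj.comul - (insL (TA V) + insR (TA V))) ≫ G = 𝟙 _ - primProj k hV := by
  choose c hc using fun n : ℕ => exists_coeff k hV (Nat.succ_pos n)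
  obtain ⟨G, hG⟩ := TA.exists_desc_tensor (V := V) (Z := TA V) fun p q => (tpAdd V p q).hom ≫
    match p + q with
    -- In degree `0` the projection is zero and the reduced diagonal is `-(1 ⊗ 1)`, whence the sign.
    | 0 => -TA.inj V 0
    | n + 1 => gact k V (n + 1) (c n p) ≫ TA.inj V (n + 1)
  have h : ∀ n p, p < n + 1 → cut V (n + 1) p ≫ G = gact k V (n + 1) (c n p) ≫ TA.inj V (n + 1) := by
    intro n p hp
    obtain ⟨q, hq⟩ := Nat.exists_eq_add_of_lt hp
    have hq' : n + 1 = p + (q + 1) := hq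
    obtain rfl : n = p + q := by omega
    have h2 := cut_add V p (q + 1)
    have h3 := hG p (q + 1)
    change cut V (p + (q + 1)) p ≫ G = _
    rw [h2, Category.assoc, h3, Iso.inv_hom_id_assoc]
    rfl
  have h0 : cut V 0 0 ≫ G = -TA.inj V 0 := by
    have h2 := cut_add V 0 0
    have h3 := hG 0 0
    change cut V (0 + 0) 0 ≫ G = _
    rw [h2, Category.assoc, h3, Iso.inv_hom_id_assoc]
  refine ⟨G, TA.hom_ext fun n => ?_⟩
  rw [Preadditive.comp_sub, Category.comp_id, inj_primProj, ← Category.assoc]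
  obtain _ | n := n
  · rw [inj_zero_comul_sub k, Preadditive.neg_comp, h0, neg_neg, profAct_eq, idem_zero]
    change _ = _ - gact k V 0 (outLift (0 : GroupRing k _)) ≫ _
    rw [outLift, MonoidAlgebra.coeff_zero, Finsupp.sum_zero_index, map_zero, zero_comp, sub_zero]
  · have e := congrArg (· ≫ TA.inj V (n + 1)) (hc n)
    simp only [Preadditive.sub_comp, Category.id_comp] at e
    rw [e, inj_comul_sub k V (Nat.succ_pos n), Preadditive.sum_comp, Preadditive.sum_comp]
    refine Finset.sum_congr rfl fun p hp => ?_
    rw [Finset.mem_Ioo] at hp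
    rw [Category.assoc, Category.assoc, h n p hp.2]

variable (k) in
/-- The retraction of the tensor algebra of a finitely braided object to the primitives. -/
noncomputable def primRetr (hV : FinitelyBraided V) : TA V ⟶ primitives (TA V) :=
  primLift (primProj k hV) (by
    rw [← sub_eq_zero, ← Preadditive.comp_sub, primProj_comul_sub])

variable (k) in
theorem primRetr_ι (hV : FinitelyBraided V) : primRetr k hV ≫ primι (TA V) = primProj k hV :=
  primLift_ι _ _

variable (k) in
theorem primι_retr (hV : FinitelyBraided V) : primι (TA V) ≫ primRetr k hV = 𝟙 _ := by
  obtain ⟨G, hG⟩ := exists_comul_sub_comp k hV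
  have h : primι (TA V) ≫ (ComonObj.comul - (insL (TA V) + insR (TA V))) = 0 :=
    kernel.condition _
  have h2 := congrArg (primι (TA V) ≫ ·) hG
  simp only [reassoc_of% h, zero_comp, Preadditive.comp_sub, Category.comp_id] at h2
  rw [← cancel_mono (primι (TA V)), Category.assoc, primRetr_ι, Category.id_comp]
  exact (sub_eq_zero.1 h2.symm).symm

theorem profAct_inj_primProj (hV : FinitelyBraided V) (n : ℕ) (a : (brPrim k).elements n) :
    profAct hV a.1 ≫ TA.inj V n ≫ primProj k hV = profAct hV a.1 ≫ TA.inj V n := by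
  rw [inj_primProj, ← Category.assoc, profAct_eq, profAct_eq, ← gact_mul]
  congr 1
  refine gact_eq_of_toLevel_eq hV ?_
  rw [map_mul, toLevel_outLift, toLevel_outLift]
  exact idem_mul k (a.2.1 _)

/-- The tensor powers of the primitives are retracts of those of `T(V)`, which are covered by
summands that are fixed at some level. Naturality of the braid action preserves this invariance
under the projection. -/
theorem enoughFixed_tensorAlgebra (k : Type*) [Field k] [CharZero k] [Linear k C]
    [MonoidalLinear k C] (hV : FinitelyBraided V) : EnoughFixed (primι (TA V)) := by
  intro n Z f g h
  have e : tpMap (primι (TA V)) n ≫ tpMap (primRetr k hV) n = 𝟙 _ := by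
    rw [← tpMap_comp, primι_retr, tpMap_id]
  rw [← Category.id_comp f, ← Category.id_comp g, ← e, Category.assoc, Category.assoc]
  congr 1
  refine tpIncl_ext V fun s => ?_
  obtain ⟨R, hR⟩ := tpIncl_fixed hV s
  have h2 := h _ (tpIncl V s ≫ tpMap (primRetr k hV) n) R (by
    rw [Category.assoc, ← tpMap_comp]
    exact hR.map _)
  simpa only [Category.assoc] using h2

variable (k) in
/-- The primitives in the tensor algebra of a finitely braided object are an algebra over the
braided primitive operad. -/
noncomputable def tensorOpAlgebra (hV : FinitelyBraided V) :
    OpAlgebra (isSuboperad_brPrim (k := k)) (primitives (TA V)) :=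
  primOpAlgebra (tensorAlgebraAction k hV) (enoughFixed_tensorAlgebra k hV)

theorem tensorOpAlgebra_ι (hV : FinitelyBraided V) (n : ℕ) (a : (brPrim k).elements n) :
    (tensorOpAlgebra k hV).act n a ≫ primι (TA V) = tpMap (primι (TA V)) n ≫
      (tensorAlgebraAction k hV).act n a ≫ foldMul (𝟙 (TA V)) n :=
  primOp_ι (tensorAlgebraAction k hV) (enoughFixed_tensorAlgebra k hV) n a

theorem unit_tensorOpAlgebra (hV : FinitelyBraided V) (n : ℕ) (a : (brPrim k).elements n) :
    tpMap (primUnit V) n ≫ (tensorOpAlgebra k hV).act n a =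
      profAct hV a.1 ≫ TA.inj V n ≫ primRetr k hV := by
  rw [← cancel_mono (primι (TA V)), Category.assoc, Category.assoc, Category.assoc, primRetr_ι,
    profAct_inj_primProj, tensorOpAlgebra_ι, ← Category.assoc, ← tpMap_comp, primUnit_ι]
  have h1 := (fixedBy_kerQuot hV (𝟙 (tp V n))).map (TA.incl V)
  rw [Category.id_comp] at h1
  rw [← Category.assoc, (tensorAlgebraAction k hV).comp_act h1 (toLevel_outLift _), gact_naturality,
    profAct_eq, Category.assoc, ← TA.inj_eq_foldMul]

end Projection

/-! ### Constant pro-objects -/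

namespace ProObject

variable {C : Type u} [Category.{v} C]

/-- The functor corepresented by a constant pro-object. -/
noncomputable def constι (X : C) : coyoneda.obj (.op X) ⟶ (const X).homFunctor :=
  colimit.ι ((const X).F.op ⋙ coyoneda) (.op PUnit.unit)

instance (X : C) : IsIso (constι X) :=
  isIso_ι_of_isTerminal (IsTerminal.ofUniqueHom (fun _ => 𝟙 _) fun _ _ => rfl)
    ((const X).F.op ⋙ coyoneda)

/-- The coprojections of the functor corepresented by a pro-object. -/
noncomputable def homι (V : ProObject C) (i : V.I) : coyoneda.obj (.op (V.F.obj i)) ⟶ V.homFunctor :=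
  colimit.ι (V.F.op ⋙ coyoneda) (.op i)

theorem map_homι (V : ProObject C) {i j : V.I} (f : i ⟶ j) :
    coyoneda.map (V.F.map f).op ≫ V.homι i = V.homι j :=
  colimit.w (V.F.op ⋙ coyoneda) f.op

theorem homι_ofCone (V : ProObject C) (X : C) (f : ∀ i, X ⟶ V.F.obj i) (hf) (i : V.I) :
    V.homι i ≫ (ofCone V X f hf).nat = coyoneda.map (f i).op ≫ constι X :=
  colimit.ι_desc _ _

theorem homFunctor_ext (V : ProObject C) {T : C ⥤ Type v} {a b : V.homFunctor ⟶ T}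
    (h : ∀ i, V.homι i ≫ a = V.homι i ≫ b) : a = b :=
  colimit.hom_ext fun i => h i.unop

theorem hom_ext {V W : ProObject C} {f g : V ⟶ W} (h : f.nat = g.nat) : f = g :=
  congrArg Hom.mk h

theorem constMap_ofCone (V : ProObject C) {X Y : C} (h : Y ⟶ X) (f : ∀ i, X ⟶ V.F.obj i) (hf)
    (f' : ∀ i, Y ⟶ V.F.obj i) (hf') (e : ∀ i, h ≫ f i = f' i) :
    constMap h ≫ ofCone V X f hf = ofCone V Y f' hf' := by
  refine hom_ext (homFunctor_ext V fun i => ?_)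
  change V.homι i ≫ (ofCone V X f hf).nat ≫ (constMap h).nat = _
  have e2 : constι X ≫ (constMap h).nat = coyoneda.map h.op ≫ constι Y :=
    homι_ofCone (const X) Y _ _ PUnit.unit
  rw [← Category.assoc, homι_ofCone, Category.assoc, e2, homι_ofCone, ← e, op_comp,
    Functor.map_comp, Category.assoc]

theorem constMap_comp {X Y Z : C} (f : X ⟶ Y) (g : Y ⟶ Z) :
    constMap f ≫ constMap g = constMap (f ≫ g) :=
  constMap_ofCone (const Z) f _ _ _ _ fun _ => rfl

theorem constMap_id (X : C) : constMap (𝟙 X) = 𝟙 (const X) := by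
  refine hom_ext (homFunctor_ext (const X) fun i => ?_)
  refine (homι_ofCone (const X) X _ _ PUnit.unit).trans ?_
  change coyoneda.map (𝟙 X).op ≫ constι X = constι X ≫ 𝟙 _
  rw [op_id, CategoryTheory.Functor.map_id, Category.id_comp, Category.comp_id]

theorem constMap_injective {X Y : C} {f g : X ⟶ Y} (h : constMap f = constMap g) : f = g := by
  have e : ∀ f : X ⟶ Y, constι Y ≫ (constMap f).nat = coyoneda.map f.op ≫ constι X :=
    fun f => homι_ofCone (const Y) X _ _ PUnit.unit
  have h2 := e f
  rw [h, e g, cancel_mono] at h2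
  exact (Quiver.Hom.op_inj (coyoneda.map_injective h2)).symm

theorem exists_constMap {X Y : C} (h : const X ⟶ const Y) : ∃ f, constMap f = h := by
  refine ⟨(coyoneda.preimage (constι Y ≫ h.nat ≫ inv (constι X))).unop, ?_⟩
  refine hom_ext (homFunctor_ext (const Y) fun i => ?_)
  refine (homι_ofCone (const Y) X _ _ PUnit.unit).trans ?_
  change coyoneda.map (coyoneda.preimage (constι Y ≫ h.nat ≫ inv (constι X))).unop.op ≫ constι X =
    constι Y ≫ h.nat
  rw [Quiver.Hom.op_unop, Functor.map_preimage, Category.assoc, Category.assoc, IsIso.inv_hom_id,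
    Category.comp_id]

/-- An isomorphism of constant pro-objects comes from an isomorphism of objects. -/
theorem exists_iso {X Y : C} (h : const X ≅ const Y) : ∃ e : X ≅ Y, constMap e.hom = h.hom := by
  obtain ⟨f, hf⟩ := exists_constMap h.hom
  obtain ⟨g, hg⟩ := exists_constMap h.inv
  refine ⟨⟨f, g, constMap_injective ?_, constMap_injective ?_⟩, hf⟩
  · rw [← constMap_comp, hf, hg, h.hom_inv_id, constMap_id]
  · rw [← constMap_comp, hf, hg, h.inv_hom_id, constMap_id]

/-- A criterion for a pro-object to be constant. -/
theorem isIso_ofCone (V : ProObject C) (X : C) (f : ∀ i, X ⟶ V.F.obj i)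
    (hf : ∀ {i j : V.I} (u : i ⟶ j), f i ≫ V.F.map u = f j) (K : V.I) (g : V.F.obj K ⟶ X)
    (hg : f K ≫ g = 𝟙 X) (hepi : ∀ j (_ : j ⟶ K), Epi (f j)) : IsIso (ofCone V X f hf) := by
  let ψ : V ⟶ const X := ⟨inv (constι X) ≫ coyoneda.map g.op ≫ V.homι K⟩
  refine ⟨ψ, hom_ext ?_, hom_ext (homFunctor_ext V fun i => ?_)⟩
  · change (inv (constι X) ≫ coyoneda.map g.op ≫ V.homι K) ≫ (ofCone V X f hf).nat = 𝟙 _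
    rw [Category.assoc, Category.assoc, homι_ofCone, ← Functor.map_comp_assoc, ← op_comp, hg, op_id,
      CategoryTheory.Functor.map_id, Category.id_comp, IsIso.inv_hom_id]
  · change V.homι i ≫ (ofCone V X f hf).nat ≫ inv (constι X) ≫ coyoneda.map g.op ≫ V.homι K =
      V.homι i ≫ 𝟙 _
    rw [← Category.assoc, homι_ofCone, Category.assoc, IsIso.hom_inv_id_assoc, Category.comp_id]
    -- The inverse need only be compared on a common refinement, where `f j` is an epimorphism and
    -- can be cancelled.
    let j := IsCofiltered.min i K
    have h1 := hepi j (IsCofiltered.minToRight i K)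
    have h2 : V.F.map (IsCofiltered.minToRight i K) ≫ g ≫ f i =
        V.F.map (IsCofiltered.minToLeft i K) := by
      rw [← cancel_epi (f j), hf, ← Category.assoc, hf, reassoc_of% hg]
    rw [← V.map_homι (IsCofiltered.minToRight i K), ← V.map_homι (IsCofiltered.minToLeft i K), ← h2,
      op_comp, op_comp, Functor.map_comp, Functor.map_comp]
    simp only [Category.assoc]

end ProObject

/-! ### The Artin functor of a finitely braided object -/

section Artin

attribute [local instance] Abelian.hasFiniteBiproducts

variable {k : Type*} [Field k] {C : Type u} [Category.{v} C] [Abelian C] [Linear k C]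
  [MonoidalCategory C] [BraidedCategory C]

namespace BraidedSubseq

theorem mul_toLevel_mem (O : BraidedSubseq k) {n : ℕ} {Q : FinQuot n} {a : GroupRing k Q}
    (ha : a ∈ O.level Q) (x : MonoidAlgebra k (B n)) : a * toLevel k Q x ∈ O.level Q := by
  induction x using MonoidAlgebra.induction_linear with
  | zero => rw [map_zero, mul_zero]; exact Submodule.zero_mem _
  | add x y hx hy => rw [map_add, mul_add]; exact Submodule.add_mem _ hx hy
  | single g s =>
    have e : (MonoidAlgebra.single g s : MonoidAlgebra k (B n)) = s • MonoidAlgebra.single g 1 := by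
      rw [MonoidAlgebra.smul_single, smul_eq_mul, mul_one]
    rw [e, map_smul, mul_smul_comm]
    exact Submodule.smul_mem _ _ (O.mul_mem Q a g ha)

/-- The relation `a g ⊗ x = a ⊗ g x`, imposed for the generators only, extends to all braids because
both sides are actions. -/
theorem braid_pieceIncl (O : BraidedSubseq k) {n : ℕ} (Q : FinQuot n) (V : C) (g : B n)
    (a : O.level Q) : (braidAction V n g).hom ≫ O.pieceIncl Q V a =
      O.pieceIncl Q V (O.mulRight Q g a) := by
  have h1 : ∀ a, O.mulRight Q 1 a = a := fun a => Subtype.ext (by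
    change a.1 * braidClass k Q 1 = a.1
    rw [braidClass, ← MonoidAlgebra.one_def, map_one, mul_one])
  have h2 : ∀ (g h : B n) a, O.mulRight Q h (O.mulRight Q g a) = O.mulRight Q (g * h) a :=
    fun g h a => Subtype.ext (by
      change a.1 * braidClass k Q g * braidClass k Q h = a.1 * braidClass k Q (g * h)
      rw [mul_assoc, braidClass, braidClass, ← map_mul, MonoidAlgebra.single_mul_single, mul_one,
        braidClass])
  induction g using braid_induction generalizing a with
  | one => rw [braidAction_one, Category.id_comp, h1]
  | mul x y hx hy => rw [braidAction_mul, Category.assoc, hx, hy, h2]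
  | inv x hx =>
    have h := hx (O.mulRight Q x⁻¹ a)
    rw [h2, inv_mul_cancel, h1] at h
    rw [← h, ← Category.assoc, ← braidAction_mul, mul_inv_cancel, braidAction_one,
      Category.id_comp]
  | gen i hi =>
    exact (O.pieceIncl_mulRight Q V ⟨i, by omega⟩ a).symm

theorem gact_pieceIncl (O : BraidedSubseq k) {n : ℕ} (Q : FinQuot n) (V : C)
    (x : MonoidAlgebra k (B n)) (a b : O.level Q) (h : a.1 * toLevel k Q x = b.1) :
    gact k V n x ≫ O.pieceIncl Q V a = O.pieceIncl Q V b := by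
  obtain rfl : ⟨_, O.mul_toLevel_mem a.2 x⟩ = b := Subtype.ext h
  induction x using MonoidAlgebra.induction_linear with
  | zero =>
    have e : (⟨_, O.mul_toLevel_mem a.2 0⟩ : O.level Q) = 0 := Subtype.ext (by
      change a.1 * toLevel k Q 0 = 0
      rw [map_zero, mul_zero])
    rw [e, map_zero, zero_comp]
    exact (map_zero (O.pieceInclₗ Q V)).symm
  | add x y hx hy =>
    have e : (⟨_, O.mul_toLevel_mem a.2 (x + y)⟩ : O.level Q) =
        ⟨_, O.mul_toLevel_mem a.2 x⟩ + ⟨_, O.mul_toLevel_mem a.2 y⟩ := Subtype.ext (by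
      change a.1 * toLevel k Q (x + y) = a.1 * toLevel k Q x + a.1 * toLevel k Q y
      rw [map_add, mul_add])
    rw [e, map_add, Preadditive.add_comp, hx rfl, hy rfl]
    exact (map_add (O.pieceInclₗ Q V) _ _).symm
  | single g s =>
    have e : (⟨_, O.mul_toLevel_mem a.2 (MonoidAlgebra.single g s)⟩ : O.level Q) =
        s • O.mulRight Q g a := Subtype.ext (by
      change a.1 * toLevel k Q (MonoidAlgebra.single g s) = s • (a.1 * braidClass k Q g)
      rw [braidClass, ← mul_smul_comm, ← map_smul, MonoidAlgebra.smul_single, smul_eq_mul, mul_one])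
    rw [e, gact_single, Linear.smul_comp, braid_pieceIncl]
    exact (map_smul (O.pieceInclₗ Q V) _ _).symm

end BraidedSubseq

/-- The linear map `outLift`. -/
noncomputable def outLiftₗ {n : ℕ} (Q : FinQuot n) : GroupRing k Q →ₗ[k] MonoidAlgebra k (B n) where
  toFun := outLift
  map_add' a b := Finsupp.sum_add_index' (fun _ => MonoidAlgebra.single_zero _)
    (fun _ _ _ => MonoidAlgebra.single_add _ _ _)
  map_smul' s a := by
    rw [outLift, outLift, MonoidAlgebra.coeff_smul, Finsupp.sum_smul_index
      (fun _ => MonoidAlgebra.single_zero _), Finsupp.smul_sum]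
    simp only [MonoidAlgebra.smul_single, smul_eq_mul, RingHom.id_apply]

theorem toLevel_outLift_of_le {n : ℕ} {P Q : FinQuot n} (h : P ≤ Q) (a : GroupRing k P) :
    toLevel k Q (outLift a) = levelMap k h a := by
  rw [← levelMap_toLevel k h, toLevel_outLift]

variable [MonoidalPreadditive C] [MonoidalLinear k C]
  [HasCountableCoproducts C] [TensorPreservesCountable C] [CharZero k] {V : C}

variable (k) in
/-- The morphism from the tensor algebra to a level of the Artin functor, given by the canonical
idempotents. -/
noncomputable def idemMap (V : C) (Q : ∀ n, FinQuot n) :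
    TA V ⟶ ∐ fun n => (brPrim k).piece (Q n) V :=
  Limits.Sigma.map fun n =>
    (brPrim k).pieceIncl (Q n) V ((brPrim k).elementsAt (idemElt k n) (Q n))

variable (k) in
/-- The morphism from the primitives of the tensor algebra to a level of the Artin functor, given
by the canonical idempotents. -/
noncomputable def artinCone (V : C) (Q : ∀ n, FinQuot n) :
    primitives (TA V) ⟶ (∐ fun n => (brPrim k).piece (Q n) V) :=
  primι (TA V) ≫ idemMap k V Q

theorem inj_idemMap (V : C) (Q : ∀ n, FinQuot n) (n : ℕ) :
    TA.inj V n ≫ idemMap k V Q =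
    (brPrim k).pieceIncl (Q n) V ((brPrim k).elementsAt (idemElt k n) (Q n)) ≫
      Limits.Sigma.ι (fun n => (brPrim k).piece (Q n) V) n :=
  Limits.Sigma.ι_map _ _

theorem artinCone_map (V : C) {P Q : Levels} (h : P ⟶ Q) :
    artinCone k V P ≫ Limits.Sigma.map (fun n => (brPrim k).pieceMap (leOfHom h n) V) =
      artinCone k V Q := by
  refine (Category.assoc _ _ _).trans (congrArg (primι (TA V) ≫ ·) ?_)
  refine TA.hom_ext fun n => ?_
  have h1 := inj_idemMap (k := k) V P n
  have h2 := inj_idemMap (k := k) V Q n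
  refine (Category.assoc _ _ _).symm.trans (Eq.trans ?_ h2.symm)
  exact (congrArg (· ≫ _) h1).trans ((brPrim k).artinIncl_aux V (idemElt k n) h)

variable (k) in
/-- The morphism from the primitives of the tensor algebra to the Artin functor. -/
noncomputable def artinHom (V : C) :
    ProObject.const (primitives (TA V)) ⟶ (brPrim k).artin V :=
  ProObject.ofCone ((brPrim k).artin V) (primitives (TA V)) (artinCone k V)
    fun h => artinCone_map V h

theorem gact_mul_idem (hV : FinitelyBraided V) {n : ℕ} {x : MonoidAlgebra k (B n)}
    (hx : toLevel k (kerQuot hV n) x ∈ (brPrim k).level (kerQuot hV n)) :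
    gact k V n x ≫ TA.inj V n ≫ primProj k hV = gact k V n x ≫ TA.inj V n := by
  rw [inj_primProj, ← Category.assoc, profAct_eq, ← gact_mul]
  congr 1
  refine gact_eq_of_toLevel_eq hV ?_
  rw [map_mul, toLevel_outLift]
  exact idem_mul k hx

/-- The computation is `e ⊗ a x = e a ⊗ x = a ⊗ x`, where the last step is `idem_mul`. -/
theorem gact_artinCone (hV : FinitelyBraided V) (Q : ∀ n, FinQuot n) (n : ℕ) {x : MonoidAlgebra k (B n)}
    (hx : toLevel k (kerQuot hV n) x ∈ (brPrim k).level (kerQuot hV n)) (a : (brPrim k).level (Q n))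
    (ha : toLevel k (Q n) x = a.1) :
    (gact k V n x ≫ TA.inj V n ≫ primRetr k hV) ≫ artinCone k V Q =
      (brPrim k).pieceIncl (Q n) V a ≫ Limits.Sigma.ι (fun n => (brPrim k).piece (Q n) V) n := by
  have h := gact_mul_idem hV hx
  rw [artinCone, Category.assoc, Category.assoc, ← Category.assoc (primRetr k hV), primRetr_ι,
    ← Category.assoc (TA.inj V n), ← Category.assoc (gact k V n x), h, Category.assoc,
    inj_idemMap, ← Category.assoc]
  congr 1
  refine (brPrim k).gact_pieceIncl _ _ _ _ _ ?_
  rw [ha]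
  exact idem_mul k a.2

/-- The components of the inverse of `artinCone`. -/
noncomputable def artinInvₗ (hV : FinitelyBraided V) {n : ℕ} (Q : FinQuot n) :
    (brPrim k).level Q →ₗ[k] (tp V n ⟶ primitives (TA V)) :=
  (Linear.rightComp k _ (TA.inj V n ≫ primRetr k hV)).comp
    ((gact k V n).comp ((outLiftₗ Q).comp ((brPrim k).level Q).subtype))

theorem artinInvₗ_apply (hV : FinitelyBraided V) {n : ℕ} (Q : FinQuot n) (a : (brPrim k).level Q) :
    artinInvₗ hV Q a = gact k V n (outLift a.1) ≫ TA.inj V n ≫ primRetr k hV := rfl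

/-- The inverse of `artinCone`. -/
noncomputable def artinInv (hV : FinitelyBraided V) (Q : ∀ n, FinQuot n) (hQ : ∀ n, Q n ≤ kerQuot hV n) :
    (∐ fun n => (brPrim k).piece (Q n) V) ⟶ primitives (TA V) :=
  Limits.Sigma.desc fun n => (brPrim k).pieceDesc (artinInvₗ hV (Q n)) fun i a => by
    rw [artinInvₗ_apply, artinInvₗ_apply, ← gact_of (k := k),
      ← Category.assoc (gact k V n (MonoidAlgebra.of k _ _)), ← gact_mul]
    congr 1
    refine gact_eq_of_toLevel_eq hV ?_
    rw [toLevel_outLift_of_le (hQ n), map_mul, toLevel_outLift_of_le (hQ n)]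
    change levelMap k (hQ n) (a.1 * braidClass k (Q n) (σ n i)) = _
    rw [map_mul, braidClass, levelMap_toLevel]
    rfl

theorem ι_artinInv (hV : FinitelyBraided V) (Q : ∀ n, FinQuot n) (hQ : ∀ n, Q n ≤ kerQuot hV n) (n : ℕ)
    (a : (brPrim k).level (Q n)) : (brPrim k).pieceIncl (Q n) V a ≫
      Limits.Sigma.ι (fun n => (brPrim k).piece (Q n) V) n ≫ artinInv hV Q hQ =
        gact k V n (outLift a.1) ≫ TA.inj V n ≫ primRetr k hV := by
  rw [artinInv, Limits.Sigma.ι_desc, BraidedSubseq.pieceIncl_desc, artinInvₗ_apply]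

/-- Mapping `x` to `e ⊗ x` and evaluating gives `e x`, which is the projection and thus the identity
on primitives. The bound on `Q` ensures that evaluation at this level is the action on `V^{⊗ n}`. -/
theorem artinCone_inv (hV : FinitelyBraided V) (Q : ∀ n, FinQuot n) (hQ : ∀ n, Q n ≤ kerQuot hV n) :
    artinCone k V Q ≫ artinInv hV Q hQ = 𝟙 _ := by
  have h : idemMap k V Q ≫ artinInv hV Q hQ =
        primProj k hV ≫ primRetr k hV := by
    refine TA.hom_ext fun n => ?_
    rw [← Category.assoc, inj_idemMap, Category.assoc, ι_artinInv, ← Category.assoc,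
      ← Category.assoc, inj_primProj, profAct_eq, Category.assoc, Category.assoc]
    congr 1
    refine gact_eq_of_toLevel_eq hV ?_
    rw [toLevel_outLift_of_le (hQ n), toLevel_outLift]
    exact (idem_mem k n).2 _ _ (hQ n)
  rw [artinCone, Category.assoc, h, ← primRetr_ι, Category.assoc, primι_retr, Category.comp_id,
    primι_retr]

theorem artinInv_cone (hV : FinitelyBraided V) (Q : ∀ n, FinQuot n) (hQ : ∀ n, Q n ≤ kerQuot hV n) :
    artinInv hV Q hQ ≫ artinCone k V Q = 𝟙 _ := by
  refine Limits.Sigma.hom_ext _ _ fun n => (brPrim k).piece_hom_ext fun a => ?_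
  rw [← Category.assoc, ← Category.assoc, Category.assoc (BraidedSubseq.pieceIncl _ _ _ _),
    ι_artinInv, gact_artinCone hV Q n _ a (toLevel_outLift _)]
  · exact congrArg (_ ≫ ·) (Category.comp_id _).symm
  · rw [toLevel_outLift_of_le (hQ n)]
    exact (brPrim k).levelMap_mem _ _ a.2

/-- At every level below the kernels of the braid actions the cone is an isomorphism, with inverse
`a ⊗ x ↦ a x`. So the inverse system is essentially constant. -/
theorem isIso_artinHom (hV : FinitelyBraided V) : IsIso (artinHom k V) :=
  ProObject.isIso_ofCone ((brPrim k).artin V) _ _ _ (fun n => kerQuot hV n)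
    (artinInv hV _ fun _ => le_rfl) (artinCone_inv hV _ _) fun (j : Levels) hj =>
      (SplitEpi.mk (artinInv hV j (leOfHom (X := Levels) hj)) (artinInv_cone hV _ _)).epi

theorem constMap_artinHom (hV : FinitelyBraided V) (n : ℕ) (a : (brPrim k).elements n) :
    ProObject.constMap (tpMap (primUnit V) n ≫ (tensorOpAlgebra k hV).act n a) ≫ artinHom k V =
      (brPrim k).artinIncl V a := by
  refine ProObject.constMap_ofCone _ _ _ _ _ _ fun (Q : Levels) => ?_
  rw [unit_tensorOpAlgebra, profAct_eq]
  obtain ⟨x, h1, h2⟩ := exists_lift a.2 (kerQuot hV n) (Q n)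
  rw [gact_eq_of_toLevel_eq hV (x := outLift _) (y := x) (by rw [toLevel_outLift, h1])]
  exact gact_artinCone hV Q n (h1 ▸ a.2.1 _) _ h2

end Artin

/-! ### The monad of the braided primitive operad -/

theorem foldMul_comp_hom {C : Type u} [Category.{v} C] [MonoidalCategory C] {V A A' : C} [MonObj A]
    [MonObj A'] (f : V ⟶ A) (φ : A ⟶ A') [IsMonHom φ] (n : ℕ) :
    foldMul f n ≫ φ = foldMul (f ≫ φ) n := by
  induction n with
  | zero => exact IsMonHom.one_hom φ
  | succ n ih =>
    change ((foldMul f n ⊗ₘ f) ≫ MonObj.mul) ≫ φ = (foldMul (f ≫ φ) n ⊗ₘ (f ≫ φ)) ≫ MonObj.mul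
    rw [Category.assoc, IsMonHom.mul_hom, ← Category.assoc, tensorHom_comp_tensorHom, ih]

section Monad

variable {k : Type*} [Field k] [CharZero k] {C : Type u} [Category.{v} C] [Abelian C] [Linear k C]
  [MonoidalCategory C] [BraidedCategory C] [MonoidalPreadditive C] [MonoidalLinear k C]
  [HasCountableCoproducts C] [TensorPreservesCountable C]

/-- The morphism of bialgebras that extends `f` respects products and commutes with braids. It
carries invariants of `R` to invariants of `R`, so both operations can be computed from the same
lift. -/
theorem tensorOpAlgebra_primExt {V W : C} (hV : FinitelyBraided V) (hW : FinitelyBraided W)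
    (f : V ⟶ primitives (TA W)) (n : ℕ) (a : (brPrim k).elements n) :
    (tensorOpAlgebra k hV).act n a ≫ primExt f =
      tpMap (primExt f) n ≫ (tensorOpAlgebra k hW).act n a := by
  rw [← cancel_mono (primι (TA W)), Category.assoc, Category.assoc, primExt_ι, tensorOpAlgebra_ι,
    ← Category.assoc, tensorOpAlgebra_ι, ← Category.assoc (tpMap (primExt f) n), ← tpMap_comp,
    primExt_ι, tpMap_comp]
  refine enoughFixed_tensorAlgebra k hV n _ _ _ fun Y u R hu => ?_
  have h1 := (tensorAlgebraAction k hV).comp_act hu (toLevel_outLift (a.1 R))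
  have h2 := (tensorAlgebraAction k hW).comp_act (hu.map (TA.lift (f ≫ primι (TA W))))
    (toLevel_outLift (a.1 R))
  have h3 : foldMul (𝟙 (TA V)) n ≫ TA.lift (f ≫ primι (TA W)) =
      tpMap (TA.lift (f ≫ primι (TA W))) n ≫ foldMul (𝟙 (TA W)) n := by
    rw [foldMul_comp_hom, tpMap_foldMul, Category.id_comp, Category.comp_id]
  simp only [Category.assoc] at h1 h2 ⊢
  rw [h3, reassoc_of% h1, reassoc_of% h2, ← Category.assoc (tpMap (TA.lift _) n), gact_naturality,
    Category.assoc]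

theorem restrictMonad_ext {V W : (FinitelyBraided (C := C)).FullSubcategory}
    (f : V.obj ⟶ primitives (TA W.obj)) :
    (restrictMonad (primMonad C) (FinitelyBraided (C := C)).ι).ext (X := V) (Y := W) f =
      primExt f := by
  change primExt (f ≫ primUnit _) ≫ primExt (𝟙 _) = _
  rw [primExt_comp, Category.assoc, primUnit_ext, Category.comp_id]

variable (k C) in
/-- The monad on the finitely braided objects defined by the braided primitive operad. -/
noncomputable def artinMonad : ArtinMonad (C := C) (isSuboperad_brPrim (k := k)) where
  toRelMonad := restrictMonad (primMonad C) (FinitelyBraided (C := C)).ι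
  iso V := @asIso _ _ _ _ (artinHom k V.obj) (isIso_artinHom (k := k) V.property)
  op V := tensorOpAlgebra k V.property
  op_unit V n a := constMap_artinHom V.property n a
  op_ext {V W} f n a := by
    rw [restrictMonad_ext f]
    exact tensorOpAlgebra_primExt V.property W.property f n a

end Monad

/-! ### Uniqueness of the monad -/

section Words

variable {k : Type*} [Field k] [CharZero k] {C : Type u} [Category.{v} C] [Abelian C] [Linear k C]
  [MonoidalCategory C] [BraidedCategory C] [MonoidalPreadditive C] [HasCountableCoproducts C]
  [TensorPreservesCountable C]

/-- The tensor product of values of the canonical idempotents on generators. -/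
noncomputable def idemTensor {W X : C} (θ : OpAlgebra (isSuboperad_brPrim (k := k)) X) (u : W ⟶ X) :
    ∀ {n : ℕ} (s : Idx n), tpPiece W s ⟶ tp X n
  | 0, _ => 𝟙 _
  | _ + 1, s => idemTensor θ u s.1 ⊗ₘ (tpMap u s.2 ≫ θ.act s.2 (idemElt k s.2))

theorem exists_tpc_act {n m : ℕ} (h : n = m) (a : (brPrim k).elements m) :
    ∃ b : (brPrim k).elements n, ∀ (X : C) (θ : OpAlgebra (isSuboperad_brPrim (k := k)) X),
      (tpc X h).hom ≫ θ.act m a = θ.act n b := by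
  subst h
  exact ⟨a, fun X θ => Category.id_comp _⟩

/-- By operadic composition, an operation applied to values of idempotents on generators is an
operation applied to generators. The morphism `c` and the element `b` are independent of `θ` and
`u`, so the formula can be compared between two algebras. -/
theorem idemTensor_append {W : C} {n : ℕ} (s : Idx n) (t : ℕ) (a : (brPrim k).elements (n + t)) :
    ∃ (N : ℕ) (c : tpPiece W s ⊗ tp W t ⟶ tp W N) (b : (brPrim k).elements N),
      ∀ (X : C) (θ : OpAlgebra (isSuboperad_brPrim (k := k)) X) (u : W ⟶ X),
        (idemTensor θ u s ⊗ₘ tpMap u t) ≫ (tpAdd X n t).hom ≫ θ.act (n + t) a =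
          c ≫ tpMap u N ≫ θ.act N b := by
  induction n generalizing t with
  | zero =>
    refine ⟨0 + t, (tpAdd W 0 t).hom, a, fun X θ u => ?_⟩
    change (𝟙 _ ⊗ₘ tpMap u t) ≫ (tpAdd X 0 t).hom ≫ _ = _
    have h : (𝟙 _ ⊗ₘ tpMap u t) ≫ (tpAdd X 0 t).hom = (tpAdd W 0 t).hom ≫ tpMap u (0 + t) :=
      tpAdd_naturality u 0 t
    rw [← Category.assoc, h, Category.assoc]
    rfl
  | succ n ih =>
    obtain ⟨s, m⟩ := s
    obtain ⟨b', hb'⟩ := exists_tpc_act (C := C) (show n + (m + t) = n + m + t by omega)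
      ⟨operadComp n m t a.1 (idem k m),
        isSuboperad_brPrim.comp_mem n m t a.1 _ a.2 (idem_mem k m)⟩
    obtain ⟨N, c, b, h⟩ := ih s (m + t) b'
    refine ⟨N, (α_ (tpPiece W s) (tp W m) (tp W t)).hom ≫ tpPiece W s ◁ (tpAdd W m t).hom ≫ c, b,
      fun X θ u => ?_⟩
    have e := tpIncl_append_aux X n m t (idemTensor θ u s) u (θ.act m (idemElt k m)) (by omega)
    have e2 := θ.act_comp n m t a (idemElt k m)
    have e3 := h X θ u
    rw [← hb' X θ] at e3
    change ((idemTensor θ u s ⊗ₘ (tpMap u m ≫ θ.act m (idemElt k m))) ⊗ₘ tpMap u t) ≫ _ ≫ _ = _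
    rw [← Category.assoc, ← e]
    simp only [Category.assoc] at e3 ⊢
    rw [← e2]
    exact (congrArg (fun z => (α_ (tpPiece W s) (tp W m) (tp W t)).hom ≫
      tpPiece W s ◁ (tpAdd W m t).hom ≫ z) e3).trans
        ((Category.assoc _ _ _).trans (congrArg (_ ≫ ·) (Category.assoc _ _ _))).symm

theorem idemTensor_act {W : C} {n : ℕ} (s : Idx n) (a : (brPrim k).elements n) :
    ∃ (N : ℕ) (c : tpPiece W s ⟶ tp W N) (b : (brPrim k).elements N),
      ∀ (X : C) (θ : OpAlgebra (isSuboperad_brPrim (k := k)) X) (u : W ⟶ X),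
        idemTensor θ u s ≫ θ.act n a = c ≫ tpMap u N ≫ θ.act N b := by
  obtain ⟨N, c, b, h⟩ := idemTensor_append (W := W) s 0 a
  refine ⟨N, (ρ_ _).inv ≫ c, b, fun X θ u => ?_⟩
  have h2 := h X θ u
  change (idemTensor θ u s ⊗ₘ 𝟙 _) ≫ (ρ_ _).hom ≫ θ.act n a = _ at h2
  rw [tensorHom_id, rightUnitor_naturality_assoc] at h2
  rw [Category.assoc, ← h2, Iso.inv_hom_id_assoc]

end Words

/-! ### The comparison with the monad of primitives -/

section Unique

variable {k : Type*} [Field k] [CharZero k] {C : Type u} [Category.{v} C] [Abelian C] [Linear k C]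
  [MonoidalCategory C] [BraidedCategory C] [MonoidalPreadditive C] [MonoidalLinear k C]
  [HasCountableCoproducts C] [TensorPreservesCountable C]

theorem primProj_retr {V : C} (hV : FinitelyBraided V) :
    primProj k hV ≫ primRetr k hV = primRetr k hV := by
  rw [← primRetr_ι, Category.assoc, primι_retr, Category.comp_id]

theorem unit_idemElt {V : C} (hV : FinitelyBraided V) (n : ℕ) :
    tpMap (primUnit V) n ≫ (tensorOpAlgebra k hV).act n (idemElt k n) =
      TA.inj V n ≫ primRetr k hV := by
  rw [unit_tensorOpAlgebra]
  change profAct hV (idem k n) ≫ _ = _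
  rw [← Category.assoc, ← inj_primProj, Category.assoc, primProj_retr]

theorem idemTensor_tensorOpAlgebra {V : C} (hV : FinitelyBraided V) {n : ℕ} (s : Idx n) :
    idemTensor (tensorOpAlgebra k hV) (primUnit V) s = tpIncl V s ≫ tpMap (primRetr k hV) n := by
  induction n with
  | zero => exact (Category.comp_id _).symm
  | succ n ih =>
    obtain ⟨s, m⟩ := s
    change (idemTensor _ _ s ⊗ₘ (tpMap (primUnit V) m ≫ (tensorOpAlgebra k hV).act m (idemElt k m))) =
      (tpIncl V s ⊗ₘ TA.inj V m) ≫ (tpMap (primRetr k hV) n ⊗ₘ primRetr k hV)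
    rw [ih, unit_idemElt, tensorHom_comp_tensorHom]

/-- The values of the idempotents on generators cover `P(T(V))`: they are the images of the summands
of `T(V)` under the retraction. -/
theorem idemTensor_jointly_epi {V : C} (hV : FinitelyBraided V) {n : ℕ} {Z : C}
    {f g : tp (primitives (TA V)) n ⟶ Z}
    (h : ∀ s, idemTensor (tensorOpAlgebra k hV) (primUnit V) s ≫ f =
      idemTensor (tensorOpAlgebra k hV) (primUnit V) s ≫ g) : f = g := by
  have e : tpMap (primι (TA V)) n ≫ tpMap (primRetr k hV) n = 𝟙 _ := by
    rw [← tpMap_comp, primι_retr, tpMap_id]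
  rw [← Category.id_comp f, ← Category.id_comp g, ← e, Category.assoc, Category.assoc]
  congr 1
  refine tpIncl_ext V fun s => ?_
  simpa only [idemTensor_tensorOpAlgebra, Category.assoc] using h s

namespace ArtinMonad

variable (M : ArtinMonad (C := C) (isSuboperad_brPrim (k := k)))

/-- Both objects are identified with the same Artin functor, compatibly with the morphisms `x ↦ a ⊗
x`, and objects embed fully faithfully as constant pro-objects. -/
theorem exists_comparison (V : (FinitelyBraided (C := C)).FullSubcategory) :
    ∃ e : M.obj V ≅ primitives (TA V.obj), ∀ n (a : (brPrim k).elements n),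
      (tpMap (M.unit V) n ≫ (M.op V).act n a) ≫ e.hom =
        tpMap (primUnit V.obj) n ≫ (tensorOpAlgebra k V.property).act n a := by
  have := isIso_artinHom (k := k) V.property
  obtain ⟨e, he⟩ := ProObject.exists_iso (M.iso V ≪≫ (asIso (artinHom k V.obj)).symm)
  refine ⟨e, fun n a => ProObject.constMap_injective ?_⟩
  rw [← cancel_mono (artinHom k V.obj), constMap_artinHom, ← ProObject.constMap_comp, he,
    Iso.trans_hom, Iso.symm_hom, asIso_inv, Category.assoc, Category.assoc, IsIso.inv_hom_id,
    Category.comp_id, M.op_unit]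

/-- The comparison isomorphism. -/
noncomputable def comparison (V : (FinitelyBraided (C := C)).FullSubcategory) :
    M.obj V ≅ primitives (TA V.obj) := (M.exists_comparison V).choose

theorem op_comparison (V : (FinitelyBraided (C := C)).FullSubcategory) (n : ℕ)
    (a : (brPrim k).elements n) :
    (tpMap (M.unit V) n ≫ (M.op V).act n a) ≫ (M.comparison V).hom =
      tpMap (primUnit V.obj) n ≫ (tensorOpAlgebra k V.property).act n a :=
  (M.exists_comparison V).choose_spec n a

theorem idemTensor_comparison (V : (FinitelyBraided (C := C)).FullSubcategory) {n : ℕ} (s : Idx n) :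
    idemTensor (M.op V) (M.unit V) s ≫ tpMap (M.comparison V).hom n =
      idemTensor (tensorOpAlgebra k V.property) (primUnit V.obj) s := by
  induction n with
  | zero => exact Category.comp_id _
  | succ n ih =>
    obtain ⟨s, m⟩ := s
    change (idemTensor _ _ s ⊗ₘ (tpMap (M.unit V) m ≫ (M.op V).act m (idemElt k m))) ≫
      (tpMap (M.comparison V).hom n ⊗ₘ (M.comparison V).hom) = (idemTensor _ _ s ⊗ₘ
        (tpMap (primUnit V.obj) m ≫ (tensorOpAlgebra k V.property).act m (idemElt k m)))
    rw [tensorHom_comp_tensorHom, ih, op_comparison]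

/-- A priori the comparison respects operations only on generators. Tensors of idempotent values on
generators are jointly epimorphic, and `idemTensor_act` rewrites an operation on them as an
operation on generators, in the same way in both algebras. -/
theorem act_comparison (V : (FinitelyBraided (C := C)).FullSubcategory) (n : ℕ)
    (a : (brPrim k).elements n) : (M.op V).act n a ≫ (M.comparison V).hom =
      tpMap (M.comparison V).hom n ≫ (tensorOpAlgebra k V.property).act n a := by
  have e1 : tpMap (M.comparison V).inv n ≫ tpMap (M.comparison V).hom n = 𝟙 _ := by
    rw [← tpMap_comp, Iso.inv_hom_id, tpMap_id]
  have e2 : tpMap (M.comparison V).hom n ≫ tpMap (M.comparison V).inv n = 𝟙 _ := by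
    rw [← tpMap_comp, Iso.hom_inv_id, tpMap_id]
  suffices h : tpMap (M.comparison V).inv n ≫ (M.op V).act n a ≫ (M.comparison V).hom =
      (tensorOpAlgebra k V.property).act n a by
    rw [← h, reassoc_of% e2]
  refine idemTensor_jointly_epi (k := k) V.property fun s => ?_
  obtain ⟨N, c, b, h⟩ := idemTensor_act (W := V.obj) s a
  have h1 := h _ (M.op V) (M.unit V)
  have h2 := op_comparison M V N b
  rw [h _ (tensorOpAlgebra k V.property), ← idemTensor_comparison M V, Category.assoc,
    reassoc_of% e2, reassoc_of% h1, ← Category.assoc (tpMap _ N), h2]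

theorem unit_comparison (V : (FinitelyBraided (C := C)).FullSubcategory) :
    M.unit V ≫ (M.comparison V).hom = primUnit V.obj := by
  have h : ∀ {X : C} (θ : OpAlgebra (isSuboperad_brPrim (k := k)) X) (u : V.obj ⟶ X),
      tpMap u 1 ≫ θ.act 1 ⟨fun _ => 1, isSuboperad_brPrim.one_mem⟩ = (λ_ V.obj).hom ≫ u := by
    intro X θ u
    rw [θ.act_one]
    change (𝟙 _ ⊗ₘ u) ≫ _ = _
    rw [id_tensorHom, leftUnitor_naturality]
  have h2 := M.op_comparison V 1 ⟨fun _ => 1, isSuboperad_brPrim.one_mem⟩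
  have h3 := h (M.op V) (M.unit V)
  have h4 := h (tensorOpAlgebra k V.property) (primUnit V.obj)
  rw [h4] at h2
  rw [← cancel_epi (λ_ V.obj).hom, ← h2, ← Category.assoc]
  exact congrArg (· ≫ (M.comparison V).hom) h3.symm

/-- Both sides come from morphisms of algebras that agree on the generators. They therefore agree on
the values of the idempotents, which cover `P(T(V))`. -/
theorem ext_comparison {V W : (FinitelyBraided (C := C)).FullSubcategory}
    (f : V.obj ⟶ M.obj W) : M.ext (X := V) (Y := W) f ≫ (M.comparison W).hom =
      (M.comparison V).hom ≫ primExt (f ≫ (M.comparison W).hom) := by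
  suffices h : (M.comparison V).inv ≫ M.ext (X := V) (Y := W) f ≫ (M.comparison W).hom =
      primExt (f ≫ (M.comparison W).hom) by
    rw [← h, Iso.hom_inv_id_assoc]
  have e : primι (TA V.obj) ≫ primRetr k V.property = 𝟙 _ := primι_retr k V.property
  rw [← Category.id_comp (primExt _), ← Category.id_comp ((M.comparison V).inv ≫ _), ← e,
    Category.assoc, Category.assoc]
  congr 1
  refine TA.hom_ext fun n => ?_
  have h1 := M.op_comparison V n (idemElt k n)
  have h2 := M.op_ext (V := V) (W := W) f n (idemElt k n)
  have h3 : tpMap (M.unit V) n ≫ tpMap (M.ext (X := V) (Y := W) f) n = tpMap f n :=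
    (tpMap_comp _ _ n).symm.trans (congrArg (tpMap · n) (M.unit_ext (X := V) (Y := W) f))
  have h4 := M.act_comparison W n (idemElt k n)
  have h5 := tensorOpAlgebra_primExt V.property W.property (f ≫ (M.comparison W).hom) n
    (idemElt k n)
  have h6 : tpMap (primUnit V.obj) n ≫ tpMap (primExt (f ≫ (M.comparison W).hom)) n =
      tpMap f n ≫ tpMap (M.comparison W).hom n := by
    rw [← tpMap_comp, primUnit_ext, tpMap_comp]
  have h7 : (tpMap (primUnit V.obj) n ≫ (tensorOpAlgebra k V.property).act n (idemElt k n)) ≫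
      (M.comparison V).inv = tpMap (M.unit V) n ≫ (M.op V).act n (idemElt k n) := by
    rw [Iso.comp_inv_eq, h1]
  rw [← Category.assoc (TA.inj _ n), ← Category.assoc (TA.inj _ n), ← unit_idemElt V.property n,
    Category.assoc, Category.assoc, h5, reassoc_of% h6, ← h4, ← reassoc_of% h3, ← reassoc_of% h2,
    ← Category.assoc (tpMap (M.unit V) n), ← h7]
  simp only [Category.assoc]

/-- Each monad defined by the braided primitive operad is the monad of primitives. -/
noncomputable def isoPrimMonad : M.toRelMonad.Iso
    (restrictMonad (primMonad C) (FinitelyBraided (C := C)).ι) where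
  app V := M.comparison V
  unit V := M.unit_comparison V
  ext {V W} f := (M.ext_comparison f).trans
    (congrArg ((M.comparison V).hom ≫ ·) (restrictMonad_ext (f ≫ (M.comparison W).hom)).symm)

end ArtinMonad

end Unique

end BraidedPrim

theorem mainTheorem8 {k : Type*} [Field k] [CharZero k] {C : Type u} [Category.{v} C] [Abelian C]
    [Linear k C] [MonoidalCategory C] [BraidedCategory C] [MonoidalPreadditive C]
    [MonoidalLinear k C] [HasCountableCoproducts C] [BraidedPrim.TensorPreservesCountable C] :
    ∃ hO : BraidedPrim.IsSuboperad (BraidedPrim.brPrim k),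
      Nonempty (BraidedPrim.ArtinMonad (C := C) hO) ∧
      (∀ M : BraidedPrim.ArtinMonad (C := C) hO,
        Nonempty (M.toRelMonad.Iso (BraidedPrim.restrictMonad (BraidedPrim.primMonad C)
          (BraidedPrim.FinitelyBraided (C := C)).ι))) ∧
      ∀ (A : C) [BimonObj A] (hA : BraidedPrim.FinitelyBraided A),
        ∃ θ : BraidedPrim.OpAlgebra hO (BraidedPrim.primitives A), θ.IsContinuous ∧
          ∀ (n : ℕ) (a : (BraidedPrim.brPrim k).elements n),
            θ.act n a ≫ BraidedPrim.primι A =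
              BraidedPrim.tpMap (BraidedPrim.primι A) n ≫ BraidedPrim.profAct hA a.1 ≫
                BraidedPrim.foldMul (𝟙 A) n :=
  ⟨BraidedPrim.isSuboperad_brPrim, ⟨BraidedPrim.artinMonad k C⟩, fun M => ⟨M.isoPrimMonad⟩,
    fun A _ hA => ⟨BraidedPrim.primOpAlgebra (BraidedPrim.profiniteAction hA)
      (BraidedPrim.enoughFixed_of_finitelyBraided _ hA), BraidedPrim.primOpAlgebra_isContinuous hA,
      fun n a => BraidedPrim.primOp_ι (BraidedPrim.profiniteAction hA)
        (BraidedPrim.enoughFixed_of_finitelyBraided (BraidedPrim.primι A) hA) n a⟩⟩
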